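/- **Setup.** Let $\ell\ge 1$, $I=\{0,1,\dots,\ell\}$, $J=\{0,\dots,\ell-1\}$. Let $\Lambda$ be the algebra over $\mathbb C$ of symmetric functions in $x_1,x_2,\dots$, with Schur functions $\mathsf s_\lambda$ and the bilinear form $\langle\cdot,\cdot\rangle$ such that $\langle \mathsf s_\lambda,\mathsf s_\mu\rangle=\delta_{\lambda,\mu}$. Let $\Omega\subset\Lambda$ be the subalgebra generated by the odd power sums $\mathsf p_1,\mathsf p_3,\mathsf p_5,\dots$, with its bases $\mathsf P_\lambda$ and $\mathsf Q_\lambda=2^{h(\lambda)}\mathsf P_\lambda$ of Schur $P$- and $Q$-functions indexed by strict partitions $\lambda$ (partitions with distinct nonzero parts, $h(\lambda)$ being the number of nonzero parts), and the bilinear form $[\cdot,\cdot]$ such that $[\mathsf P_\lambda,\mathsf Q_\mu]=\delta_{\lambda,\mu}$. Put $\mathsf{Sym}^I=\Omega\otimes\Lambda^{(1)}\otimes\dots\otimes\Lambda^{(\ell)}$, where each $\Lambda^{(i)}$ is a copy of $\Lambda$, with the bilinear form $$(f_0\otimes\dots\otimes f_\ell,\ g_0\otimes\dots\otimes g_\ell)_{\mathsf{Sym}}=[f_0,g_0]\,\langle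 f_1,g_1\rangle\cdots\langle f_\ell,g_\ell\rangle .$$ Let $\mathscr P^I_0(d)$ be the set of tuples $\underline\lambda=(\lambda^{(0)},\dots,\lambda^{(\ell)})$ of partitions of total size $d$ such that $\lambda^{(0)}$ is strict. Such a tuple is identified with the set of nodes $(i,r,s)$ with $i\in I$, $r\geq 1$ and $1\le s\le\lambda^{(i)}_r$ (component $i$, row $r$, column $s$). For $\underline\lambda\in\mathscr P^I_0(d)$ put $\pi_{\underline\lambda}=\mathsf P_{\lambda^{(0)}}\otimes \mathsf s_{\lambda^{(1)}}\otimes\dots\otimes \mathsf s_{\lambda^{(\ell)}}$. For $n\ge 1$ and $d\ge 0$, a *colored composition* of $d$ with $n$ parts is a pair $(\mu,\boldsymbol j)$ with $\mu=(\mu_1,\dots,\mu_n)\in\mathbb Z_{\ge0}^n$, $\mu_1+\dots+\mu_n=d$, and $\boldsymbol j=(j_1,\dots,j_n)\in J^n$. For $\underline\lambda\in\mathscr P^I_0(d)$, a *colored tableau* of shape $\underline\lambda$ and type $(\mu,\boldsymbol j)$ is a map $T:\underline\lambda\to\mathbb Z_{>0}$ such that 1. $T(i,r,s)\le T(i,r,s+1)$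 and $T(i,r,s)\le T(i,r+1,s)$ whenever both nodes belong to $\underline\lambda$; moreover $T(0,r,s+1)\le T(0,r+1,s)$ whenever both nodes belong to $\underline\lambda$ (equivalently, given the previous inequalities, for every $k$ the nodes of $\lambda^{(0)}$ with entry at most $k$ form the diagram of a strict partition); 2. for $k=1,\dots,n$ we have $|T^{-1}(k)|=\mu_k$, and all nodes of $T^{-1}(k)$ lie in the components $j_k$ and $j_k+1$; 3. for $k=1,\dots,n$, no two nodes of $T^{-1}(k)$ in component $j_k$ are in the same column, and no two nodes of $T^{-1}(k)$ in component $j_k+1$ are in the same row. For such $T$ let $q(T)=\sum_{k=1}^n q_k(T)$, where $q_k(T)$ is the number of $r\ge1$ such that $T^{-1}(k)\cap\lambda^{(0)}$ contains a node in column $r$ but none in column $r+1$. Define $$K(\underline\lambda;\mu,\boldsymbol j)=\sum_T 2^{q(T)},\qquad \Pi_{\mu,\boldsymbol j}=\sum_{\underline\lambda\in\mathscr P^I_0(d)}K(\underline\lambda;\mu,\boldsymbol j)\,\pi_{\underline\lambda},\qquad \Pi_{\omega_d}=\sum_{\boldsymbol i\in J^d}\Pi_{\omega_d,\boldsymbol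 i},$$ where $T$ runs over the colored tableaux of shape $\underline\lambda$ and type $(\mu,\boldsymbol j)$, and $\omega_d=(1,\dots,1)$ is the composition of $d$ with $d$ parts equal to $1$. (For $d=0$, $J^0$ has one element and $\Pi_{\omega_0}=1$.) Let $|\mu,\boldsymbol j|_{\ell-1}=\sum_{r:\,j_r=\ell-1}\mu_r$. **Theorem.** For every colored composition $(\mu,\boldsymbol j)$ of $d$ with $n$ parts, $$(\Pi_{\mu,\boldsymbol j},\Pi_{\omega_d})_{\mathsf{Sym}}=\frac{d!}{\mu_1!\cdots\mu_n!}\;4^{\,d-|\mu,\boldsymbol j|_{\ell-1}}\;3^{\,|\mu,\boldsymbol j|_{\ell-1}} .$$ -/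

import Mathlib

open scoped TensorProduct

noncomputable section

namespace ColoredSym

/-! ### Symmetric functions in the variables `x_0, x_1, …` over `ℂ` -/

/-- The algebra `Λ` of symmetric functions: the power series in countably many variables that have
bounded degree and are invariant under all permutations of the variables. -/
def Lam : Subalgebra ℂ (MvPowerSeries ℕ ℂ) where
  carrier := {f | (∀ e : Equiv.Perm ℕ, MvPowerSeries.renameEquiv ℂ e f = f) ∧
    ∃ N : ℕ, ∀ m : ℕ →₀ ℕ, N < m.degree → MvPowerSeries.coeff m f = 0}
  mul_mem' := by
    rintro f g ⟨hf, N, hN⟩ ⟨hg, M, hM⟩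
    refine ⟨fun e => by rw [map_mul, hf, hg], N + M, fun m hm => ?_⟩
    classical
    rw [MvPowerSeries.coeff_mul]
    refine Finset.sum_eq_zero fun x hx => ?_
    rw [Finset.HasAntidiagonal.mem_antidiagonal] at hx
    have hd : x.1.degree + x.2.degree = m.degree := by rw [← hx, map_add]
    by_cases h1 : N < x.1.degree
    · rw [hN _ h1, zero_mul]
    · rw [hM _ (by omega), mul_zero]
  add_mem' := by
    rintro f g ⟨hf, N, hN⟩ ⟨hg, M, hM⟩
    refine ⟨fun e => by rw [map_add, hf, hg], N + M, fun m hm => ?_⟩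
    rw [map_add, hN _ (by omega), hM _ (by omega), add_zero]
  algebraMap_mem' := by
    intro r
    refine ⟨fun e => AlgEquiv.commutes _ r, 0, fun m hm => ?_⟩
    classical
    rw [MvPowerSeries.algebraMap_apply, MvPowerSeries.coeff_C, if_neg]
    rintro rfl
    simp at hm

theorem coeff_renameEquiv (e : Equiv.Perm ℕ) (f : MvPowerSeries ℕ ℂ) (m : ℕ →₀ ℕ) :
    MvPowerSeries.coeff m (MvPowerSeries.renameEquiv ℂ e f) =
      MvPowerSeries.coeff (m.equivMapDomain e.symm) f := by
  have h := MvPowerSeries.coeff_embDomain_rename (e := e.toEmbedding) f (m.equivMapDomain e.symm)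
  have h2 : Finsupp.embDomain e.toEmbedding (m.equivMapDomain e.symm) = m := by
    rw [Finsupp.embDomain_eq_mapDomain, Finsupp.equivMapDomain_eq_mapDomain]
    rw [← Finsupp.mapDomain_comp]
    have : (⇑e.toEmbedding ∘ ⇑e.symm) = id := by ext; simp
    rw [this, Finsupp.mapDomain_id]
  rw [h2] at h
  exact h

/-- The symmetric function, homogeneous of degree `n`, with prescribed permutation invariant
coefficients `c`. -/
def homogeneous (n : ℕ) (c : (ℕ →₀ ℕ) → ℂ)
    (hc : ∀ (e : Equiv.Perm ℕ) (m : ℕ →₀ ℕ), c (m.equivMapDomain e) = c m) : Lam :=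
  ⟨(fun m => if m.degree = n then c m else 0 : MvPowerSeries ℕ ℂ), by
    refine ⟨fun e => ?_, n, fun m hm => ?_⟩
    · ext m
      refine (coeff_renameEquiv e _ m).trans ?_
      change (if (m.equivMapDomain e.symm).degree = n then _ else _) = if m.degree = n then _ else _
      rw [hc, Finsupp.equivMapDomain_eq_mapDomain, Finsupp.degree_mapDomain]
    · change (if m.degree = n then _ else _) = _
      rw [if_neg (by omega)]⟩

/-- The power sum `p_k = ∑ i, x_i ^ k` (used for `k ≥ 1`). -/
def powerSum (k : ℕ) : Lam :=
  open Classical in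
  homogeneous k (fun m => if ∃ i, m = Finsupp.single i k then 1 else 0) (by
    intro e m
    congr 1
    refine propext ⟨?_, ?_⟩
    · rintro ⟨i, hi⟩
      refine ⟨e.symm i, ?_⟩
      have := congrArg (Finsupp.equivMapDomain e.symm) hi
      rwa [← Finsupp.equivMapDomain_trans, Equiv.self_trans_symm, Finsupp.equivMapDomain_refl,
        Finsupp.equivMapDomain_single] at this
    · rintro ⟨i, rfl⟩
      exact ⟨e i, Finsupp.equivMapDomain_single _ _ _⟩)

/-- The complete symmetric function `h_r`, the sum of all monomials of degree `r`. -/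
def complete (r : ℕ) : Lam := homogeneous r (fun _ => 1) (fun _ _ => rfl)

/-- `h_z` for an integer index, with `h_z = 0` for `z < 0`. -/
def completeInt (z : ℤ) : Lam := if z < 0 then 0 else complete z.toNat

/-- The Schur function `s_μ = det (h_{μ_i - i + j})`. -/
def schur (μ : YoungDiagram) : Lam :=
  Matrix.det (Matrix.of fun i j : Fin (μ.colLen 0) =>
    completeInt ((μ.rowLen i : ℤ) - (i : ℤ) + (j : ℤ)))

/-- The subalgebra `Ω` of `Λ` generated by the odd power sums `p_1, p_3, p_5, …`. -/
def Omega : Subalgebra ℂ Lam := Algebra.adjoin ℂ {f | ∃ k : ℕ, Odd k ∧ f = powerSum k}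

/-- The symmetric function `q_r`, as an element of `Λ`: the coefficient of `t ^ r` in
`∏ i, (1 + x_i t) / (1 - x_i t) = ∏ i, (1 + 2 x_i t + 2 x_i ^ 2 t ^ 2 + ⋯)`. Thus a monomial of
degree `r` that involves exactly `s` variables has coefficient `2 ^ s`. -/
def qLam (r : ℕ) : Lam :=
  homogeneous r (fun m => 2 ^ m.support.card) (by
    intro e m
    simp [Finsupp.equivMapDomain])

theorem coeff_qLam (r : ℕ) (m : ℕ →₀ ℕ) : MvPowerSeries.coeff m (qLam r : MvPowerSeries ℕ ℂ) =
    if m.degree = r then 2 ^ m.support.card else 0 := rfl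

open Classical in
theorem coeff_powerSum (k : ℕ) (m : ℕ →₀ ℕ) :
    MvPowerSeries.coeff m (powerSum k : MvPowerSeries ℕ ℂ) =
      if ∃ i, m = Finsupp.single i k then 1 else 0 := by
  change (if m.degree = k then (if _ then _ else _) else _) = _
  by_cases h : ∃ i, m = Finsupp.single i k
  · obtain ⟨i, rfl⟩ := h
    simp
  · simp [h]

theorem coeff_powerSum_mul (k : ℕ) (hk : 0 < k) (g : MvPowerSeries ℕ ℂ) (m : ℕ →₀ ℕ) :
    MvPowerSeries.coeff m ((powerSum k : MvPowerSeries ℕ ℂ) * g) =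
      ∑ i ∈ m.support, if k ≤ m i then MvPowerSeries.coeff (m - Finsupp.single i k) g else 0 := by
  classical
  rw [MvPowerSeries.coeff_mul, ← Finset.sum_filter]
  symm
  refine Finset.sum_of_injOn (fun i => (Finsupp.single i k, m - Finsupp.single i k)) ?_ ?_ ?_ ?_
  · intro i _ j _ hij
    exact (Finsupp.single_left_inj hk.ne').1 (Prod.ext_iff.1 hij).1
  · intro i hi
    simp only [Finset.coe_filter, Set.mem_ofPred_eq] at hi
    simp only [Finset.mem_coe, Finset.HasAntidiagonal.mem_antidiagonal]
    exact add_tsub_cancel_of_le (Finsupp.single_le_iff.2 hi.2)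
  · rintro ⟨a, b⟩ hab hn
    rw [coeff_powerSum]
    rw [if_neg, zero_mul]
    rintro ⟨i, rfl⟩
    rw [Finset.HasAntidiagonal.mem_antidiagonal] at hab
    simp only at hab
    apply hn
    have hle : k ≤ m i := by rw [← hab]; simp
    refine ⟨i, ?_, ?_⟩
    · simp only [Finset.coe_filter, Set.mem_ofPred_eq, Finsupp.mem_support_iff]
      omega
    · simp [← hab]
  · intro i _
    rw [coeff_powerSum, if_pos ⟨i, rfl⟩, one_mul]

theorem sum_odd_weight (a : ℕ) :
    ∑ k ∈ (Finset.range (a + 1)).filter Odd, (if k < a then 2 else 1) = a := by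
  have h : ∀ b : ℕ, ∑ k ∈ (Finset.range b).filter Odd, 2 = 2 * (b / 2) := by
    intro b
    induction b with
    | zero => simp
    | succ b ih =>
      rw [Finset.range_add_one, Finset.filter_insert]
      split_ifs with hb
      · rw [Finset.sum_insert (by simp), ih]
        obtain ⟨c, rfl⟩ := hb
        omega
      · rw [ih]
        rw [Nat.not_odd_iff_even] at hb
        obtain ⟨c, rfl⟩ := hb
        omega
  have h2 : ∑ k ∈ (Finset.range a).filter Odd, (if k < a then 2 else 1) = 2 * (a / 2) := by
    rw [← h a]
    refine Finset.sum_congr rfl fun k hk => ?_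
    rw [if_pos (by simpa using (Finset.mem_filter.1 hk).1)]
  rw [Finset.range_add_one, Finset.filter_insert]
  split_ifs with hb
  · rw [Finset.sum_insert (by simp), h2]
    obtain ⟨c, rfl⟩ := hb
    simp
    omega
  · rw [h2]
    rw [Nat.not_odd_iff_even] at hb
    obtain ⟨c, rfl⟩ := hb
    omega

theorem qLam_recursion (n : ℕ) :
    (n : ℂ) • qLam n = (2 : ℂ) • ∑ k ∈ (Finset.range (n + 1)).filter Odd,
      powerSum k * qLam (n - k) := by
  apply Subtype.ext
  ext m
  simp only [SetLike.val_smul, AddSubmonoidClass.coe_finsetSum, MulMemClass.coe_mul, map_smul,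
    map_sum, smul_eq_mul]
  have step : ∀ k ∈ (Finset.range (n + 1)).filter Odd,
      MvPowerSeries.coeff m ((powerSum k : MvPowerSeries ℕ ℂ) * (qLam (n - k) : MvPowerSeries ℕ ℂ))
      = ∑ i ∈ m.support, if k ≤ m i then
          (if m.degree = n then (2 : ℂ) ^ (m - Finsupp.single i k).support.card else 0) else 0 := by
    intro k hk
    rw [Finset.mem_filter, Finset.mem_range] at hk
    rw [coeff_powerSum_mul k hk.2.pos]
    refine Finset.sum_congr rfl fun i _ => ?_
    split_ifs with h1
    · rw [coeff_qLam, if_pos]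
      have h3 := congrArg Finsupp.degree (tsub_add_cancel_of_le (Finsupp.single_le_iff.2 h1))
      rw [map_add, Finsupp.degree_single] at h3
      omega
    · rw [coeff_qLam, if_neg]
      have h3 := congrArg Finsupp.degree (tsub_add_cancel_of_le (Finsupp.single_le_iff.2 h1))
      rw [map_add, Finsupp.degree_single] at h3
      omega
    · rfl
  rw [Finset.sum_congr rfl step, coeff_qLam]
  by_cases hm : m.degree = n
  · simp only [hm, if_true]
    rw [Finset.sum_comm, Finset.mul_sum]
    have inner : ∀ i ∈ m.support, 2 * ∑ k ∈ (Finset.range (n + 1)).filter Odd,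
        (if k ≤ m i then (2 : ℂ) ^ (m - Finsupp.single i k).support.card else 0) =
        2 ^ m.support.card * (m i : ℂ) := by
      intro i hi
      have hle : m i ≤ n := hm ▸ Finsupp.le_degree i m
      have hcard : 0 < m.support.card := Finset.card_pos.2 ⟨i, hi⟩
      have e1 : ∑ k ∈ (Finset.range (n + 1)).filter Odd,
          (if k ≤ m i then (2 : ℂ) ^ (m - Finsupp.single i k).support.card else 0) =
          ∑ k ∈ (Finset.range (m i + 1)).filter Odd,
            (2 : ℂ) ^ (m - Finsupp.single i k).support.card := by
        rw [← Finset.sum_filter]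
        refine Finset.sum_congr ?_ fun _ _ => rfl
        ext k
        simp only [Finset.mem_filter, Finset.mem_range]
        constructor
        · rintro ⟨⟨_, h⟩, h'⟩
          exact ⟨by omega, h⟩
        · rintro ⟨h, h'⟩
          exact ⟨⟨by omega, h'⟩, by omega⟩
      have e2 : ∀ k ∈ (Finset.range (m i + 1)).filter Odd,
          2 * (2 : ℂ) ^ (m - Finsupp.single i k).support.card =
            2 ^ m.support.card * ((if k < m i then 2 else 1 : ℕ) : ℂ) := by
        intro k hk
        rw [Finset.mem_filter, Finset.mem_range] at hk
        split_ifs with h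
        · have : (m - Finsupp.single i k).support = m.support := by
            ext j
            simp only [Finsupp.mem_support_iff, Finsupp.tsub_apply]
            by_cases hj : i = j
            · subst hj
              rw [Finsupp.single_eq_same]
              omega
            · rw [Finsupp.single_eq_of_ne' hj]
              omega
          rw [this]
          push_cast
          ring
        · have hk' : k = m i := by omega
          have : (m - Finsupp.single i k).support = m.support.erase i := by
            ext j
            simp only [Finsupp.mem_support_iff, Finsupp.tsub_apply, Finset.mem_erase]
            by_cases hj : i = j
            · subst hj
              rw [Finsupp.single_eq_same]
              simp [hk']
            · rw [Finsupp.single_eq_of_ne' hj]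
              simp [Ne.symm hj]
          rw [this, Finset.card_erase_of_mem hi, ← pow_succ', Nat.sub_add_cancel hcard]
          simp
      rw [e1, Finset.mul_sum, Finset.sum_congr rfl e2, ← Finset.mul_sum, ← Nat.cast_sum,
        sum_odd_weight]
    rw [Finset.sum_congr rfl inner, ← Finset.mul_sum, ← Nat.cast_sum, mul_comm]
    congr 2
    rw [← hm]
    rfl
  · simp [hm]

theorem qLam_zero : qLam 0 = 1 := by
  apply Subtype.ext
  ext m
  classical
  rw [coeff_qLam, OneMemClass.coe_one, MvPowerSeries.coeff_one]
  by_cases h : m = 0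
  · subst h
    simp
  · rw [if_neg h, if_neg]
    rwa [Finsupp.degree_eq_zero_iff]

theorem qLam_mem (r : ℕ) : qLam r ∈ Omega := by
  induction r using Nat.strong_induction_on with
  | _ r ih =>
    rcases Nat.eq_zero_or_pos r with rfl | hr
    · rw [qLam_zero]
      exact one_mem _
    · have h : qLam r = (r : ℂ)⁻¹ • ((r : ℂ) • qLam r) := by
        rw [smul_smul, inv_mul_cancel₀ (by exact_mod_cast hr.ne'), one_smul]
      rw [h, qLam_recursion]
      refine Subalgebra.smul_mem _ (Subalgebra.smul_mem _ (sum_mem fun k hk => ?_) _) _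
      rw [Finset.mem_filter] at hk
      have := hk.2.pos
      exact mul_mem (Algebra.subset_adjoin ⟨k, hk.2, rfl⟩) (ih _ (by omega))

/-- The symmetric function `q_r` as an element of `Ω`. -/
def q (r : ℕ) : Omega := ⟨qLam r, qLam_mem r⟩

/-- Schur's two-row functions
`Q_{(a, b)} = q_a q_b + 2 ∑_{1 ≤ i ≤ b} (-1) ^ i q_{a + i} q_{b - i}` for `a > b ≥ 0`; in
particular `Q_{(a, 0)} = q_a`. -/
def schurQTwo (a b : ℕ) : Omega :=
  q a * q b + 2 * ∑ i ∈ Finset.Icc 1 b, (-1) ^ i * (q (a + i) * q (b - i))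

/-- The Pfaffian of the skew-symmetric `2m × 2m` matrix with entries `A a b` for `a < b`, by
expansion along the first row. Only the entries above the diagonal are used. -/
def pfaffian {R : Type*} [CommRing R] : (m : ℕ) → (Fin (2 * m) → Fin (2 * m) → R) → R
  | 0, _ => 1
  | m + 1, A => ∑ j : Fin (2 * m + 1), (-1) ^ (j : ℕ) * A (0 : Fin (2 * m + 1 + 1)) j.succ *
      pfaffian m fun a b => A (j.succAbove a).succ (j.succAbove b).succ

/-- A Young diagram is strict if its nonzero rows have distinct lengths. -/
def IsStrict (μ : YoungDiagram) : Prop := ∀ i, 0 < μ.rowLen i → μ.rowLen (i + 1) < μ.rowLen i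

/-- Schur's `Q`-function of a strict partition `μ = (μ_1 > ⋯ > μ_h > 0)`: the Pfaffian of the matrix
`(Q_{(μ_a, μ_b)})` with `1 ≤ a < b ≤ 2m`, where `2m` is `h` or `h + 1` and `μ_{h + 1} = 0`. -/
def schurQ (μ : YoungDiagram) : Omega :=
  pfaffian ((μ.colLen 0 + 1) / 2) fun a b => schurQTwo (μ.rowLen a) (μ.rowLen b)

/-- Schur's `P`-function `P_μ = 2 ^ (-h(μ)) Q_μ`, with `h(μ)` the number of nonzero parts. -/
def schurP (μ : YoungDiagram) : Omega := ((2 : ℂ) ^ μ.colLen 0)⁻¹ • schurQ μ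

/-! ### The inner products and the algebra `Sym^I` -/

/-- The inner product `⟨·,·⟩` on `Λ`: the bilinear form for which the Schur functions (a basis
of `Λ`) are orthonormal. -/
def formLam : LinearMap.BilinForm ℂ Lam :=
  open Classical in
  Classical.epsilon fun B => ∀ μ ν : YoungDiagram, B (schur μ) (schur ν) = if μ = ν then 1 else 0

/-- The inner product `[·,·]` on `Ω`: the bilinear form for which the bases `P_μ` and `Q_μ`, `μ`
strict, are dual to each other. -/
def formOmega : LinearMap.BilinForm ℂ Omega :=
  open Classical in
  Classical.epsilon fun B => ∀ μ ν : YoungDiagram, IsStrict μ → IsStrict ν →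
    B (schurP μ) (schurQ ν) = if μ = ν then 1 else 0

/-- `Sym^I = Ω ⊗ Λ^{(1)} ⊗ ⋯ ⊗ Λ^{(ℓ)}`; the factor `Λ^{(i)}` has index `i - 1` in `Fin ℓ`. -/
abbrev SymI (ℓ : ℕ) : Type := Omega ⊗[ℂ] (⨂[ℂ] _ : Fin ℓ, Lam)

/-- The elementary tensor `f_0 ⊗ f_1 ⊗ ⋯ ⊗ f_ℓ`. -/
def elementary {ℓ : ℕ} (f₀ : Omega) (f : Fin ℓ → Lam) : SymI ℓ :=
  f₀ ⊗ₜ[ℂ] PiTensorProduct.tprod ℂ f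

/-- The bilinear form on `Λ^{(1)} ⊗ ⋯ ⊗ Λ^{(ℓ)}` that is the tensor product of the forms on `Λ`. -/
def formTensorLam (ℓ : ℕ) : LinearMap.BilinForm ℂ (⨂[ℂ] _ : Fin ℓ, Lam) :=
  (PiTensorProduct.map₂ fun _ : Fin ℓ => formLam).compr₂
    (PiTensorProduct.constantBaseRingEquiv (Fin ℓ) ℂ).toLinearMap

/-- The inner product `(·,·)_Sym` on `Sym^I`. -/
def formSym (ℓ : ℕ) : LinearMap.BilinForm ℂ (SymI ℓ) :=
  LinearMap.BilinForm.tmul formOmega (formTensorLam ℓ)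

theorem formSym_elementary {ℓ : ℕ} (f₀ g₀ : Omega) (f g : Fin ℓ → Lam) :
    formSym ℓ (elementary f₀ f) (elementary g₀ g) =
      formOmega f₀ g₀ * ∏ i, formLam (f i) (g i) := by
  simp [formSym, elementary, formTensorLam, PiTensorProduct.map₂_tprod_tprod, mul_comm]

/-! ### Strict multipartitions and colored tableaux -/

/-- `I`-multipartitions for `I = {0, …, ℓ}`, as families of Young diagrams. -/
abbrev Multipartition (ℓ : ℕ) : Type := Fin (ℓ + 1) → YoungDiagram

theorem finite_strictMultipartitions (ℓ d : ℕ) :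
    {lam : Multipartition ℓ | IsStrict (lam 0) ∧ ∑ i, (lam i).card = d}.Finite := by
  have hd : {μ : YoungDiagram | μ.card ≤ d}.Finite := by
    refine Set.Finite.of_injOn (f := YoungDiagram.cells)
      (t := ((Finset.range d ×ˢ Finset.range d).powerset : Set (Finset (ℕ × ℕ)))) ?_ ?_
      (Finset.finite_toSet _)
    · intro μ hμ
      simp only [Finset.coe_powerset, Set.mem_preimage, Set.mem_powerset_iff, Finset.coe_subset]
      intro c hc
      obtain ⟨a, b⟩ := c
      rw [YoungDiagram.mem_cells] at hc
      have h1 : μ.rowLen a ≤ μ.card := by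
        rw [YoungDiagram.rowLen_eq_card]
        exact Finset.card_le_card (Finset.filter_subset _ _)
      have h2 : μ.colLen b ≤ μ.card := by
        rw [YoungDiagram.colLen_eq_card]
        exact Finset.card_le_card (Finset.filter_subset _ _)
      have h3 := YoungDiagram.mem_iff_lt_rowLen.1 hc
      have h4 := YoungDiagram.mem_iff_lt_colLen.1 hc
      have h5 : μ.card ≤ d := hμ
      simp only [Finset.mem_product, Finset.mem_range]
      omega
    · intro μ _ ν _ h
      exact YoungDiagram.ext h
  refine (Set.Finite.pi' fun _ : Fin (ℓ + 1) => hd).subset ?_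
  rintro lam ⟨_, h⟩ i
  change (lam i).card ≤ d
  rw [← h]
  exact Finset.single_le_sum (f := fun i => (lam i).card) (fun _ _ => Nat.zero_le _)
    (Finset.mem_univ i)

/-- The finite set of multipartitions of `d` whose `0`th component is strict. -/
def strictMultipartitions (ℓ d : ℕ) : Finset (Multipartition ℓ) :=
  (finite_strictMultipartitions ℓ d).toFinset

/-- The element `π_lam = P_{lam 0} ⊗ s_{lam 1} ⊗ ⋯ ⊗ s_{lam ℓ}`. -/
def piElt {ℓ : ℕ} (lam : Multipartition ℓ) : SymI ℓ :=
  elementary (schurP (lam 0)) fun i => schur (lam i.succ)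

/-- Colored compositions of `d` with `n` parts; the colors are in `J = {0, …, ℓ - 1}`. -/
structure ColoredComposition (ℓ n d : ℕ) where
  /-- The parts, possibly zero. -/
  part : Fin n → ℕ
  /-- The colors. -/
  color : Fin n → Fin ℓ
  sum_part : ∑ r, part r = d

/-- The nodes `(i, r, s)` of a multipartition; rows `r` and columns `s` are numbered from `0`. -/
abbrev Node {ℓ : ℕ} (lam : Multipartition ℓ) : Type :=
  (i : Fin (ℓ + 1)) × {x : ℕ × ℕ // x ∈ (lam i).cells}

/-- The component of a node. -/
def Node.comp {ℓ : ℕ} {lam : Multipartition ℓ} (a : Node lam) : Fin (ℓ + 1) := a.1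

/-- The row of a node. -/
def Node.row {ℓ : ℕ} {lam : Multipartition ℓ} (a : Node lam) : ℕ := a.2.1.1

/-- The column of a node. -/
def Node.col {ℓ : ℕ} {lam : Multipartition ℓ} (a : Node lam) : ℕ := a.2.1.2

/-- Colored tableaux of shape `lam` and type `c`. Since the parts of `c` add up to the number of
nodes, `card_eq` forces all entries to lie in `{1, …, n}`, so we take entries in `Fin n`. -/
structure IsColoredTableau {ℓ n d : ℕ} (lam : Multipartition ℓ) (c : ColoredComposition ℓ n d)
    (T : Node lam → Fin n) : Prop where
  /-- Entries weakly increase along the rows. -/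
  row_le : ∀ a b : Node lam, a.comp = b.comp → a.row = b.row → b.col = a.col + 1 → T a ≤ T b
  /-- Entries weakly increase down the columns. -/
  col_le : ∀ a b : Node lam, a.comp = b.comp → a.col = b.col → b.row = a.row + 1 → T a ≤ T b
  /-- In component `0`, the entry in row `r` and column `s + 1` is at most the one in row `r + 1`
  and column `s`. Equivalently, the nodes of this component with entries at most `k` form the
  diagram of a strict partition, for every `k`. -/
  strict : ∀ a b : Node lam, a.comp = 0 → b.comp = 0 → b.row = a.row + 1 → a.col = b.col + 1 →
    T a ≤ T b
  /-- The entry `k` occurs `μ_k` times. -/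
  card_eq : ∀ k : Fin n, (Finset.univ.filter fun a : Node lam => T a = k).card = c.part k
  /-- The entry `k` occurs only in the components `j_k` and `j_k + 1`. -/
  comp_mem : ∀ a : Node lam,
    a.comp = (c.color (T a)).castSucc ∨ a.comp = (c.color (T a)).succ
  /-- In component `j_k`, the entry `k` occurs at most once in each column. -/
  col_inj : ∀ a b : Node lam, T a = T b → a.comp = (c.color (T a)).castSucc →
    b.comp = (c.color (T a)).castSucc → a.col = b.col → a = b
  /-- In component `j_k + 1`, the entry `k` occurs at most once in each row. -/
  row_inj : ∀ a b : Node lam, T a = T b → a.comp = (c.color (T a)).succ →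
    b.comp = (c.color (T a)).succ → a.row = b.row → a = b

/-- The set of columns of component `0` that contain a node with entry `k`. -/
def columnsZero {ℓ n : ℕ} {lam : Multipartition ℓ} (T : Node lam → Fin n) (k : Fin n) : Finset ℕ :=
  (Finset.univ.filter fun a : Node lam => a.comp = 0 ∧ T a = k).image Node.col

/-- The statistic `q(T) = q_1(T) + ⋯ + q_n(T)`, where `q_k(T)` is the number of columns `r` of
component `0` such that the entry `k` occurs in column `r` but not in column `r + 1`. -/
def qStat {ℓ n : ℕ} {lam : Multipartition ℓ} (T : Node lam → Fin n) : ℕ :=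
  ∑ k : Fin n, ((columnsZero T k).filter fun r => r + 1 ∉ columnsZero T k).card

/-- The number `K(lam; μ, j) = ∑_T 2 ^ q(T)`, summed over the colored tableaux `T`. -/
def K {ℓ n d : ℕ} (lam : Multipartition ℓ) (c : ColoredComposition ℓ n d) : ℕ :=
  open Classical in
  ∑ T : Node lam → Fin n with IsColoredTableau lam c T, 2 ^ qStat T

/-! ### The elements `Π_{μ,j}` and `Π_{ω_d}` -/

/-- `Π_{μ,j} = ∑_lam K(lam; μ, j) π_lam`, summed over the strict multipartitions of `d`. -/
def PiElt {ℓ n d : ℕ} (c : ColoredComposition ℓ n d) : SymI ℓ :=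
  ∑ lam ∈ strictMultipartitions ℓ d, (K lam c : ℂ) • piElt lam

/-- The composition `ω_d = (1, …, 1)` of `d`, colored by `j`. -/
def omegaComposition {ℓ d : ℕ} (j : Fin d → Fin ℓ) : ColoredComposition ℓ d d where
  part := fun _ => 1
  color := j
  sum_part := by simp

/-- `Π_{ω_d} = ∑_j Π_{ω_d, j}`, summed over all `j ∈ J ^ d`. -/
def PiOmega (ℓ d : ℕ) : SymI ℓ := ∑ j : Fin d → Fin ℓ, PiElt (omegaComposition j)

/-- `|μ, j|_{ℓ-1}`, the sum of the parts of color `ℓ - 1`. -/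
def ColoredComposition.lastColorSize {ℓ n d : ℕ} (c : ColoredComposition ℓ n d) : ℕ :=
  ∑ r : Fin n with (c.color r : ℕ) + 1 = ℓ, c.part r

end ColoredSym

end

open scoped TensorProduct

noncomputable section

namespace ColoredSym

/-! ### Young diagrams and their row lengths -/

/-! The pairing counts weighted walks up and down in a graded graph, and a Heisenberg-type
commutation relation evaluates it. Everything takes place in the free module on multipartitions.

Up. Deleting the nodes with the largest entry $n$ from a colored tableau leaves a colored tableau of
smaller shape. The deleted nodes form a horizontal strip in component $j_n$ and a vertical strip in
component $j_n+1$, and $2^{q_n}$ depends only on the strip. So the coefficient vector of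
$\Pi_{\mu,j}$ arises from the empty multipartition by the operators $S_m$ = `stepOp j m`, one for
each part (`K_succ`, `tableauVector_succ`).

Down. The $\pi_\lambda$ are orthogonal with $(\pi_\lambda,\pi_\lambda)=2^{-h(\lambda^{(0)})}$. Let
$D$ = `removeOp ℓ` remove one cell with suitable weights. The number $\sum_i K(\lambda;\omega_d,i)$
is $2^{h(\lambda^{(0)})}$ times the coefficient of $\varnothing$ in $D^d\lambda$ (`K_omega_eq`). The
powers of 2 cancel, and the pairing is the coefficient of $\varnothing$ in $D^d$ applied to the
vector of $\Pi_{\mu,j}$ (`formSym_PiElt_PiOmega`).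

Commutation. One has $DS_m=S_mD+\alpha S_{m-1}$ with $\alpha=4$, or $\alpha=3$ for the last color
(`isLowering_stepOp`): component $j$ contributes 2, and component $j+1$ contributes 2, or 1 if it is
the last one. Since $\varnothing$ never occurs in the image of $S_m$ for $m>0$, moving $D^d$ past
$S_m$ leaves $\binom dm\alpha^mD^{d-m}$ (`IsLowering.pow_mul`). Induction on the number of parts
gives the multinomial coefficient and the powers of 4 and 3. In one component the relation is a
signed matching of additions with removals: `sum_HStrip`, its transpose `sum_VStrip`, and
`sum_qKernel` for strict partitions, where the weights match only up to a telescoping term.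

The bilinear forms are chosen by `Classical.epsilon`, so their defining property requires that such
forms exist, that is, that the Schur functions and the $Q_\lambda$ with $\lambda$ strict are
linearly independent. Filter the products of the generators $h_r$, respectively $q_r$, by the sum of
the squares of the indices. Then $s_\lambda$ and $Q_\lambda$ have leading terms $h_\lambda$ and
$q_\lambda$, and the relations $Q(t)Q(-t)=1$ eliminate repeated indices. So in each degree these
functions span all products of power sums, respectively of odd power sums. The latter are
independent and at least as numerous, by Euler's theorem on odd and distinct parts in the case of
$Q_\lambda$ (`linearIndependent_schur`, `linearIndependent_schurQ`). -/

theorem rowLen_injective : Function.Injective YoungDiagram.rowLen := by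
  intro μ ν h
  refine SetLike.ext fun c => ?_
  obtain ⟨a, b⟩ := c
  rw [YoungDiagram.mem_iff_lt_rowLen, YoungDiagram.mem_iff_lt_rowLen, h]

theorem le_iff_rowLen_le {μ ν : YoungDiagram} : μ ≤ ν ↔ ∀ i, μ.rowLen i ≤ ν.rowLen i := by
  constructor
  · intro h i
    by_contra! hlt
    exact lt_irrefl _ (YoungDiagram.mem_iff_lt_rowLen.1
      (h (YoungDiagram.mem_iff_lt_rowLen.2 hlt)))
  · rintro h ⟨a, b⟩ hc
    exact YoungDiagram.mem_iff_lt_rowLen.2 ((YoungDiagram.mem_iff_lt_rowLen.1 hc).trans_le (h a))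

theorem rowLen_antitone (μ : YoungDiagram) : Antitone μ.rowLen :=
  fun i j h => μ.rowLen_anti i j h

theorem rowLen_pos_iff {μ : YoungDiagram} {i : ℕ} : 0 < μ.rowLen i ↔ i < μ.colLen 0 := by
  rw [← YoungDiagram.mem_iff_lt_rowLen, YoungDiagram.mem_iff_lt_colLen]

theorem rowLen_eq_zero_of_le {μ : YoungDiagram} {i : ℕ} (h : μ.colLen 0 ≤ i) :
    μ.rowLen i = 0 := by
  by_contra hn
  exact absurd (rowLen_pos_iff.1 (Nat.pos_of_ne_zero hn)) (by omega)

theorem card_eq_sum_rowLen (μ : YoungDiagram) {N : ℕ} (hN : μ.colLen 0 ≤ N) :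
    μ.card = ∑ i ∈ Finset.range N, μ.rowLen i := by
  have h : ∀ c ∈ μ.cells, c.1 ∈ Finset.range N := by
    rintro ⟨a, b⟩ hc
    have := rowLen_pos_iff.1 ((Nat.zero_le b).trans_lt (YoungDiagram.mem_iff_lt_rowLen.1 hc))
    simp only [Finset.mem_range]
    omega
  rw [YoungDiagram.card, Finset.card_eq_sum_card_fiberwise h]
  refine Finset.sum_congr rfl fun i _ => ?_
  rw [YoungDiagram.rowLen_eq_card]
  rfl

/-- The Young diagram with given weakly decreasing row lengths. -/
def ofRowLen (f : ℕ → ℕ) (hf : Antitone f) (N : ℕ) (_ : f N = 0) : YoungDiagram where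
  cells := (Finset.range N ×ˢ Finset.range (f 0)).filter fun c => c.2 < f c.1
  isLowerSet := by
    rintro ⟨a, b⟩ ⟨a', b'⟩ h hc
    simp only [Finset.coe_filter, Finset.mem_product, Finset.mem_range, Set.mem_ofPred_eq,
      Prod.mk_le_mk] at h hc ⊢
    have := hf h.1
    omega

theorem rowLen_ofRowLen {f : ℕ → ℕ} (hf : Antitone f) {N : ℕ} (hN : f N = 0) :
    (ofRowLen f hf N hN).rowLen = f := by
  have key : ∀ i j, j < (ofRowLen f hf N hN).rowLen i ↔ j < f i := by
    intro i j
    rw [← YoungDiagram.mem_iff_lt_rowLen, ← YoungDiagram.mem_cells]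
    simp only [ofRowLen, Finset.mem_filter, Finset.mem_product, Finset.mem_range,
      and_iff_right_iff_imp]
    intro h
    refine ⟨?_, h.trans_le (hf (Nat.zero_le i))⟩
    by_contra! hi
    have := hf hi
    omega
  funext i
  exact eq_of_forall_lt_iff fun j => key i j

theorem finite_diagrams (n : ℕ) : {μ : YoungDiagram | μ.card = n}.Finite := by
  -- The diagram is placed in component 1 of a multipartition with $\ell=1$, next to an empty, hence
  -- strict, component 0.
  refine Set.Finite.of_injOn (f := fun μ => (![⊥, μ] : Multipartition 1))
    (t := {lam : Multipartition 1 | IsStrict (lam 0) ∧ ∑ i, (lam i).card = n}) ?_ ?_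
    (finite_strictMultipartitions 1 n)
  · intro μ hμ
    refine ⟨fun i hi => ?_, ?_⟩
    · have := YoungDiagram.mem_iff_lt_rowLen.2 hi
      exact absurd this (YoungDiagram.notMem_bot _)
    · simpa [Fin.sum_univ_two, YoungDiagram.card] using hμ
  · intro μ _ ν _ h
    simpa using congrFun h 1

/-- The finite set of Young diagrams with `n` cells. -/
def diagrams (n : ℕ) : Finset YoungDiagram := (finite_diagrams n).toFinset

theorem mem_diagrams {n : ℕ} {μ : YoungDiagram} : μ ∈ diagrams n ↔ μ.card = n := by
  simp [diagrams]

/-! ### The covering relation of Young's lattice in terms of rows -/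

/-- `Covers ν μ` means that `μ` is obtained from `ν` by adding one cell. -/
def Covers (ν μ : YoungDiagram) : Prop := ν ≤ μ ∧ μ.card = ν.card + 1

theorem card_of_rowLen_eq_update {ν μ : YoungDiagram} {i : ℕ}
    (h : μ.rowLen = Function.update ν.rowLen i (ν.rowLen i + 1)) : Covers ν μ := by
  have hle : ∀ j, ν.rowLen j ≤ μ.rowLen j := by
    intro j
    rw [h, Function.update_apply]
    split_ifs with hj
    · subst hj; omega
    · exact le_rfl
  refine ⟨le_iff_rowLen_le.2 hle, ?_⟩
  have hi : i ∈ Finset.range (μ.colLen 0 + ν.colLen 0 + i + 1) := by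
    simp only [Finset.mem_range]; omega
  rw [card_eq_sum_rowLen μ (N := μ.colLen 0 + ν.colLen 0 + i + 1) (by omega),
    card_eq_sum_rowLen ν (N := μ.colLen 0 + ν.colLen 0 + i + 1) (by omega), h,
    Finset.sum_update_of_mem hi, ← Finset.add_sum_erase _ _ hi, Finset.sdiff_singleton_eq_erase]
  omega

/-- Row lengths can only grow and their sums differ by 1, so exactly one row grows, and by exactly
1. -/
theorem Covers.exists_row {ν μ : YoungDiagram} (h : Covers ν μ) :
    ∃ i, μ.rowLen = Function.update ν.rowLen i (ν.rowLen i + 1) := by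
  obtain ⟨hle, hc⟩ := h
  have hle' := le_iff_rowLen_le.1 hle
  rw [card_eq_sum_rowLen μ (N := μ.colLen 0 + ν.colLen 0) (by omega),
    card_eq_sum_rowLen ν (N := μ.colLen 0 + ν.colLen 0) (by omega)] at hc
  have hex : ∃ i, ν.rowLen i < μ.rowLen i := by
    by_contra! hn
    have : ∑ i ∈ Finset.range (μ.colLen 0 + ν.colLen 0), μ.rowLen i ≤
        ∑ i ∈ Finset.range (μ.colLen 0 + ν.colLen 0), ν.rowLen i :=
      Finset.sum_le_sum fun i _ => hn i
    omega
  obtain ⟨i, hi⟩ := hex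
  have hmem : ∀ j, ν.rowLen j < μ.rowLen j →
      j ∈ Finset.range (μ.colLen 0 + ν.colLen 0) := by
    intro j hj
    have := rowLen_pos_iff.1 ((Nat.zero_le _).trans_lt hj)
    simp only [Finset.mem_range]
    omega
  have hi' := hmem i hi
  rw [← Finset.add_sum_erase _ _ hi', ← Finset.add_sum_erase _ (fun j => ν.rowLen j) hi'] at hc
  have hs : ∑ j ∈ (Finset.range (μ.colLen 0 + ν.colLen 0)).erase i, ν.rowLen j ≤
      ∑ j ∈ (Finset.range (μ.colLen 0 + ν.colLen 0)).erase i, μ.rowLen j :=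
    Finset.sum_le_sum fun j _ => hle' j
  refine ⟨i, funext fun j => ?_⟩
  rw [Function.update_apply]
  split_ifs with hj
  · subst hj; omega
  · by_contra hne
    have hlt : ν.rowLen j < μ.rowLen j := lt_of_le_of_ne (hle' j) (Ne.symm hne)
    have hs' : ∑ j ∈ (Finset.range (μ.colLen 0 + ν.colLen 0)).erase i, ν.rowLen j <
        ∑ j ∈ (Finset.range (μ.colLen 0 + ν.colLen 0)).erase i, μ.rowLen j :=
      Finset.sum_lt_sum (fun j _ => hle' j) ⟨j, Finset.mem_erase.2 ⟨hj, hmem j hlt⟩, hlt⟩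
    omega

theorem antitone_update_add {x : ℕ → ℕ} (hx : Antitone x) {i : ℕ}
    (hi : i = 0 ∨ x i < x (i - 1)) : Antitone (Function.update x i (x i + 1)) := by
  refine antitone_nat_of_succ_le fun j => ?_
  have h1 := hx (Nat.le_succ j)
  rw [Function.update_apply, Function.update_apply]
  split_ifs with h2 h3 h3
  · omega
  · subst h2
    simp only [Nat.add_sub_cancel] at hi
    omega
  · subst h3; simp only [Nat.succ_eq_add_one] at h1; omega
  · exact h1

theorem antitone_update_sub {x : ℕ → ℕ} (hx : Antitone x) {i : ℕ}
    (hi : x (i + 1) < x i) : Antitone (Function.update x i (x i - 1)) := by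
  refine antitone_nat_of_succ_le fun j => ?_
  have h1 := hx (Nat.le_succ j)
  rw [Function.update_apply, Function.update_apply]
  simp only [Nat.succ_eq_add_one] at h1
  split_ifs with h2 h3 h3
  · omega
  · subst h2; omega
  · subst h3; omega
  · exact h1

open Classical in
/-- Summation over the diagrams covering `ν`, by the row of the new cell. -/
theorem sum_covers_above (ν : YoungDiagram) {N : ℕ} (hN : ν.colLen 0 < N)
    (F : YoungDiagram → ℚ) (G : ℕ → ℚ)
    (hFG : ∀ i μ, (i = 0 ∨ ν.rowLen i < ν.rowLen (i - 1)) →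
      μ.rowLen = Function.update ν.rowLen i (ν.rowLen i + 1) → F μ = G i) :
    (∑ μ ∈ diagrams (ν.card + 1), if Covers ν μ then F μ else 0) =
      ∑ i ∈ Finset.range N, if i = 0 ∨ ν.rowLen i < ν.rowLen (i - 1) then G i else 0 := by
  rw [← Finset.sum_filter, ← Finset.sum_filter]
  symm
  have anti : ∀ i, i = 0 ∨ ν.rowLen i < ν.rowLen (i - 1) →
      Antitone (Function.update ν.rowLen i (ν.rowLen i + 1)) := fun i hi =>
    antitone_update_add (rowLen_antitone ν) hi
  have zero : ∀ i, Function.update ν.rowLen i (ν.rowLen i + 1) (ν.colLen 0 + i + 1) = 0 := by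
    intro i
    rw [Function.update_of_ne (by omega), rowLen_eq_zero_of_le (by omega)]
  refine Finset.sum_bij (fun i hi => ofRowLen _ (anti i (Finset.mem_filter.1 hi).2) _ (zero i))
    ?_ ?_ ?_ ?_
  · intro i hi
    have := card_of_rowLen_eq_update (rowLen_ofRowLen (anti i (Finset.mem_filter.1 hi).2) (zero i))
    simp only [Finset.mem_filter, mem_diagrams]
    exact ⟨this.2, this⟩
  · intro i hi j hj h
    have h' := congrArg YoungDiagram.rowLen h
    rw [rowLen_ofRowLen, rowLen_ofRowLen] at h'
    by_contra hne
    have := congrFun h' i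
    rw [Function.update_self, Function.update_of_ne hne] at this
    omega
  · intro μ hμ
    obtain ⟨i, hi⟩ := (Finset.mem_filter.1 hμ).2.exists_row
    have hv : i = 0 ∨ ν.rowLen i < ν.rowLen (i - 1) := by
      by_contra! hn
      have h1 := rowLen_antitone μ (show i - 1 ≤ i by omega)
      rw [hi, Function.update_self, Function.update_of_ne (by omega)] at h1
      omega
    refine ⟨i, ?_, rowLen_injective ?_⟩
    · simp only [Finset.mem_filter, Finset.mem_range]
      refine ⟨?_, hv⟩
      -- The new cell may open the row `ν.colLen 0`, which is why the bound on `N` is strict; a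
      -- lower row would have an empty row above it.
      by_contra! hle
      have : ν.rowLen (i - 1) = 0 := rowLen_eq_zero_of_le (by omega)
      omega
    · rw [rowLen_ofRowLen, hi]
  · intro i hi
    exact (hFG i _ (Finset.mem_filter.1 hi).2 (rowLen_ofRowLen _ _)).symm

open Classical in
/-- Summation over the diagrams covered by `lam`, by the row of the removed cell. -/
theorem sum_covers_below (lam : YoungDiagram) {N : ℕ} (hN : lam.colLen 0 ≤ N)
    (F : YoungDiagram → ℚ) (G : ℕ → ℚ)
    (hFG : ∀ i κ, lam.rowLen (i + 1) < lam.rowLen i →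
      κ.rowLen = Function.update lam.rowLen i (lam.rowLen i - 1) → F κ = G i) :
    (∑ κ ∈ diagrams (lam.card - 1), if Covers κ lam then F κ else 0) =
      ∑ i ∈ Finset.range N, if lam.rowLen (i + 1) < lam.rowLen i then G i else 0 := by
  rw [← Finset.sum_filter, ← Finset.sum_filter]
  symm
  have anti : ∀ i, lam.rowLen (i + 1) < lam.rowLen i →
      Antitone (Function.update lam.rowLen i (lam.rowLen i - 1)) := fun i hi =>
    antitone_update_sub (rowLen_antitone lam) hi
  have zero : ∀ i, Function.update lam.rowLen i (lam.rowLen i - 1) (lam.colLen 0 + i + 1) = 0 := by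
    intro i
    rw [Function.update_of_ne (by omega), rowLen_eq_zero_of_le (by omega)]
  refine Finset.sum_bij (fun i hi => ofRowLen _ (anti i (Finset.mem_filter.1 hi).2) _ (zero i))
    ?_ ?_ ?_ ?_
  · intro i hi
    have hi' := (Finset.mem_filter.1 hi).2
    have := card_of_rowLen_eq_update (ν := ofRowLen _ (anti i hi') _ (zero i)) (μ := lam) (i := i)
      (by
        rw [rowLen_ofRowLen, Function.update_self, Function.update_idem,
          Nat.sub_add_cancel (by omega), Function.update_eq_self])
    simp only [Finset.mem_filter, mem_diagrams]
    exact ⟨by rw [this.2]; rfl, this⟩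
  · intro i hi j hj h
    have h' := congrArg YoungDiagram.rowLen h
    rw [rowLen_ofRowLen, rowLen_ofRowLen] at h'
    have hi' := (Finset.mem_filter.1 hi).2
    by_contra hne
    have := congrFun h' i
    rw [Function.update_self, Function.update_of_ne hne] at this
    omega
  · intro κ hκ
    obtain ⟨i, hi⟩ := (Finset.mem_filter.1 hκ).2.exists_row
    have hv : lam.rowLen (i + 1) < lam.rowLen i := by
      rw [hi, Function.update_self, Function.update_of_ne (by omega)]
      have := rowLen_antitone κ (Nat.le_succ i)
      simp only [Nat.succ_eq_add_one] at this
      omega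
    refine ⟨i, ?_, rowLen_injective ?_⟩
    · simp only [Finset.mem_filter, Finset.mem_range]
      exact ⟨(rowLen_pos_iff.1 (by omega)).trans_le hN, hv⟩
    · rw [rowLen_ofRowLen, hi, Function.update_self, Function.update_idem, Nat.add_sub_cancel,
        Function.update_eq_self]
  · intro i hi
    exact (hFG i _ (Finset.mem_filter.1 hi).2 (rowLen_ofRowLen _ _)).symm

/-! ### Horizontal and vertical strips -/

/-- `μ` is obtained from `ν` by adding a horizontal strip: no two new cells share a column. -/
def HStrip (ν μ : YoungDiagram) : Prop :=
  ν ≤ μ ∧ ∀ a b : ℕ × ℕ, a ∈ μ → a ∉ ν → b ∈ μ → b ∉ ν → a.2 = b.2 → a = b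

/-- `μ` is obtained from `ν` by adding a vertical strip: no two new cells share a row. -/
def VStrip (ν μ : YoungDiagram) : Prop :=
  ν ≤ μ ∧ ∀ a b : ℕ × ℕ, a ∈ μ → a ∉ ν → b ∈ μ → b ∉ ν → a.1 = b.1 → a = b

theorem VStrip_iff_transpose {ν μ : YoungDiagram} :
    VStrip ν μ ↔ HStrip ν.transpose μ.transpose := by
  unfold VStrip HStrip
  rw [YoungDiagram.transpose_le_iff]
  refine and_congr_right fun _ => ⟨fun h a b h1 h2 h3 h4 h5 => ?_, fun h a b h1 h2 h3 h4 h5 => ?_⟩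
  · rw [YoungDiagram.mem_transpose] at h1 h2 h3 h4
    exact Prod.swap_injective (h _ _ h1 h2 h3 h4 h5)
  · refine Prod.swap_injective (h a.swap b.swap ?_ ?_ ?_ ?_ h5) <;>
      rwa [YoungDiagram.mem_transpose, Prod.swap_swap]

/-- Two sequences interlace: `x 0 ≤ y 0`, `y 1 ≤ x 0`, `x 1 ≤ y 1`, …. -/
def Interlace (x y : ℕ → ℕ) : Prop := ∀ i, x i ≤ y i ∧ y (i + 1) ≤ x i

/-- If row $i+1$ of `μ` is longer than row $i$ of `ν`, then column `ν.rowLen i` has new cells in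
both rows $i$ and $i+1$. Conversely, two new cells in one column force such an overlap. -/
theorem HStrip_iff_interlace {ν μ : YoungDiagram} :
    HStrip ν μ ↔ Interlace ν.rowLen μ.rowLen := by
  constructor
  · rintro ⟨hle, h⟩ i
    refine ⟨le_iff_rowLen_le.1 hle i, ?_⟩
    by_contra! hlt
    have h1 := rowLen_antitone μ (Nat.le_succ i)
    have h2 := rowLen_antitone ν (Nat.le_succ i)
    simp only [Nat.succ_eq_add_one] at h1 h2
    have := h (i, ν.rowLen i) (i + 1, ν.rowLen i)
    simp only [YoungDiagram.mem_iff_lt_rowLen, Prod.mk.injEq] at this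
    have := this (by omega) (by omega) (by omega) (by omega) trivial
    omega
  · intro h
    refine ⟨le_iff_rowLen_le.2 fun i => (h i).1, ?_⟩
    have key : ∀ i i' c : ℕ, i < i' → (i, c) ∉ ν → (i', c) ∈ μ → False := by
      intro i i' c hi h1 h2
      rw [YoungDiagram.mem_iff_lt_rowLen] at h1 h2
      have h3 := rowLen_antitone μ (show i + 1 ≤ i' by omega)
      have := (h i).2
      omega
    rintro ⟨a, c⟩ ⟨b, c'⟩ h1 h2 h3 h4 hc
    simp only at hc
    subst hc
    rcases lt_trichotomy a b with hab | hab | hab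
    · exact (key _ _ _ hab h2 h3).elim
    · rw [hab]
    · exact (key _ _ _ hab h4 h1).elim

theorem Interlace.update_add_iff {x y : ℕ → ℕ} (h : Interlace x y) (i : ℕ) :
    Interlace x (Function.update y i (y i + 1)) ↔ i = 0 ∨ y i < x (i - 1) := by
  constructor
  · intro h'
    rcases i with _ | i
    · exact Or.inl rfl
    · right
      have := (h' i).2
      rw [Function.update_self] at this
      simpa using this
  · intro hi j
    refine ⟨(h j).1.trans ?_, ?_⟩
    · rw [Function.update_apply]
      split_ifs with hj
      · subst hj; omega
      · exact le_rfl
    · rw [Function.update_apply]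
      split_ifs with hj
      · subst hj
        simp at hi
        omega
      · exact (h j).2

theorem Interlace.update_sub_iff {x y : ℕ → ℕ} (h : Interlace x y) (i : ℕ) (hi : 0 < x i) :
    Interlace (Function.update x i (x i - 1)) y ↔ y (i + 1) < x i := by
  constructor
  · intro h'
    have := (h' i).2
    rw [Function.update_self] at this
    omega
  · intro hi j
    refine ⟨le_trans ?_ (h j).1, ?_⟩
    · rw [Function.update_apply]
      split_ifs with hj
      · subst hj; omega
      · exact le_rfl
    · rw [Function.update_apply]
      split_ifs with hj
      · subst hj
        omega
      · exact (h j).2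

/-- If `x, y` do not interlace but do so after increasing `y i`, then `x i = y i + 1`. -/
theorem Interlace.of_update_add {x y : ℕ → ℕ} {i : ℕ}
    (h : Interlace x (Function.update y i (y i + 1))) (hn : ¬ Interlace x y) : x i = y i + 1 := by
  by_contra hne
  refine hn fun j => ?_
  have h1 := h j
  have h2 := (h i).1
  rw [Function.update_self] at h2
  simp only [Function.update_apply] at h1
  constructor
  · have := h1.1
    split_ifs at this with hj
    · subst hj; omega
    · exact this
  · have := h1.2
    split_ifs at this with hj
    · subst hj; omega
    · exact this

/-- If `x, y` do not interlace but do so after decreasing `x i`, then `x i = y i + 1`. -/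
theorem Interlace.of_update_sub {x y : ℕ → ℕ} {i : ℕ} (hi : 0 < x i)
    (h : Interlace (Function.update x i (x i - 1)) y) (hn : ¬ Interlace x y) : x i = y i + 1 := by
  by_contra hne
  refine hn fun j => ?_
  have h1 := h j
  have h2 := (h i).1
  rw [Function.update_self] at h2
  simp only [Function.update_apply] at h1
  constructor
  · have := h1.1
    split_ifs at this with hj
    · subst hj; omega
    · exact this
  · have := h1.2
    split_ifs at this with hj
    · subst hj; omega
    · exact this

/-- When $x_i=y_i+1$, the condition violated at row $i$ is repaired equally well by raising $y_i$ or
by lowering $x_i$. The neighboring conditions that the two updates change hold anyway, since `x` and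
`y` are weakly decreasing. -/
theorem interlace_update_iff {x y : ℕ → ℕ} (hx : Antitone x) (hy : Antitone y) {i : ℕ}
    (hi : x i = y i + 1) : Interlace x (Function.update y i (y i + 1)) ↔
      Interlace (Function.update x i (x i - 1)) y := by
  have key : ∀ j, (x j ≤ Function.update y i (y i + 1) j ↔
      Function.update x i (x i - 1) j ≤ y j) := by
    intro j
    rw [Function.update_apply, Function.update_apply]
    split_ifs with hj
    · subst hj; omega
    · rfl
  have key2 : ∀ j, (Function.update y i (y i + 1) (j + 1) ≤ x j ↔
      y (j + 1) ≤ Function.update x i (x i - 1) j) := by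
    intro j
    have h1 := hx (Nat.le_succ j)
    have h2 := hy (Nat.le_succ j)
    simp only [Nat.succ_eq_add_one] at h1 h2
    rw [Function.update_apply, Function.update_apply]
    split_ifs with hj hj' hj'
    · omega
    · subst hj; omega
    · subst hj'; omega
    · rfl
  unfold Interlace
  simp only [key, key2]

theorem Interlace.add_one_row_lt {x y : ℕ → ℕ} (hx : Antitone x) {i : ℕ}
    (hi : x i = y i + 1) (h : Interlace x (Function.update y i (y i + 1))) :
    i = 0 ∨ y i < y (i - 1) := by
  rcases i with _ | i
  · exact Or.inl rfl
  · right
    have h1 := (h i).1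
    rw [Function.update_of_ne (by omega)] at h1
    have h2 := hx (Nat.le_succ i)
    simp only [Nat.succ_eq_add_one, Nat.add_sub_cancel] at *
    omega

open Classical in
-- This is the matrix form of $DH_a=H_aD+H_{a-1}$ on Young's lattice, for all $a$ at once. Additions
-- to `ν` are matched with removals from `lam`: with a shift by one row if the two already
-- interlace, and within the same row if they do not.
theorem sum_HStrip (lam ν : YoungDiagram) :
    (∑ μ ∈ diagrams (ν.card + 1), if Covers ν μ then (if HStrip lam μ then (1 : ℚ) else 0) else 0) =
      (∑ κ ∈ diagrams (lam.card - 1),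
        if Covers κ lam then (if HStrip κ ν then (1 : ℚ) else 0) else 0) +
        if HStrip lam ν then 1 else 0 := by
  set N := lam.colLen 0 + ν.colLen 0 with hN
  set x := lam.rowLen with hx
  set y := ν.rowLen with hy
  have ax : Antitone x := rowLen_antitone lam
  have ay : Antitone y := rowLen_antitone ν
  rw [sum_covers_above ν (N := N + 1) (by omega) _
      (fun i => if Interlace x (Function.update y i (y i + 1)) then 1 else 0)
      (fun i μ _ h => by simp only [HStrip_iff_interlace, h, hx, hy]),
    sum_covers_below lam (N := N + 1) (by omega) _
      (fun i => if Interlace (Function.update x i (x i - 1)) y then 1 else 0)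
      (fun i μ _ h => by simp only [HStrip_iff_interlace, h, hx, hy]), HStrip_iff_interlace]
  simp only [← hx, ← hy]
  by_cases hI : Interlace x y
  -- Row $i+1$ of the additions is compared with row $i$ of the removals. Adding to row 0 is always
  -- possible and is the extra 1; row `N` has nothing to remove.
  · rw [if_pos hI, Finset.sum_range_succ', Finset.sum_range_succ _ N]
    have h0 : x N = 0 := rowLen_eq_zero_of_le (by omega)
    rw [if_pos (Or.inl rfl), if_pos ((hI.update_add_iff 0).2 (Or.inl rfl)),
      if_neg (show ¬ x (N + 1) < x N by omega), add_zero]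
    congr 1
    refine Finset.sum_congr rfl fun i _ => ?_
    rw [hI.update_add_iff]
    have h1 := hI i
    have h2 := hI (i + 1)
    by_cases hlt : y (i + 1) < x i
    · rw [if_pos (Or.inr (by simp; omega)), if_pos (Or.inr (by simpa using hlt)),
        if_pos (by omega), if_pos ((hI.update_sub_iff i (by omega)).2 hlt)]
    · rw [if_neg (show ¬ (i + 1 = 0 ∨ y (i + 1) < x (i + 1 - 1)) by simpa using hlt)]
      by_cases h3 : x (i + 1) < x i
      · rw [if_pos h3, if_neg (fun h => hlt ((hI.update_sub_iff i (by omega)).1 h))]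
        simp
      · simp [h3]
  · rw [if_neg hI, add_zero]
    -- Without interlacing, a move in row $i$ can help only if $x_i=y_i+1$, and then both moves help
    -- or neither does.
    refine Finset.sum_congr rfl fun i _ => ?_
    by_cases hi : x i = y i + 1
    · rw [interlace_update_iff ax ay hi]
      by_cases h : Interlace (Function.update x i (x i - 1)) y
      · have h2 := (h i).2
        have h3 := (h (i + 1)).1
        rw [Function.update_self] at h2
        rw [Function.update_of_ne (by omega)] at h3
        rw [if_pos (Interlace.add_one_row_lt ax hi ((interlace_update_iff ax ay hi).2 h)),
          if_pos (show x (i + 1) < x i by omega)]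
      · simp [h]
    · rw [if_neg (fun h : Interlace x (Function.update y i (y i + 1)) =>
        hi (h.of_update_add hI)), ite_self]
      by_cases h : x (i + 1) < x i
      · rw [if_neg (fun h' : Interlace (Function.update x i (x i - 1)) y =>
          hi (h'.of_update_sub (by omega) hI))]
        simp
      · simp [h]

/-! ### Vertical strips -/

theorem card_transpose (μ : YoungDiagram) : μ.transpose.card = μ.card :=
  Finset.card_map _

theorem covers_transpose {ν μ : YoungDiagram} :
    Covers ν.transpose μ.transpose ↔ Covers ν μ := by
  unfold Covers
  rw [YoungDiagram.transpose_le_iff, card_transpose, card_transpose]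

theorem sum_diagrams_transpose (n : ℕ) (F : YoungDiagram → ℚ) :
    ∑ μ ∈ diagrams n, F μ.transpose = ∑ μ ∈ diagrams n, F μ := by
  refine Finset.sum_bij' (fun μ _ => μ.transpose) (fun μ _ => μ.transpose) ?_ ?_ ?_ ?_ ?_
  · intro μ hμ
    rwa [mem_diagrams, card_transpose, ← mem_diagrams]
  · intro μ hμ
    rwa [mem_diagrams, card_transpose, ← mem_diagrams]
  · intro μ _
    exact μ.transpose_transpose
  · intro μ _
    exact μ.transpose_transpose
  · intro μ _
    rfl

open Classical in
theorem sum_VStrip (lam ν : YoungDiagram) :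
    (∑ μ ∈ diagrams (ν.card + 1), if Covers ν μ then (if VStrip lam μ then (1 : ℚ) else 0) else 0) =
      (∑ κ ∈ diagrams (lam.card - 1),
        if Covers κ lam then (if VStrip κ ν then (1 : ℚ) else 0) else 0) +
        if VStrip lam ν then 1 else 0 := by
  have h := sum_HStrip lam.transpose ν.transpose
  rw [card_transpose, card_transpose, ← sum_diagrams_transpose,
    ← sum_diagrams_transpose (lam.card - 1)] at h
  simpa only [VStrip_iff_transpose, covers_transpose] using h

/-! ### Horizontal strips between strict partitions -/

/-- The local weight of a row of a strip: `x` is the old length, `y` the new length and `z` the old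
length of the previous row. -/
def rowWeight (x y z : ℕ) : ℚ := if x < y ∧ y < z then 2 else 1

/-- The product of the weights of the rows `1, …, N`. -/
def rowProd (X Y : ℕ → ℕ) (N : ℕ) : ℚ :=
  ∏ i ∈ Finset.range N, rowWeight (X (i + 1)) (Y (i + 1)) (X i)

theorem rowWeight_ne_zero (x y z : ℕ) : rowWeight x y z ≠ 0 := by
  unfold rowWeight; split_ifs <;> norm_num

/-- Weakly decreasing sequences of naturals that decrease strictly as long as they are nonzero. -/
def StrictAntiSeq (X : ℕ → ℕ) : Prop := ∀ i, X (i + 1) ≤ X i ∧ (0 < X i → X (i + 1) < X i)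

theorem rowProd_update_add (X Y : ℕ → ℕ) {N i : ℕ} (hi : i < N) (v : ℕ) :
    rowProd X (Function.update Y (i + 1) v) N = rowProd X Y N *
      (rowWeight (X (i + 1)) v (X i) / rowWeight (X (i + 1)) (Y (i + 1)) (X i)) := by
  unfold rowProd
  have hm : i ∈ Finset.range N := Finset.mem_range.2 hi
  rw [← Finset.mul_prod_erase _ _ hm, ← Finset.mul_prod_erase (Finset.range N)
    (fun i => rowWeight (X (i + 1)) (Y (i + 1)) (X i)) hm, Function.update_self]
  have : ∏ j ∈ (Finset.range N).erase i,
      rowWeight (X (j + 1)) (Function.update Y (i + 1) v (j + 1)) (X j) =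
      ∏ j ∈ (Finset.range N).erase i, rowWeight (X (j + 1)) (Y (j + 1)) (X j) := by
    refine Finset.prod_congr rfl fun j hj => ?_
    rw [Function.update_of_ne (by have := Finset.ne_of_mem_erase hj; omega)]
  rw [this]
  have := rowWeight_ne_zero (X (i + 1)) (Y (i + 1)) (X i)
  field_simp

/-- An old row length enters two factors: that of its own row and, as the length of the row above,
that of the next row. -/
theorem rowProd_update_sub (X Y : ℕ → ℕ) {N i : ℕ} (hi : i + 1 < N) (v : ℕ) :
    rowProd (Function.update X (i + 1) v) Y N = rowProd X Y N *
      (rowWeight v (Y (i + 1)) (X i) / rowWeight (X (i + 1)) (Y (i + 1)) (X i)) *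
      (rowWeight (X (i + 2)) (Y (i + 2)) v / rowWeight (X (i + 2)) (Y (i + 2)) (X (i + 1))) := by
  unfold rowProd
  have hm : i ∈ Finset.range N := Finset.mem_range.2 (by omega)
  have hm' : i + 1 ∈ (Finset.range N).erase i :=
    Finset.mem_erase.2 ⟨by omega, Finset.mem_range.2 hi⟩
  rw [← Finset.mul_prod_erase _ _ hm, ← Finset.mul_prod_erase _ _ hm',
    ← Finset.mul_prod_erase (Finset.range N)
    (fun i => rowWeight (X (i + 1)) (Y (i + 1)) (X i)) hm, ← Finset.mul_prod_erase _
    (fun i => rowWeight (X (i + 1)) (Y (i + 1)) (X i)) hm', Function.update_self,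
    Function.update_of_ne (show i ≠ i + 1 by omega),
    Function.update_of_ne (show i + 1 + 1 ≠ i + 1 by omega)]
  have : ∏ j ∈ ((Finset.range N).erase i).erase (i + 1),
      rowWeight (Function.update X (i + 1) v (j + 1)) (Y (j + 1))
        (Function.update X (i + 1) v j) =
      ∏ j ∈ ((Finset.range N).erase i).erase (i + 1),
        rowWeight (X (j + 1)) (Y (j + 1)) (X j) := by
    refine Finset.prod_congr rfl fun j hj => ?_
    have h1 := Finset.ne_of_mem_erase hj
    have h2 := Finset.ne_of_mem_erase (Finset.mem_of_mem_erase hj)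
    rw [Function.update_of_ne (by omega), Function.update_of_ne (by omega)]
  rw [this]
  have h1 := rowWeight_ne_zero (X (i + 1)) (Y (i + 1)) (X i)
  have h2 := rowWeight_ne_zero (X (i + 2)) (Y (i + 2)) (X (i + 1))
  simp only [show i + 1 + 1 = i + 2 from rfl]
  field_simp

/-- The contribution of a new cell at the end of the row of length `y`. -/
def addWeight (x y z w : ℕ) : ℚ :=
  if y + 1 < w ∧ y < z then
    (if y = 0 then 1 else 2) * (rowWeight x (y + 1) z / rowWeight x y z) else 0

/-- The contribution of a cell removed from the row of length `z`. -/
def removeWeight (x y z w : ℕ) : ℚ :=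
  if (x + 1 < z ∨ z = 1 ∧ x = 0) ∧ y < z then
    (if z = 1 then 1 else 2) * (if w = z then 2 else 1) *
      (rowWeight x y (z - 1) / rowWeight x y z) else 0

/-- The correction term that makes the sum telescope. -/
def tieWeight (x y : ℕ) : ℚ := if x = y ∧ 0 < y then 1 else 0

/-- Here $x\le y$ are the old and new lengths of one row and $z\le w$ those of the row above. Adding
a cell to the lower row of the new shape and removing one from the upper row of the old shape have
different weights, but the defect is a difference of terms that detect a nonempty row left unchanged
by the strip. Hence it telescopes. -/
theorem addWeight_eq {x y z w : ℕ} (h1 : x ≤ y) (h2 : y ≤ z) (h3 : z ≤ w)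
    (h4 : 0 < z → x < z) (h5 : 0 < w → y < w) :
    addWeight x y z w = removeWeight x y z w + 2 * (tieWeight x y - tieWeight z w) := by
  unfold addWeight removeWeight tieWeight rowWeight
  split_ifs <;> first | omega | norm_num

theorem rowWeight_pred {z w u : ℕ} (h1 : z ≤ w) (h3 : z < u) (h4 : 0 < z) :
    rowWeight (z - 1) w u / rowWeight z w u = if w = z then 2 else 1 := by
  unfold rowWeight
  split_ifs <;> first | omega | norm_num

/-- Row 0 is a fictitious row above the diagram. Summing the local identity `addWeight_eq` over all
rows makes the tie terms telescope to zero. What is left on the right is the removals from genuine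
rows and the term of the fictitious row, which supplies $2\cdot$`rowProd X Y N`. -/
theorem sum_rowProd {X Y : ℕ → ℕ} (hX : StrictAntiSeq X) (hY : StrictAntiSeq Y)
    (hI : Interlace X Y) (h0 : Y 1 + 2 ≤ X 0) (h0' : X 0 < Y 0) {N : ℕ} (hN : X N = 0)
    (hN' : Y N = 0) :
    (∑ i ∈ Finset.range N, if Y (i + 1) + 1 < Y i ∧ Y (i + 1) < X i then
      (if Y (i + 1) = 0 then (1 : ℚ) else 2) *
        rowProd X (Function.update Y (i + 1) (Y (i + 1) + 1)) N else 0) =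
    (∑ i ∈ Finset.range N, if (X (i + 2) + 1 < X (i + 1) ∨ X (i + 1) = 1 ∧ X (i + 2) = 0) ∧
        Y (i + 2) < X (i + 1) then
      (if X (i + 1) = 1 then (1 : ℚ) else 2) *
        rowProd (Function.update X (i + 1) (X (i + 1) - 1)) Y N else 0) + 2 * rowProd X Y N := by
  obtain ⟨N, rfl⟩ : ∃ M, N = M + 1 := by
    rcases N with _ | N
    · omega
    · exact ⟨N, rfl⟩
  have hA : ∀ i ∈ Finset.range (N + 1), (if Y (i + 1) + 1 < Y i ∧ Y (i + 1) < X i then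
      (if Y (i + 1) = 0 then (1 : ℚ) else 2) *
        rowProd X (Function.update Y (i + 1) (Y (i + 1) + 1)) (N + 1) else 0) =
      rowProd X Y (N + 1) * addWeight (X (i + 1)) (Y (i + 1)) (X i) (Y i) := by
    intro i hi
    rw [rowProd_update_add X Y (Finset.mem_range.1 hi)]
    unfold addWeight
    split_ifs <;> ring
  have hB : ∀ i ∈ Finset.range N,
      (if (X (i + 2) + 1 < X (i + 1) ∨ X (i + 1) = 1 ∧ X (i + 2) = 0) ∧
        Y (i + 2) < X (i + 1) then
      (if X (i + 1) = 1 then (1 : ℚ) else 2) *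
        rowProd (Function.update X (i + 1) (X (i + 1) - 1)) Y (N + 1) else 0) =
      rowProd X Y (N + 1) * removeWeight (X (i + 2)) (Y (i + 2)) (X (i + 1)) (Y (i + 1)) := by
    intro i hi
    rw [rowProd_update_sub X Y (by have := Finset.mem_range.1 hi; omega)]
    unfold removeWeight
    by_cases h : (X (i + 2) + 1 < X (i + 1) ∨ X (i + 1) = 1 ∧ X (i + 2) = 0) ∧
        Y (i + 2) < X (i + 1)
    · rw [if_pos h, if_pos h, rowWeight_pred (hI (i + 1)).1 ((hX i).2 _) (by omega)]
      · ring
      · have := (hX i).1; omega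
    · rw [if_neg h, if_neg h, mul_zero]
  have hlast : (if (X (N + 2) + 1 < X (N + 1) ∨ X (N + 1) = 1 ∧ X (N + 2) = 0) ∧
        Y (N + 2) < X (N + 1) then (if X (N + 1) = 1 then (1 : ℚ) else 2) *
        rowProd (Function.update X (N + 1) (X (N + 1) - 1)) Y (N + 1) else 0) = 0 :=
    if_neg (by omega)
  rw [Finset.sum_congr rfl hA, Finset.sum_range_succ (fun i => if (X (i + 2) + 1 < X (i + 1) ∨
    X (i + 1) = 1 ∧ X (i + 2) = 0) ∧ Y (i + 2) < X (i + 1) then _ else _) N, hlast, add_zero,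
    Finset.sum_congr rfl hB, ← Finset.mul_sum, ← Finset.mul_sum]
  have hloc : ∀ i, addWeight (X (i + 1)) (Y (i + 1)) (X i) (Y i) =
      removeWeight (X (i + 1)) (Y (i + 1)) (X i) (Y i) +
        2 * (tieWeight (X (i + 1)) (Y (i + 1)) - tieWeight (X i) (Y i)) := fun i =>
    addWeight_eq (hI (i + 1)).1 (hI i).2 (hI i).1 (hX i).2 (hY i).2
  rw [Finset.sum_congr rfl fun i _ => hloc i, Finset.sum_add_distrib, ← Finset.mul_sum,
    Finset.sum_range_sub (fun i => tieWeight (X i) (Y i)), Finset.sum_range_succ' _ N]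
  -- The fictitious row is long enough that shortening it by one changes no comparison, so only the
  -- factor 2 for a cell outside the first column remains.
  have e1 : removeWeight (X 1) (Y 1) (X 0) (Y 0) = 2 := by
    have := (hI 1).1
    unfold removeWeight rowWeight
    split_ifs <;> first | omega | norm_num
  have e2 : tieWeight (X (N + 1)) (Y (N + 1)) = 0 := by simp [tieWeight, hN']
  have e3 : tieWeight (X 0) (Y 0) = 0 := by
    unfold tieWeight; rw [if_neg (by omega)]
  rw [e2, e3, zero_add, e1]
  ring

/-! ### The column statistic of a strip as a product over rows -/

/-- The columns of `μ` that contain a cell outside `ν`. -/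
def stripCols (ν μ : YoungDiagram) : Finset ℕ := (μ.cells \ ν.cells).image Prod.snd

/-- The number of columns `r` containing a cell of `μ` outside `ν` such that column `r + 1` contains
no such cell. -/
def stripEnds (ν μ : YoungDiagram) : ℕ :=
  ((stripCols ν μ).filter fun r => r + 1 ∉ stripCols ν μ).card

theorem mem_stripCols {ν μ : YoungDiagram} {c : ℕ} :
    c ∈ stripCols ν μ ↔ ∃ i, ν.rowLen i ≤ c ∧ c < μ.rowLen i := by
  simp only [stripCols, Finset.mem_image, Finset.mem_sdiff, YoungDiagram.mem_cells, Prod.exists,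
    YoungDiagram.mem_iff_lt_rowLen, not_lt]
  constructor
  · rintro ⟨i, _, h, rfl⟩
    exact ⟨i, h.2, h.1⟩
  · rintro ⟨i, h⟩
    exact ⟨i, c, ⟨h.2, h.1⟩, rfl⟩

/-- The sequence `M, x 0, x 1, …`. -/
def pad (M : ℕ) (x : ℕ → ℕ) : ℕ → ℕ
  | 0 => M
  | i + 1 => x i

theorem pad_update (M : ℕ) (x : ℕ → ℕ) (i v : ℕ) :
    pad M (Function.update x i v) = Function.update (pad M x) (i + 1) v := by
  funext j
  rcases j with _ | j
  · simp [pad]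
  · simp [pad, Function.update_apply]

theorem colLen_le_of_rowLen_eq_zero {μ : YoungDiagram} {N : ℕ} (h : μ.rowLen N = 0) :
    μ.colLen 0 ≤ N := by
  by_contra! hn
  have := rowLen_pos_iff.2 hn
  omega

theorem isStrict_iff {μ : YoungDiagram} : IsStrict μ ↔ StrictAntiSeq μ.rowLen :=
  ⟨fun h i => ⟨rowLen_antitone μ (Nat.le_succ i), h i⟩, fun h i => (h i).2⟩

/-- A run of columns ends with the last cell of some row $i$ that has new cells. It fails to end
there exactly when the new cells of row $i-1$ begin in the next column, that is, when
$\mu_i=\nu_{i-1}$. The bound `M` plays the role of $\nu_{-1}$ and only has to exceed $\mu_0$; `M'`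
does not enter the product. -/
theorem two_pow_stripEnds {ν μ : YoungDiagram} (hμ : IsStrict μ)
    (hI : Interlace ν.rowLen μ.rowLen) {M M' N : ℕ} (hM : μ.rowLen 0 < M)
    (hN : μ.colLen 0 ≤ N) :
    (2 : ℚ) ^ stripEnds ν μ = rowProd (pad M ν.rowLen) (pad M' μ.rowLen) N := by
  unfold rowProd rowWeight
  rw [← Finset.prod_filter, Finset.prod_const]
  congr 1
  symm
  refine Finset.card_bij (fun i _ => μ.rowLen i - 1) ?_ ?_ ?_
  · intro i hi
    rw [Finset.mem_filter, Finset.mem_range] at hi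
    simp only [pad] at hi
    rw [Finset.mem_filter, mem_stripCols, mem_stripCols, Nat.sub_add_cancel (by omega)]
    refine ⟨⟨i, by omega, by omega⟩, ?_⟩
    rintro ⟨r, h1, h2⟩
    have h3 := hi.2.2
    rcases lt_trichotomy r i with h | h | h
    · obtain ⟨j, rfl⟩ : ∃ j, i = j + 1 := ⟨i - 1, by omega⟩
      simp only at h3
      have := rowLen_antitone ν (show r ≤ j by omega)
      omega
    · subst h; omega
    · have := rowLen_antitone μ h.le
      omega
  · intro i hi j hj h
    rw [Finset.mem_filter, Finset.mem_range] at hi hj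
    simp only [pad] at hi hj
    have key : ∀ i j, 0 < μ.rowLen i → i < j → μ.rowLen j < μ.rowLen i := fun i j hp hij =>
      (rowLen_antitone μ (show i + 1 ≤ j by omega)).trans_lt (hμ i hp)
    rcases lt_trichotomy i j with hij | hij | hij
    · have := key i j (by omega) hij; omega
    · exact hij
    · have := key j i (by omega) hij; omega
  · intro c hc
    rw [Finset.mem_filter, mem_stripCols, mem_stripCols] at hc
    obtain ⟨⟨i, h1, h2⟩, h3⟩ := hc
    have h4 : c + 1 = μ.rowLen i := by
      by_contra hne
      exact h3 ⟨i, by omega, by omega⟩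
    refine ⟨i, ?_, by omega⟩
    have hiN := rowLen_pos_iff.1 (show 0 < μ.rowLen i by omega)
    rw [Finset.mem_filter, Finset.mem_range]
    simp only [pad]
    refine ⟨by omega, by omega, ?_⟩
    rcases i with _ | i
    · exact hM
    · simp only
      by_contra hn
      refine h3 ⟨i, by omega, ?_⟩
      have := (hI i).2
      have := hμ i ((show 0 < μ.rowLen (i + 1) by omega).trans_le
        (rowLen_antitone μ (Nat.le_succ i)))
      omega

/-! ### The commutation relation for strict partitions -/

open Classical in
/-- The coefficient of `P_μ` in the product of `P_ν` with some `q_a`. -/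
def qKernel (ν μ : YoungDiagram) : ℕ :=
  if IsStrict ν ∧ IsStrict μ ∧ HStrip ν μ then 2 ^ stripEnds ν μ else 0

open Classical in
/-- The weight for removing a cell from a strict diagram: `1` if the cell is in the first column,
and `2` otherwise. -/
def strictCoverKernel (ν μ : YoungDiagram) : ℕ :=
  if IsStrict ν ∧ IsStrict μ ∧ Covers ν μ then (if μ.colLen 0 = ν.colLen 0 then 2 else 1) else 0

/-- Either update makes the strip empty in the row concerned, which then has weight 1. The weight of
the next row could differ only through the comparison with the changed old length, and strictness of
`Y` makes the two comparisons agree whenever that row has new cells. -/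
theorem rowProd_update_comm {X Y : ℕ → ℕ} (hY : StrictAntiSeq Y) {i : ℕ} (N : ℕ)
    (h : X (i + 1) = Y (i + 1) + 1) :
    rowProd X (Function.update Y (i + 1) (Y (i + 1) + 1)) N =
      rowProd (Function.update X (i + 1) (X (i + 1) - 1)) Y N := by
  refine Finset.prod_congr rfl fun j _ => ?_
  simp only [Function.update_apply]
  have h1 := hY (i + 1)
  unfold rowWeight
  by_cases hj : j = i
  · subst hj
    simp [h]
  · by_cases hj' : j = i + 1
    · subst hj'
      simp only [show i + 1 + 1 ≠ i + 1 by omega, if_true, if_false]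
      split_ifs <;> first | rfl | omega
    · simp [hj, hj']

theorem colLen_eq_iff_of_update {ν μ : YoungDiagram} {i : ℕ}
    (h : μ.rowLen = Function.update ν.rowLen i (ν.rowLen i + 1)) :
    μ.colLen 0 = ν.colLen 0 ↔ ν.rowLen i ≠ 0 := by
  have key : ∀ j, (j < μ.colLen 0 ↔ j < ν.colLen 0 ∨ j = i) := by
    intro j
    rw [← rowLen_pos_iff, ← rowLen_pos_iff, h, Function.update_apply]
    split_ifs with hj
    · simp [hj]
    · simp [hj]
  constructor
  · intro he h0
    have h1 := (key i).2 (Or.inr rfl)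
    rw [he, ← rowLen_pos_iff] at h1
    omega
  · intro h0
    have h1 := rowLen_pos_iff.1 (Nat.pos_of_ne_zero h0)
    refine eq_of_forall_lt_iff fun j => ?_
    rw [key]
    constructor
    · rintro (h | rfl)
      · exact h
      · exact h1
    · exact Or.inl

theorem isStrict_iff_of_update_add {ν μ : YoungDiagram} (hν : IsStrict ν) {i : ℕ}
    (h : μ.rowLen = Function.update ν.rowLen i (ν.rowLen i + 1)) :
    IsStrict μ ↔ i = 0 ∨ ν.rowLen i + 1 < ν.rowLen (i - 1) := by
  constructor
  · intro hs
    rcases i with _ | i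
    · exact Or.inl rfl
    · right
      have h1 := hs i
      rw [h, Function.update_self, Function.update_of_ne (by omega)] at h1
      have h2 := rowLen_antitone μ (Nat.le_succ i)
      rw [h] at h2
      simp only [Nat.succ_eq_add_one, Function.update_self] at h2
      rw [Function.update_of_ne (by omega)] at h2
      simp only [Nat.add_sub_cancel]
      omega
  · intro hi j hj
    rw [h] at hj ⊢
    have h1 := hν j
    have h2 := rowLen_antitone ν (Nat.le_succ j)
    simp only [Function.update_apply, Nat.succ_eq_add_one] at *
    split_ifs at * with h3 h4 h4
    · omega
    · subst h3
      simp at hi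
      omega
    · subst h4; omega
    · exact h1 hj

theorem isStrict_iff_of_update_sub {ν μ : YoungDiagram} (hμ : IsStrict μ) {i : ℕ}
    (hi : 0 < μ.rowLen i)
    (h : ν.rowLen = Function.update μ.rowLen i (μ.rowLen i - 1)) :
    IsStrict ν ↔ μ.rowLen (i + 1) + 1 < μ.rowLen i ∨ μ.rowLen i = 1 ∧ μ.rowLen (i + 1) = 0 := by
  constructor
  · intro hs
    have h1 := hs i
    have h2 := rowLen_antitone ν (Nat.le_succ i)
    rw [h] at h1 h2
    simp only [Nat.succ_eq_add_one, Function.update_self] at h1 h2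
    rw [Function.update_of_ne (by omega)] at h1 h2
    omega
  · intro hi j hj
    rw [h] at hj ⊢
    have h1 := hμ j
    have h2 := rowLen_antitone μ (Nat.le_succ j)
    simp only [Function.update_apply, Nat.succ_eq_add_one] at *
    split_ifs at * with h3 h4 h4
    · omega
    · subst h3
      omega
    · subst h4; omega
    · exact h1 hj

theorem strictAntiSeq_pad {x : ℕ → ℕ} (hx : StrictAntiSeq x) {M : ℕ} (hM : x 0 < M) :
    StrictAntiSeq (pad M x)
  | 0 => ⟨hM.le, fun _ => hM⟩
  | i + 1 => hx i

/-- This is $DQ_a=Q_aD+2Q_{a-1}$ in matrix form. The matching of moves is the one for horizontal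
strips; in the interlacing case the weights $2^{q}$ and the weights 1 or 2 of the removed cell agree
only after the summation in `sum_rowProd`. -/
theorem sum_qKernel (lam ν : YoungDiagram) :
    (∑ μ ∈ diagrams (ν.card + 1), (qKernel lam μ : ℚ) * strictCoverKernel ν μ) =
      (∑ κ ∈ diagrams (lam.card - 1), (strictCoverKernel κ lam : ℚ) * qKernel κ ν) +
        2 * qKernel lam ν := by
  classical
  by_cases hs : IsStrict lam ∧ IsStrict ν
  swap
  · rcases not_and_or.1 hs with h | h <;> simp [qKernel, strictCoverKernel, h]
  obtain ⟨hlam, hν⟩ := hs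
  set N := lam.colLen 0 + ν.colLen 0 + 1 with hN
  -- The fictitious top rows get lengths `M` and `M + 1`: long enough for the inequalities on the
  -- top rows in `sum_rowProd`, and such that adding a cell to the first real row is never
  -- obstructed.
  set M := lam.rowLen 0 + ν.rowLen 0 + 2 with hM
  set x := lam.rowLen with hx
  set y := ν.rowLen with hy
  set X := pad M x with hX
  set Y := pad (M + 1) y with hY
  have sX : StrictAntiSeq X := strictAntiSeq_pad (isStrict_iff.1 hlam) (by omega)
  have sY : StrictAntiSeq Y := strictAntiSeq_pad (isStrict_iff.1 hν) (by omega)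
  have zx : x (N - 1) = 0 := rowLen_eq_zero_of_le (by omega)
  have zy : y (N - 1) = 0 := rowLen_eq_zero_of_le (by omega)
  have zX : X N = 0 := zx
  have zY : Y N = 0 := zy
  have hYv : ∀ i, (i = 0 ∨ y i + 1 < y (i - 1)) ↔ Y (i + 1) + 1 < Y i := by
    rintro (_ | i)
    · simp only [true_or, true_iff]
      change y 0 + 1 < M + 1
      omega
    · simp [Y, pad]
  have hXv : ∀ i, (i = 0 ∨ y i < x (i - 1)) ↔ Y (i + 1) < X i := by
    rintro (_ | i)
    · simp only [true_or, true_iff]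
      change y 0 < M
      omega
    · simp [X, Y, pad]
  have hA : (∑ μ ∈ diagrams (ν.card + 1), (qKernel lam μ : ℚ) * strictCoverKernel ν μ) =
      ∑ i ∈ Finset.range N, if (Y (i + 1) + 1 < Y i) ∧ Interlace x (Function.update y i (y i + 1))
        then (if Y (i + 1) = 0 then (1 : ℚ) else 2) *
          rowProd X (Function.update Y (i + 1) (Y (i + 1) + 1)) N else 0 := by
    have h1 : ∀ μ ∈ diagrams (ν.card + 1), (qKernel lam μ : ℚ) * strictCoverKernel ν μ =
        if Covers ν μ then (qKernel lam μ : ℚ) * (if IsStrict μ then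
          (if μ.colLen 0 = ν.colLen 0 then 2 else 1) else 0) else 0 := by
      intro μ _
      unfold strictCoverKernel
      by_cases h1 : IsStrict μ <;> by_cases h2 : Covers ν μ <;> simp [h1, h2, hν]
    rw [Finset.sum_congr rfl h1, sum_covers_above ν (N := N) (by omega) _
      (fun i => if (Y (i + 1) + 1 < Y i) ∧ Interlace x (Function.update y i (y i + 1))
        then (if Y (i + 1) = 0 then (1 : ℚ) else 2) *
          rowProd X (Function.update Y (i + 1) (Y (i + 1) + 1)) N else 0)]
    · refine Finset.sum_congr rfl fun i _ => ?_
      by_cases h : i = 0 ∨ y i < y (i - 1)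
      · rw [if_pos h]
      · rw [if_neg h, if_neg]
        rintro ⟨h', -⟩
        rw [← hYv] at h'
        omega
    · intro i μ hi h
      have e1 := isStrict_iff_of_update_add hν h
      have e2 := colLen_eq_iff_of_update h
      rw [← hy, hYv] at e1
      rw [← hy] at e2 h hi
      unfold qKernel
      rw [HStrip_iff_interlace, e1, h, ← hx]
      by_cases c1 : Y (i + 1) + 1 < Y i
      · by_cases c2 : Interlace x (Function.update y i (y i + 1))
        · rw [if_pos (show IsStrict lam ∧ Y (i + 1) + 1 < Y i ∧
              Interlace x (Function.update y i (y i + 1)) from ⟨hlam, c1, c2⟩), if_pos c1,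
            if_pos (show Y (i + 1) + 1 < Y i ∧
              Interlace x (Function.update y i (y i + 1)) from ⟨c1, c2⟩)]
          have hzero : μ.rowLen N = 0 := by
            rw [h, Function.update_apply]
            have : y N ≤ y (N - 1) := rowLen_antitone ν (show N - 1 ≤ N by omega)
            split_ifs with hNi
            · have hz2 : y (i - 1) = 0 := by rw [← hNi]; exact zy
              rw [hz2] at hi
              omega
            · omega
          have hM0 : μ.rowLen 0 < M := by
            rw [h, Function.update_apply]
            split_ifs with h0
            · rw [← h0]; omega
            · omega
          push_cast
          rw [two_pow_stripEnds (e1.2 c1) (by rw [h]; exact c2) (M := M) (M' := M + 1) (N := N)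
            hM0 (colLen_le_of_rowLen_eq_zero hzero), h, pad_update, mul_comm]
          congr 1
          have e3 : Y (i + 1) = y i := rfl
          rw [e3]
          by_cases c3 : y i = 0
          · rw [if_neg (by rw [e2]; exact not_not.2 c3), if_pos c3]
          · rw [if_pos (e2.2 c3), if_neg c3]
        · simp [c2]
      · simp [c1]
  have hB : (∑ κ ∈ diagrams (lam.card - 1), (strictCoverKernel κ lam : ℚ) * qKernel κ ν) =
      ∑ i ∈ Finset.range N, if (X (i + 2) + 1 < X (i + 1) ∨ X (i + 1) = 1 ∧ X (i + 2) = 0) ∧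
        Interlace (Function.update x i (x i - 1)) y
        then (if X (i + 1) = 1 then (1 : ℚ) else 2) *
          rowProd (Function.update X (i + 1) (X (i + 1) - 1)) Y N else 0 := by
    have h1 : ∀ κ ∈ diagrams (lam.card - 1), (strictCoverKernel κ lam : ℚ) * qKernel κ ν =
        if Covers κ lam then (if IsStrict κ then
          (if lam.colLen 0 = κ.colLen 0 then 2 else 1) else 0) * (qKernel κ ν : ℚ) else 0 := by
      intro κ _
      unfold strictCoverKernel
      by_cases h1 : IsStrict κ <;> by_cases h2 : Covers κ lam <;> simp [h1, h2, hlam]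
    rw [Finset.sum_congr rfl h1, sum_covers_below lam (N := N) (by omega) _
      (fun i => if (X (i + 2) + 1 < X (i + 1) ∨ X (i + 1) = 1 ∧ X (i + 2) = 0) ∧
        Interlace (Function.update x i (x i - 1)) y
        then (if X (i + 1) = 1 then (1 : ℚ) else 2) *
          rowProd (Function.update X (i + 1) (X (i + 1) - 1)) Y N else 0)]
    · refine Finset.sum_congr rfl fun i _ => ?_
      by_cases h : x (i + 1) < x i
      · rw [if_pos h]
      · rw [if_neg h, if_neg]
        rintro ⟨h', -⟩
        change x (i + 1) + 1 < x i ∨ x i = 1 ∧ x (i + 1) = 0 at h'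
        omega
    · intro i κ hi h
      have e1 := isStrict_iff_of_update_sub hlam (by omega) h
      have h' : lam.rowLen = Function.update κ.rowLen i (κ.rowLen i + 1) := by
        rw [h, Function.update_self, Function.update_idem, Nat.sub_add_cancel (by omega),
          Function.update_eq_self]
      have e2 := colLen_eq_iff_of_update h'
      rw [h, Function.update_self] at e2
      rw [← hx] at e1 e2 h
      change _ ↔ X (i + 2) + 1 < X (i + 1) ∨ X (i + 1) = 1 ∧ X (i + 2) = 0 at e1
      unfold qKernel
      rw [HStrip_iff_interlace, e1, h, ← hy]
      by_cases c1 : X (i + 2) + 1 < X (i + 1) ∨ X (i + 1) = 1 ∧ X (i + 2) = 0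
      · by_cases c2 : Interlace (Function.update x i (x i - 1)) y
        · rw [if_pos (show (X (i + 2) + 1 < X (i + 1) ∨ X (i + 1) = 1 ∧ X (i + 2) = 0) ∧
              IsStrict ν ∧ Interlace (Function.update x i (x i - 1)) y from ⟨c1, hν, c2⟩),
            if_pos c1, if_pos (show (X (i + 2) + 1 < X (i + 1) ∨ X (i + 1) = 1 ∧ X (i + 2) = 0) ∧
              Interlace (Function.update x i (x i - 1)) y from ⟨c1, c2⟩)]
          push_cast
          rw [two_pow_stripEnds hν (by rw [h]; exact c2) (M := M) (M' := M + 1) (N := N)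
            (by omega) (by omega), h, pad_update]
          congr 1
          have e3 : X (i + 1) = x i := rfl
          rw [e3]
          by_cases c3 : x i = 1
          · rw [if_neg (by rw [e2]; omega), if_pos c3]
          · rw [if_pos (e2.2 (by omega)), if_neg c3]
        · simp [c2]
      · simp [c1]
  rw [hA, hB]
  by_cases hI : Interlace x y
  · have hIP : Interlace X Y := by
      rintro (_ | i)
      · exact ⟨Nat.le_succ M, by change y 0 ≤ M; omega⟩
      · exact hI i
    have hq : (qKernel lam ν : ℚ) = rowProd X Y N := by
      unfold qKernel
      rw [if_pos ⟨hlam, hν, HStrip_iff_interlace.2 hI⟩]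
      push_cast
      exact two_pow_stripEnds hν hI (by omega) (by omega)
    have main := sum_rowProd sX sY hIP (by change y 0 + 2 ≤ M; omega) (Nat.lt_succ_self M) zX zY
    rw [hq]
    simp only [hI.update_add_iff, hXv]
    rw [main]
    congr 1
    refine Finset.sum_congr rfl fun i _ => ?_
    by_cases c1 : X (i + 2) + 1 < X (i + 1) ∨ X (i + 1) = 1 ∧ X (i + 2) = 0
    · have h0 : 0 < X (i + 1) := by omega
      rw [hI.update_sub_iff i h0]
      by_cases c2 : y (i + 1) < x i
      · exact (if_pos ⟨c1, c2⟩).trans (if_pos ⟨c1, c2⟩).symm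
      · exact (if_neg fun h => c2 h.2).trans (if_neg fun h => c2 h.2).symm
    · simp [c1]
  -- Only rows with $x_i=y_i+1$ can contribute here, and there the two repairs carry the same weight
  -- by `rowProd_update_comm`.
  · have hq : qKernel lam ν = 0 := by
      unfold qKernel
      rw [if_neg (fun h => hI (HStrip_iff_interlace.1 h.2.2))]
    rw [hq, Nat.cast_zero, mul_zero, add_zero]
    refine Finset.sum_congr rfl fun i _ => ?_
    by_cases hi : x i = y i + 1
    · rw [interlace_update_iff (rowLen_antitone lam) (rowLen_antitone ν) hi,
        rowProd_update_comm sY N hi]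
      by_cases h : Interlace (Function.update x i (x i - 1)) y
      · have h2 := (h i).2
        have h3 := (h (i + 1)).1
        rw [Function.update_self] at h2
        rw [Function.update_of_ne (by omega)] at h3
        have e1 : Y (i + 1) + 1 < Y i := by
          rw [← hYv]
          rcases i with _ | i
          · exact Or.inl rfl
          · right
            have h4 := (h i).1
            rw [Function.update_of_ne (by omega)] at h4
            have h5 : x (i + 1) < x i := hlam i ((show 0 < x (i + 1) by omega).trans_le
              (rowLen_antitone lam (Nat.le_succ i)))
            simp only [Nat.add_sub_cancel]
            omega
        have e2 : X (i + 2) + 1 < X (i + 1) ∨ X (i + 1) = 1 ∧ X (i + 2) = 0 := by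
          change x (i + 1) + 1 < x i ∨ x i = 1 ∧ x (i + 1) = 0
          have h4 : 0 < y i → y (i + 1) < y i := hν i
          rcases Nat.eq_zero_or_pos (y i) with h5 | h5 <;> omega
        rw [if_pos (show Y (i + 1) + 1 < Y i ∧ Interlace (Function.update x i (x i - 1)) y
          from ⟨e1, h⟩), if_pos (show (X (i + 2) + 1 < X (i + 1) ∨ X (i + 1) = 1 ∧ X (i + 2) = 0) ∧
          Interlace (Function.update x i (x i - 1)) y from ⟨e2, h⟩)]
        congr 1
        change (if y i = 0 then (1 : ℚ) else 2) = if x i = 1 then 1 else 2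
        simp [hi]
      · rw [if_neg (fun h' => h h'.2), if_neg (fun h' => h h'.2)]
    · rw [if_neg (fun h => hi (h.2.of_update_add hI))]
      by_cases c1 : X (i + 2) + 1 < X (i + 1) ∨ X (i + 1) = 1 ∧ X (i + 2) = 0
      · have h0 : 0 < x i := by change 0 < X (i + 1); omega
        rw [if_neg (fun h => hi (h.2.of_update_sub h0 hI))]
      · simp [c1]

/-! ### Operators that add strips and remove cells -/

/-- The operator that adds `a` cells to a diagram, with matrix entries `k`. -/
def upOp (k : YoungDiagram → YoungDiagram → ℕ) (a : ℕ) : Module.End ℂ (YoungDiagram →₀ ℂ) :=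
  Finsupp.linearCombination ℂ fun lam =>
    ∑ μ ∈ diagrams (lam.card + a), Finsupp.single μ (k lam μ : ℂ)

/-- The operator that removes a cell from a diagram, with matrix entries `k`. -/
def downOp (k : YoungDiagram → YoungDiagram → ℕ) : Module.End ℂ (YoungDiagram →₀ ℂ) :=
  Finsupp.linearCombination ℂ fun lam =>
    ∑ κ ∈ diagrams (lam.card - 1), Finsupp.single κ (k κ lam : ℂ)

theorem upOp_single (k : YoungDiagram → YoungDiagram → ℕ) (a : ℕ) (lam : YoungDiagram) :
    upOp k a (Finsupp.single lam 1) =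
      ∑ μ ∈ diagrams (lam.card + a), Finsupp.single μ (k lam μ : ℂ) := by
  simp [upOp]

theorem downOp_single (k : YoungDiagram → YoungDiagram → ℕ) (lam : YoungDiagram) :
    downOp k (Finsupp.single lam 1) =
      ∑ κ ∈ diagrams (lam.card - 1), Finsupp.single κ (k κ lam : ℂ) := by
  simp [downOp]

theorem upOp_single_apply (k : YoungDiagram → YoungDiagram → ℕ) (a : ℕ) (lam μ : YoungDiagram) :
    upOp k a (Finsupp.single lam 1) μ = if μ.card = lam.card + a then (k lam μ : ℂ) else 0 := by
  classical
  rw [upOp_single, Finsupp.finsetSum_apply]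
  simp only [Finsupp.single_apply, Finset.sum_ite_eq', mem_diagrams]

theorem downOp_single_apply (k : YoungDiagram → YoungDiagram → ℕ) (lam κ : YoungDiagram) :
    downOp k (Finsupp.single lam 1) κ = if κ.card = lam.card - 1 then (k κ lam : ℂ) else 0 := by
  classical
  rw [downOp_single, Finsupp.finsetSum_apply]
  simp only [Finsupp.single_apply, Finset.sum_ite_eq', mem_diagrams]

theorem apply_single_smul {α β : Type*} (A : (α →₀ ℂ) →ₗ[ℂ] (β →₀ ℂ)) (x : α) (c : ℂ) (y : β) :
    A (Finsupp.single x c) y = c * A (Finsupp.single x 1) y := by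
  rw [← mul_one c, ← smul_eq_mul, ← Finsupp.smul_single, map_smul]
  simp

theorem downOp_upOp_apply {k dk : YoungDiagram → YoungDiagram → ℕ}
    (hdk : ∀ κ lam, dk κ lam ≠ 0 → lam.card = κ.card + 1) (a : ℕ) (lam ν : YoungDiagram) :
    downOp dk (upOp k a (Finsupp.single lam 1)) ν =
      if ν.card + 1 = lam.card + a then
        ∑ μ ∈ diagrams (ν.card + 1), (k lam μ : ℂ) * dk ν μ else 0 := by
  rw [upOp_single, map_sum, Finsupp.finsetSum_apply]
  have hs : ∀ μ ∈ diagrams (lam.card + a),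
      downOp dk (Finsupp.single μ (k lam μ : ℂ)) ν =
        k lam μ * if ν.card = μ.card - 1 then (dk ν μ : ℂ) else 0 := fun μ _ => by
    rw [apply_single_smul, downOp_single_apply]
  rw [Finset.sum_congr rfl hs]
  split_ifs with h
  · rw [h]
    refine Finset.sum_congr rfl fun μ hμ => ?_
    rw [mem_diagrams] at hμ
    rw [if_pos (by omega)]
  · refine Finset.sum_eq_zero fun μ hμ => ?_
    rw [mem_diagrams] at hμ
    by_cases h0 : dk ν μ = 0
    · simp [h0]
    · have := hdk _ _ h0
      omega

theorem upOp_downOp_apply {k dk : YoungDiagram → YoungDiagram → ℕ}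
    (hdk : ∀ κ lam, dk κ lam ≠ 0 → lam.card = κ.card + 1) (a : ℕ) (lam ν : YoungDiagram) :
    upOp k a (downOp dk (Finsupp.single lam 1)) ν =
      if ν.card + 1 = lam.card + a then
        ∑ κ ∈ diagrams (lam.card - 1), (dk κ lam : ℂ) * k κ ν else 0 := by
  rw [downOp_single, map_sum, Finsupp.finsetSum_apply]
  have key : ∀ κ ∈ diagrams (lam.card - 1),
      upOp k a (Finsupp.single κ (dk κ lam : ℂ)) ν =
        if ν.card + 1 = lam.card + a then (dk κ lam : ℂ) * k κ ν else 0 := by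
    intro κ _
    rw [apply_single_smul, upOp_single_apply]
    by_cases h0 : dk κ lam = 0
    · simp [h0]
    · have := hdk _ _ h0
      rw [mul_ite, mul_zero]
      exact if_congr (by omega) rfl rfl
  rw [Finset.sum_congr rfl key]
  split_ifs <;> simp

/-- `D` is a derivation-like operator for the sequence `A`, with constant `α`. -/
def IsLowering {R : Type*} [Ring R] [Algebra ℂ R] (D : R) (A : ℕ → R) (α : ℂ) : Prop :=
  D * A 0 = A 0 * D ∧ ∀ a, D * A (a + 1) = A (a + 1) * D + α • A a

/-- The kernel `k` does not record the number of added cells, so one identity of kernels covers all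
sizes. The sizes of `lam` and `ν` determine which `a` it concerns. -/
theorem isLowering_upOp {k dk : YoungDiagram → YoungDiagram → ℕ} {α : ℕ}
    (hdk : ∀ κ lam, dk κ lam ≠ 0 → lam.card = κ.card + 1)
    (hk : ∀ lam μ, k lam μ ≠ 0 → lam.card ≤ μ.card)
    (h : ∀ lam ν, (∑ μ ∈ diagrams (ν.card + 1), (k lam μ : ℚ) * dk ν μ) =
      (∑ κ ∈ diagrams (lam.card - 1), (dk κ lam : ℚ) * k κ ν) + α * k lam ν) :
    IsLowering (downOp dk) (upOp k) (α : ℂ) := by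
  have h' : ∀ lam ν, (∑ μ ∈ diagrams (ν.card + 1), (k lam μ : ℂ) * dk ν μ) =
      (∑ κ ∈ diagrams (lam.card - 1), (dk κ lam : ℂ) * k κ ν) + α * k lam ν := by
    intro lam ν
    exact_mod_cast h lam ν
  refine ⟨Finsupp.lhom_ext' fun lam => LinearMap.ext_ring (Finsupp.ext fun ν => ?_),
    fun a => Finsupp.lhom_ext' fun lam => LinearMap.ext_ring (Finsupp.ext fun ν => ?_)⟩
  · change downOp dk (upOp k 0 (Finsupp.single lam 1)) ν =
      upOp k 0 (downOp dk (Finsupp.single lam 1)) ν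
    rw [downOp_upOp_apply hdk, upOp_downOp_apply hdk, h']
    split_ifs with hc
    -- For `a = 0` the sizes satisfy $|\nu|+1=|\lambda|$, so `hk` rules out the correction term.
    · have : k lam ν = 0 := by
        by_contra hne
        have := hk _ _ hne
        omega
      simp [this]
    · rfl
  · change downOp dk (upOp k (a + 1) (Finsupp.single lam 1)) ν =
      upOp k (a + 1) (downOp dk (Finsupp.single lam 1)) ν +
        (α : ℂ) * upOp k a (Finsupp.single lam 1) ν
    rw [downOp_upOp_apply hdk, upOp_downOp_apply hdk, h', upOp_single_apply]
    by_cases hc : ν.card = lam.card + a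
    · rw [if_pos (by omega), if_pos (by omega), if_pos hc]
    · rw [if_neg (by omega), if_neg (by omega), if_neg hc]
      simp

open Classical in
/-- The indicator of horizontal strips. -/
def hKernel (ν μ : YoungDiagram) : ℕ := if HStrip ν μ then 1 else 0

open Classical in
/-- The indicator of vertical strips. -/
def vKernel (ν μ : YoungDiagram) : ℕ := if VStrip ν μ then 1 else 0

open Classical in
/-- The indicator of the covering relation. -/
def coverKernel (ν μ : YoungDiagram) : ℕ := if Covers ν μ then 1 else 0

theorem coverKernel_card (κ lam : YoungDiagram) (h : coverKernel κ lam ≠ 0) :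
    lam.card = κ.card + 1 := by
  unfold coverKernel at h
  split_ifs at h with hc
  · exact hc.2
  · exact absurd rfl h

theorem strictCoverKernel_card (κ lam : YoungDiagram) (h : strictCoverKernel κ lam ≠ 0) :
    lam.card = κ.card + 1 := by
  unfold strictCoverKernel at h
  split_ifs at h with hc
  · exact hc.2.2.2
  · exact hc.2.2.2
  · exact absurd rfl h

theorem card_mono {ν μ : YoungDiagram} (h : ν ≤ μ) : ν.card ≤ μ.card := Finset.card_le_card h

theorem isLowering_hKernel : IsLowering (downOp coverKernel) (upOp hKernel) 1 := by
  have := isLowering_upOp (k := hKernel) (dk := coverKernel) (α := 1) coverKernel_card ?_ ?_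
  · simpa using this
  · intro lam μ h
    unfold hKernel at h
    split_ifs at h with hc
    · exact card_mono hc.1
    · exact absurd rfl h
  · intro lam ν
    refine (Finset.sum_congr rfl fun μ _ => ?_).trans ((sum_HStrip lam ν).trans
      (congrArg₂ _ (Finset.sum_congr rfl fun κ _ => ?_) ?_)) <;>
      · unfold hKernel
        try unfold coverKernel
        split_ifs <;> simp

theorem isLowering_vKernel : IsLowering (downOp coverKernel) (upOp vKernel) 1 := by
  have := isLowering_upOp (k := vKernel) (dk := coverKernel) (α := 1) coverKernel_card ?_ ?_
  · simpa using this
  · intro lam μ h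
    unfold vKernel at h
    split_ifs at h with hc
    · exact card_mono hc.1
    · exact absurd rfl h
  · intro lam ν
    refine (Finset.sum_congr rfl fun μ _ => ?_).trans ((sum_VStrip lam ν).trans
      (congrArg₂ _ (Finset.sum_congr rfl fun κ _ => ?_) ?_)) <;>
      · unfold vKernel
        try unfold coverKernel
        split_ifs <;> simp

theorem isLowering_qKernel : IsLowering (downOp strictCoverKernel) (upOp qKernel) 2 := by
  have := isLowering_upOp (k := qKernel) (dk := strictCoverKernel) (α := 2)
    strictCoverKernel_card ?_ ?_
  · simpa using this
  · intro lam μ h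
    unfold qKernel at h
    split_ifs at h with hc
    · exact card_mono hc.2.2.1
    · exact absurd rfl h
  · intro lam ν
    exact_mod_cast sum_qKernel lam ν

/-! ### Calculus of the relation $DA_{a+1}=A_{a+1}D+\alpha A_a$ -/

section Lowering

variable {R : Type*} [Ring R] [Algebra ℂ R]

theorem IsLowering.smul {D : R} {A : ℕ → R} {α : ℂ} (h : IsLowering D A α) (c : ℂ) :
    IsLowering (c • D) A (c * α) := by
  refine ⟨by rw [smul_mul_assoc, h.1, mul_smul_comm], fun a => ?_⟩
  rw [smul_mul_assoc, h.2, smul_add, mul_smul_comm, smul_smul]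

theorem IsLowering.add {D D' : R} {A : ℕ → R} {α β : ℂ} (h : IsLowering D A α)
    (h' : IsLowering D' A β) : IsLowering (D + D') A (α + β) := by
  refine ⟨by rw [add_mul, mul_add, h.1, h'.1], fun a => ?_⟩
  rw [add_mul, mul_add, h.2, h'.2, add_smul]
  abel

theorem isLowering_zero_of_commute {D : R} {A : ℕ → R} (h : ∀ a, Commute D (A a)) :
    IsLowering D A 0 :=
  ⟨h 0, fun a => by rw [h, zero_smul, add_zero]⟩

/-- Leibniz rule for the convolution of two sequences. -/
theorem IsLowering.conv {D : R} {A B : ℕ → R} {α β : ℂ} (hA : IsLowering D A α)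
    (hB : IsLowering D B β) :
    IsLowering D (fun m => ∑ p ∈ Finset.HasAntidiagonal.antidiagonal m, A p.1 * B p.2) (α + β) := by
  have key : ∀ a b, D * (A a * B b) = A a * B b * D +
      (α • (if a = 0 then 0 else A (a - 1) * B b) +
        β • (if b = 0 then 0 else A a * B (b - 1))) := by
    intro a b
    have h1 : D * A a = A a * D + α • (if a = 0 then 0 else A (a - 1)) := by
      rcases a with _ | a
      · simp [hA.1]
      · simp [hA.2]
    have h2 : D * B b = B b * D + β • (if b = 0 then 0 else B (b - 1)) := by
      rcases b with _ | b
      · simp [hB.1]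
      · simp [hB.2]
    rw [← mul_assoc, h1, add_mul, mul_assoc (A a) D, h2, mul_add, ← mul_assoc, add_assoc]
    congr 1
    rw [add_comm]
    congr 1
    · split_ifs <;> simp
    · split_ifs <;> simp
  constructor
  · simp [key]
  · intro m
    rw [Finset.mul_sum, Finset.sum_mul, Finset.sum_congr rfl fun p _ => key p.1 p.2,
      Finset.sum_add_distrib, Finset.sum_add_distrib, ← Finset.smul_sum, ← Finset.smul_sum,
      Finset.Nat.sum_antidiagonal_succ (f := fun p => if p.1 = 0 then 0 else A (p.1 - 1) * B p.2),
      Finset.Nat.sum_antidiagonal_succ' (f := fun p => if p.2 = 0 then 0 else A p.1 * B (p.2 - 1))]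
    simp [add_smul]

/-- A functional that kills `A m` for `m > 0`, evaluated after `d` lowering operators. -/
theorem IsLowering.pow_mul {D : R} {A : ℕ → R} {α : ℂ} (h : IsLowering D A α)
    {V : Type*} [AddCommGroup V] [Module ℂ V] (ε : R →ₗ[ℂ] V)
    (h0 : ∀ x, ε (A 0 * x) = ε x) (hs : ∀ m x, ε (A (m + 1) * x) = 0) (d m : ℕ) (x : R) :
    ε (D ^ d * (A m * x)) = ((d.choose m : ℂ) * α ^ m) • ε (D ^ (d - m) * x) := by
  induction d generalizing m x with
  | zero =>
    rcases m with _ | m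
    · simp [h0]
    · simp [hs]
  | succ d ih =>
    rcases m with _ | m
    · rw [pow_succ, mul_assoc, ← mul_assoc D, h.1, mul_assoc, ih]
      simp [pow_succ, mul_assoc]
    · rw [pow_succ, mul_assoc, ← mul_assoc D, h.2, add_mul, mul_add, map_add, mul_assoc, ih,
        smul_mul_assoc, mul_smul_comm, map_smul, ih, Nat.succ_sub_succ, smul_smul]
      -- Pascal's rule combines the two terms. If $m+1>d$, the truncated exponent `d - (m + 1)` is
      -- harmless, since the binomial coefficient in front of it vanishes.
      by_cases hm : m + 1 ≤ d
      · rw [← mul_assoc (D ^ (d - (m + 1))), ← pow_succ, show d - (m + 1) + 1 = d - m by omega,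
          ← add_smul, Nat.choose_succ_succ]
        congr 1
        push_cast
        ring
      · rw [Nat.choose_eq_zero_of_lt (show d < m + 1 by omega), Nat.choose_succ_succ,
          Nat.choose_eq_zero_of_lt (show d < m.succ by omega)]
        simp only [Nat.cast_zero, zero_mul, zero_smul, zero_add, add_zero]
        congr 1
        ring

end Lowering

/-! ### Operators on one component of a multipartition -/

/-- The operator `A` acting on the `i`th component. -/
def lift {ℓ : ℕ} (i : Fin (ℓ + 1)) (A : Module.End ℂ (YoungDiagram →₀ ℂ)) :
    Module.End ℂ (Multipartition ℓ →₀ ℂ) :=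
  Finsupp.lsum ℂ fun lam => Finsupp.lmapDomain ℂ ℂ (Function.update lam i) ∘ₗ A ∘ₗ
    Finsupp.lsingle (lam i)

section Lift

variable {ℓ : ℕ} (i : Fin (ℓ + 1)) (A B : Module.End ℂ (YoungDiagram →₀ ℂ))

theorem lift_single (lam : Multipartition ℓ) (c : ℂ) :
    lift i A (Finsupp.single lam c) =
      Finsupp.mapDomain (Function.update lam i) (A (Finsupp.single (lam i) c)) := by
  simp [lift]

theorem lift_add : lift i (A + B) = lift i A + lift i B := by
  refine Finsupp.lhom_ext fun lam c => ?_
  simp [lift_single, Finsupp.mapDomain_add]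

theorem lift_smul (c : ℂ) : lift i (c • A) = c • lift i A := by
  refine Finsupp.lhom_ext fun lam c => ?_
  simp [lift_single, Finsupp.mapDomain_smul]

theorem lift_mapDomain (lam : Multipartition ℓ) (v : YoungDiagram →₀ ℂ) :
    lift i A (Finsupp.mapDomain (Function.update lam i) v) =
      Finsupp.mapDomain (Function.update lam i) (A v) := by
  induction v using Finsupp.induction_linear with
  | zero => simp
  | add f g hf hg => simp [Finsupp.mapDomain_add, hf, hg]
  | single μ c =>
    have : Function.update (Function.update lam i μ) i = Function.update lam i :=
      funext fun ν => Function.update_idem _ _ _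
    simp [lift_single, this]

theorem lift_mul : lift i (A * B) = lift i A * lift i B := by
  refine Finsupp.lhom_ext fun lam c => ?_
  simp [lift_single, lift_mapDomain]

/-- The matrix entries of a lifted operator depend only on its own component, so on a basis vector
both composites expand into the same double sum over the new components $i$ and $j$. -/
theorem lift_commute {i j : Fin (ℓ + 1)} (hij : i ≠ j) : Commute (lift i A) (lift j B) := by
  refine Finsupp.lhom_ext fun lam c => ?_
  have key : ∀ (i j : Fin (ℓ + 1)) (_ : i ≠ j) (A : Module.End ℂ (YoungDiagram →₀ ℂ))
      (w : YoungDiagram →₀ ℂ), lift i A (Finsupp.mapDomain (Function.update lam j) w) =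
      w.sum fun ν b => b • (A (Finsupp.single (lam i) 1)).sum fun μ a =>
        Finsupp.single (Function.update (Function.update lam j ν) i μ) a := by
    intro i j hij A w
    induction w using Finsupp.induction_linear with
    | zero => simp
    | add f g hf hg =>
      rw [Finsupp.mapDomain_add, map_add, hf, hg, Finsupp.sum_add_index']
      · simp
      · intro ν b b'
        rw [add_smul]
    | single ν b =>
      rw [Finsupp.mapDomain_single, lift_single, Function.update_of_ne hij,
        Finsupp.sum_single_index (by simp), ← mul_one b, ← smul_eq_mul, ← Finsupp.smul_single,
        map_smul, Finsupp.mapDomain_smul]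
      simp [Finsupp.mapDomain]
  have hc : ∀ μ : YoungDiagram, Finsupp.single μ c = c • Finsupp.single μ (1 : ℂ) := by simp
  rw [Module.End.mul_apply, Module.End.mul_apply, lift_single, lift_single,
    key i j hij, key j i hij.symm, hc, hc, map_smul, map_smul,
    Finsupp.sum_smul_index (by simp), Finsupp.sum_smul_index (by simp)]
  simp only [Finsupp.sum, Finset.smul_sum, Finsupp.smul_single]
  rw [Finset.sum_comm]
  refine Finset.sum_congr rfl fun μ _ => Finset.sum_congr rfl fun ν _ => ?_
  rw [Function.update_comm hij.symm]
  congr 1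
  simp only [smul_eq_mul]
  ring

theorem IsLowering.lift {D : Module.End ℂ (YoungDiagram →₀ ℂ)}
    {A : ℕ → Module.End ℂ (YoungDiagram →₀ ℂ)} {α : ℂ} (h : IsLowering D A α) :
    IsLowering (lift i D) (fun a => ColoredSym.lift i (A a)) α := by
  refine ⟨by rw [← lift_mul, h.1, lift_mul], fun a => ?_⟩
  simp only
  rw [← lift_mul, h.2, lift_add, lift_mul, lift_smul]

open Classical in
theorem lift_single_apply (lam μ : Multipartition ℓ) :
    lift i A (Finsupp.single lam 1) μ =
      if ∀ r, r ≠ i → lam r = μ r then A (Finsupp.single (lam i) 1) (μ i) else 0 := by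
  rw [lift_single]
  split_ifs with h
  · have hμ : μ = Function.update lam i (μ i) := by
      funext r
      rw [Function.update_apply]
      split_ifs with hr
      · rw [hr]
      · exact (h r hr).symm
    conv_lhs => rw [hμ]
    exact Finsupp.mapDomain_apply (Function.update_injective lam i) _ _
  · refine Finsupp.mapDomain_of_notMem_range _ _ ?_
    rintro ⟨ν, rfl⟩
    exact h fun r hr => (Function.update_of_ne hr _ _).symm

open Classical in
theorem lift_mul_lift_single_apply {i j : Fin (ℓ + 1)} (hij : i ≠ j) (lam μ : Multipartition ℓ) :
    (lift i A * lift j B) (Finsupp.single lam 1) μ =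
      if ∀ r, r ≠ i → r ≠ j → lam r = μ r then
        A (Finsupp.single (lam i) 1) (μ i) * B (Finsupp.single (lam j) 1) (μ j) else 0 := by
  rw [Module.End.mul_apply, lift_single]
  have key : ∀ w : YoungDiagram →₀ ℂ, lift i A (Finsupp.mapDomain (Function.update lam j) w) μ =
      if ∀ r, r ≠ i → r ≠ j → lam r = μ r then
        A (Finsupp.single (lam i) 1) (μ i) * w (μ j) else 0 := by
    intro w
    induction w using Finsupp.induction_linear with
    | zero => simp
    | add f g hf hg =>
      rw [Finsupp.mapDomain_add, map_add, Finsupp.add_apply, hf, hg, Finsupp.add_apply]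
      split_ifs <;> ring
    | single ν b =>
      rw [Finsupp.mapDomain_single, apply_single_smul, lift_single_apply,
        Function.update_of_ne hij]
      by_cases hν : ν = μ j
      · subst hν
        rw [Finsupp.single_eq_same]
        have : (∀ r, r ≠ i → Function.update lam j (μ j) r = μ r) ↔
            ∀ r, r ≠ i → r ≠ j → lam r = μ r := by
          refine forall_congr' fun r => forall_congr' fun _ => ?_
          rw [Function.update_apply]
          split_ifs with hr
          · simp [hr]
          · simp [hr]
        simp only [this, mul_ite, mul_zero, mul_comm]
      · rw [if_neg, Finsupp.single_eq_of_ne (Ne.symm hν)]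
        · simp
        · intro h
          have := h j hij.symm
          rw [Function.update_self] at this
          exact hν this
  exact key _

end Lift

/-! ### The operators on multipartitions -/

/-- The kernel of horizontal strips in the `i`th component. -/
def stripKernel {ℓ : ℕ} (i : Fin (ℓ + 1)) : YoungDiagram → YoungDiagram → ℕ :=
  if i = 0 then qKernel else hKernel

/-- The total weight with which a cell is added to component `i > 0` of a multipartition. -/
def compWeight {ℓ : ℕ} (i : Fin (ℓ + 1)) : ℕ := if i = Fin.last ℓ then 1 else 2

/-- The operator that removes a cell from component `i`. -/
def boxOp {ℓ : ℕ} (i : Fin (ℓ + 1)) : Module.End ℂ (YoungDiagram →₀ ℂ) :=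
  if i = 0 then downOp strictCoverKernel else (compWeight i : ℂ) • downOp coverKernel

/-- The operator that removes a cell from a multipartition. -/
def removeOp (ℓ : ℕ) : Module.End ℂ (Multipartition ℓ →₀ ℂ) := ∑ i, lift i (boxOp i)

/-- The operator that adds a strip of size `m` and color `j`. -/
def stepOp {ℓ : ℕ} (j : Fin ℓ) (m : ℕ) : Module.End ℂ (Multipartition ℓ →₀ ℂ) :=
  ∑ p ∈ Finset.HasAntidiagonal.antidiagonal m,
    lift j.castSucc (upOp (stripKernel j.castSucc) p.1) * lift j.succ (upOp vKernel p.2)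

/-- The factor `4` or `3` of the color `j`. -/
def colorFactor {ℓ : ℕ} (j : Fin ℓ) : ℕ := if (j : ℕ) + 1 = ℓ then 3 else 4

/-- The constant is 2 in both cases: in component 0 because of the $Q$-weights, and elsewhere
because a component of the form `j.castSucc` is not the last one and so has `compWeight` 2. -/
theorem isLowering_boxOp_castSucc {ℓ : ℕ} (j : Fin ℓ) :
    IsLowering (boxOp j.castSucc) (upOp (stripKernel j.castSucc)) 2 := by
  unfold boxOp stripKernel
  by_cases h : j.castSucc = 0
  · rw [if_pos h, if_pos h]
    exact isLowering_qKernel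
  · rw [if_neg h, if_neg h]
    have := isLowering_hKernel.smul (compWeight j.castSucc : ℂ)
    rw [compWeight, if_neg (Fin.castSucc_lt_last j).ne] at *
    simpa using this

theorem isLowering_boxOp_succ {ℓ : ℕ} (j : Fin ℓ) :
    IsLowering (boxOp j.succ) (upOp vKernel) (compWeight j.succ : ℂ) := by
  unfold boxOp
  rw [if_neg (Fin.succ_ne_zero j)]
  simpa using isLowering_vKernel.smul (compWeight j.succ : ℂ)

theorem isLowering_removeOp_lift {ℓ : ℕ} (i : Fin (ℓ + 1))
    {A : ℕ → Module.End ℂ (YoungDiagram →₀ ℂ)} {α : ℂ} (h : IsLowering (boxOp i) A α) :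
    IsLowering (removeOp ℓ) (fun a => lift i (A a)) α := by
  unfold removeOp
  rw [← Finset.add_sum_erase _ _ (Finset.mem_univ i), ← add_zero α]
  refine (h.lift i).add (isLowering_zero_of_commute fun a => ?_)
  refine Commute.sum_left _ _ _ fun r hr => lift_commute _ _ (Finset.ne_of_mem_erase hr)

/-- The constants of the two factors add by the Leibniz rule: $2+2=4$ in general, and $2+1=3$ if
component $j+1$ is the last. -/
theorem isLowering_stepOp {ℓ : ℕ} (j : Fin ℓ) :
    IsLowering (removeOp ℓ) (stepOp j) (colorFactor j : ℂ) := by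
  have h := (isLowering_removeOp_lift _ (isLowering_boxOp_castSucc j)).conv
    (isLowering_removeOp_lift _ (isLowering_boxOp_succ j))
  have hf : (2 : ℂ) + (compWeight j.succ : ℂ) = (colorFactor j : ℂ) := by
    have : j.succ = Fin.last ℓ ↔ (j : ℕ) + 1 = ℓ := by
      rw [Fin.ext_iff]; simp
    unfold compWeight colorFactor
    simp only [this]
    split_ifs <;> norm_num
  rw [hf] at h
  exact h

open Classical in
/-- The matrix entries of `stepOp j m`. -/
def stepKernel {ℓ : ℕ} (j : Fin ℓ) (ν lam : Multipartition ℓ) : ℕ :=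
  if ∀ r, r ≠ j.castSucc → r ≠ j.succ → ν r = lam r then
    stripKernel j.castSucc (ν j.castSucc) (lam j.castSucc) * vKernel (ν j.succ) (lam j.succ) else 0

theorem stripKernel_le {ℓ : ℕ} {i : Fin (ℓ + 1)} {ν μ : YoungDiagram}
    (h : stripKernel i ν μ ≠ 0) : ν ≤ μ := by
  unfold stripKernel at h
  by_cases hi : i = 0
  · rw [if_pos hi] at h
    unfold qKernel at h
    split_ifs at h with hc
    · exact hc.2.2.1
    · exact absurd rfl h
  · rw [if_neg hi] at h
    unfold hKernel at h
    split_ifs at h with hc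
    · exact hc.1
    · exact absurd rfl h

theorem vKernel_le {ν μ : YoungDiagram} (h : vKernel ν μ ≠ 0) : ν ≤ μ := by
  unfold vKernel at h
  split_ifs at h with hc
  · exact hc.1
  · exact absurd rfl h

/-- The number of nodes of a multipartition. -/
def size {ℓ : ℕ} (lam : Multipartition ℓ) : ℕ := ∑ i, (lam i).card

theorem size_eq {ℓ : ℕ} (j : Fin ℓ) (lam : Multipartition ℓ) :
    size lam = (lam j.castSucc).card + ((lam j.succ).card +
      ∑ i ∈ (Finset.univ.erase j.castSucc).erase j.succ, (lam i).card) := by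
  unfold size
  rw [← Finset.add_sum_erase _ _ (Finset.mem_univ j.castSucc),
    ← Finset.add_sum_erase _ _ (Finset.mem_erase.2 ⟨(Fin.castSucc_lt_succ).ne',
      Finset.mem_univ j.succ⟩)]

/-- In the sum over `(a, b)` with $a+b=m$ at most one term survives, because the sizes of the
components force `a` and `b`. The coefficient therefore does not depend on `m`. -/
theorem stepOp_single_apply {ℓ : ℕ} (j : Fin ℓ) (m : ℕ) (ν lam : Multipartition ℓ) :
    stepOp j m (Finsupp.single ν 1) lam =
      if size lam = size ν + m then (stepKernel j ν lam : ℂ) else 0 := by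
  classical
  have hne : j.castSucc ≠ j.succ := (Fin.castSucc_lt_succ).ne
  rw [stepOp, LinearMap.sum_apply, Finsupp.finsetSum_apply]
  simp only [lift_mul_lift_single_apply _ _ hne, upOp_single_apply]
  unfold stepKernel
  by_cases h : ∀ r, r ≠ j.castSucc → r ≠ j.succ → ν r = lam r
  swap
  · simp [h]
  simp only [if_pos h]
  have hrest : ∑ i ∈ (Finset.univ.erase j.castSucc).erase j.succ, (lam i).card =
      ∑ i ∈ (Finset.univ.erase j.castSucc).erase j.succ, (ν i).card := by
    refine Finset.sum_congr rfl fun i hi => ?_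
    rw [h i (Finset.ne_of_mem_erase (Finset.mem_of_mem_erase hi)) (Finset.ne_of_mem_erase hi)]
  rw [size_eq j lam, size_eq j ν, hrest]
  by_cases h0 : stripKernel j.castSucc (ν j.castSucc) (lam j.castSucc) = 0
  · simp [h0]
  by_cases h0' : vKernel (ν j.succ) (lam j.succ) = 0
  · simp [h0']
  have h1 := card_mono (stripKernel_le h0)
  have h2 := card_mono (vKernel_le h0')
  by_cases hm : (lam j.castSucc).card + (lam j.succ).card =
      (ν j.castSucc).card + (ν j.succ).card + m
  · rw [if_pos (by omega)]
    rw [Finset.sum_eq_single ((lam j.castSucc).card - (ν j.castSucc).card,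
      (lam j.succ).card - (ν j.succ).card)]
    · rw [if_pos (by omega), if_pos (by omega)]
      push_cast
      rfl
    · rintro ⟨a, b⟩ _ hab
      by_cases ha : (lam j.castSucc).card = (ν j.castSucc).card + a
      · by_cases hb : (lam j.succ).card = (ν j.succ).card + b
        · exact absurd (Prod.ext (by simp only; omega) (by simp only; omega)) hab
        · rw [if_neg hb, mul_zero]
      · rw [if_neg ha, zero_mul]
    · intro hn
      rw [Finset.HasAntidiagonal.mem_antidiagonal] at hn
      simp only at hn
      omega
  · rw [if_neg (by omega)]
    refine Finset.sum_eq_zero ?_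
    rintro ⟨a, b⟩ hab
    rw [Finset.HasAntidiagonal.mem_antidiagonal] at hab
    simp only at hab ⊢
    by_cases ha : (lam j.castSucc).card = (ν j.castSucc).card + a
    · rw [if_neg (show ¬ (lam j.succ).card = (ν j.succ).card + b by omega), mul_zero]
    · rw [if_neg ha, zero_mul]

/-! ### Removing the largest entry from a colored tableau -/

/-- A colored composition without its last part. -/
def ColoredComposition.init {ℓ n d : ℕ} (c : ColoredComposition ℓ (n + 1) d) :
    ColoredComposition ℓ n (d - c.part (Fin.last n)) where
  part := fun k => c.part k.castSucc
  color := fun k => c.color k.castSucc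
  sum_part := by
    have := c.sum_part
    rw [Fin.sum_univ_castSucc] at this
    omega

theorem ColoredComposition.last_le {ℓ n d : ℕ} (c : ColoredComposition ℓ (n + 1) d) :
    c.part (Fin.last n) ≤ d := by
  have := c.sum_part
  rw [Fin.sum_univ_castSucc] at this
  omega

section Tableau

variable {ℓ n d : ℕ} {lam ν : Multipartition ℓ} {c : ColoredComposition ℓ (n + 1) d}

theorem card_node (lam : Multipartition ℓ) : Fintype.card (Node lam) = size lam := by
  rw [Fintype.card_sigma]
  refine Finset.sum_congr rfl fun i _ => ?_
  exact Fintype.card_coe _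

theorem IsColoredTableau.size_eq {n d : ℕ} {c : ColoredComposition ℓ n d} {T : Node lam → Fin n}
    (h : IsColoredTableau lam c T) : size lam = d := by
  rw [← card_node, ← c.sum_part, ← Finset.card_univ,
    Finset.card_eq_sum_card_fiberwise (f := T) (t := Finset.univ) (fun _ _ => Finset.mem_univ _)]
  exact Finset.sum_congr rfl fun k _ => h.card_eq k

theorem IsColoredTableau.mono {n d : ℕ} {c : ColoredComposition ℓ n d} {T : Node lam → Fin n}
    (h : IsColoredTableau lam c T) (i : Fin (ℓ + 1)) {x y : ℕ × ℕ} (hx : x ∈ (lam i).cells)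
    (hy : y ∈ (lam i).cells) (hxy : x ≤ y) : T ⟨i, x, hx⟩ ≤ T ⟨i, y, hy⟩ := by
  obtain ⟨r, s⟩ := x
  obtain ⟨r', s'⟩ := y
  obtain ⟨hr, hs⟩ : r ≤ r' ∧ s ≤ s' := hxy
  obtain ⟨p, rfl⟩ := Nat.exists_eq_add_of_le hr
  obtain ⟨q, rfl⟩ := Nat.exists_eq_add_of_le hs
  have hcol : ∀ q (hq : (r, s + q) ∈ (lam i).cells), T ⟨i, (r, s), hx⟩ ≤ T ⟨i, (r, s + q), hq⟩ := by
    intro q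
    induction q with
    | zero => intro _; exact le_rfl
    | succ q ih =>
      intro hq
      have hq' : (r, s + q) ∈ (lam i).cells := (lam i).up_left_mem le_rfl (by omega) hq
      exact (ih hq').trans (h.row_le ⟨i, (r, s + q), hq'⟩ ⟨i, (r, s + (q + 1)), hq⟩ rfl rfl rfl)
  have hq : (r, s + q) ∈ (lam i).cells := (lam i).up_left_mem (by omega) le_rfl hy
  refine (hcol q hq).trans ?_
  clear hr
  induction p with
  | zero => exact le_rfl
  | succ p ih =>
    have hp' : (r + p, s + q) ∈ (lam i).cells := (lam i).up_left_mem (by omega) le_rfl hy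
    exact (ih hp').trans (h.col_le ⟨i, (r + p, s + q), hp'⟩ ⟨i, (r + (p + 1), s + q), hy⟩ rfl rfl rfl)

open Classical in
/-- The nodes weakly above and to the left of a node that does not carry the largest entry. -/
def innerShape (T : Node lam → Fin (n + 1)) : Multipartition ℓ := fun i =>
  { cells := (lam i).cells.filter fun x =>
      ∃ y, ∃ hy : y ∈ (lam i).cells, x ≤ y ∧ T ⟨i, y, hy⟩ ≠ Fin.last n
    isLowerSet := by
      intro x z hzx hx
      simp only [Finset.coe_filter, Set.mem_ofPred_eq] at hx ⊢
      obtain ⟨hx, y, hy, hxy, hT⟩ := hx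
      exact ⟨(lam i).isLowerSet hzx hx, y, hy, hzx.trans hxy, hT⟩ }

/-- The closure in `innerShape` only serves to produce a Young diagram for arbitrary `T`. For a
tableau it adds no node, since entries increase weakly to the right and downwards. -/
theorem mem_innerShape {T : Node lam → Fin (n + 1)} (h : IsColoredTableau lam c T)
    {i : Fin (ℓ + 1)} {x : ℕ × ℕ} : x ∈ innerShape T i ↔
      ∃ hx : x ∈ (lam i).cells, T ⟨i, x, hx⟩ ≠ Fin.last n := by
  rw [← YoungDiagram.mem_cells]
  simp only [innerShape, Finset.mem_filter]
  constructor
  · rintro ⟨hx, y, hy, hxy, hT⟩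
    exact ⟨hx, ((h.mono i hx hy hxy).trans_lt (lt_of_le_of_ne (Fin.le_last _) hT)).ne⟩
  · rintro ⟨hx, hT⟩
    exact ⟨hx, x, hx, le_rfl, hT⟩

open Classical in
/-- The extension of a tableau by the largest entry. -/
def extend (lam : Multipartition ℓ) (T : Node ν → Fin n) : Node lam → Fin (n + 1) := fun a =>
  if h : a.2.1 ∈ (ν a.1).cells then (T ⟨a.1, a.2.1, h⟩).castSucc else Fin.last n

theorem extend_of_mem (T : Node ν → Fin n) (a : Node lam) (h : a.2.1 ∈ (ν a.1).cells) :
    extend lam T a = (T ⟨a.1, a.2.1, h⟩).castSucc := dif_pos h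

theorem extend_of_notMem (T : Node ν → Fin n) (a : Node lam) (h : a.2.1 ∉ (ν a.1).cells) :
    extend lam T a = Fin.last n := dif_neg h

theorem extend_eq_last_iff (T : Node ν → Fin n) (a : Node lam) :
    extend lam T a = Fin.last n ↔ a.2.1 ∉ (ν a.1).cells := by
  by_cases h : a.2.1 ∈ (ν a.1).cells
  · rw [extend_of_mem T a h]
    simp only [h, not_true_eq_false, iff_false]
    exact (Fin.castSucc_lt_last _).ne
  · simp [extend_of_notMem T a h, h]

theorem extend_eq_castSucc_iff (T : Node ν → Fin n) (a : Node lam) (k : Fin n) :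
    extend lam T a = k.castSucc ↔ ∃ h : a.2.1 ∈ (ν a.1).cells, T ⟨a.1, a.2.1, h⟩ = k := by
  by_cases h : a.2.1 ∈ (ν a.1).cells
  · rw [extend_of_mem T a h]
    simp [h, Fin.castSucc_inj]
  · rw [extend_of_notMem T a h]
    simp only [h, IsEmpty.exists_iff, iff_false]
    exact (Fin.castSucc_lt_last _).ne'

/-- `lam` is obtained from `ν` by adding a strip of color `j`. -/
structure IsStep (j : Fin ℓ) (ν lam : Multipartition ℓ) : Prop where
  le : ∀ i, ν i ≤ lam i
  eq_off : ∀ r, r ≠ j.castSucc → r ≠ j.succ → ν r = lam r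
  hstrip : HStrip (ν j.castSucc) (lam j.castSucc)
  vstrip : VStrip (ν j.succ) (lam j.succ)

theorem Node.ext {a b : Node lam} (h1 : a.1 = b.1) (h2 : a.2.1 = b.2.1) : a = b := by
  obtain ⟨i, x, hx⟩ := a
  obtain ⟨i', x', hx'⟩ := b
  simp only at h1 h2
  subst h1 h2
  rfl

theorem card_extend_eq (hle : ∀ i, ν i ≤ lam i) (T : Node ν → Fin n) (k : Fin n) :
    (Finset.univ.filter fun a : Node lam => extend lam T a = k.castSucc).card =
      (Finset.univ.filter fun a : Node ν => T a = k).card := by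
  symm
  refine Finset.card_bij (fun a _ => ⟨a.1, a.2.1, hle a.1 a.2.2⟩) ?_ ?_ ?_
  · intro a ha
    simp only [Finset.mem_filter, Finset.mem_univ, true_and] at ha ⊢
    rw [extend_eq_castSucc_iff]
    exact ⟨a.2.2, ha⟩
  · intro a _ b _ hab
    exact Node.ext (congrArg (fun a : Node lam => a.1) hab)
      (congrArg (fun a : Node lam => a.2.1) hab)
  · intro b hb
    simp only [Finset.mem_filter, Finset.mem_univ, true_and] at hb
    rw [extend_eq_castSucc_iff] at hb
    obtain ⟨h, hb⟩ := hb
    exact ⟨⟨b.1, b.2.1, h⟩, by simpa using hb, rfl⟩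

/-- The new nodes carry the largest entry, so the order conditions reduce to those of `T`, and the
conditions on the largest entry are those of a step. -/
theorem isColoredTableau_extend (hsize : size lam = d) (hν : IsStrict (ν 0))
    (hs : IsStep (c.color (Fin.last n)) ν lam) {T : Node ν → Fin n}
    (h : IsColoredTableau ν c.init T) : IsColoredTableau lam c (extend lam T) := by
  have le_of : ∀ a b : Node lam, (∀ hb : b.2.1 ∈ (ν b.1).cells,
      ∃ ha : a.2.1 ∈ (ν a.1).cells, T ⟨a.1, a.2.1, ha⟩ ≤ T ⟨b.1, b.2.1, hb⟩) →
      extend lam T a ≤ extend lam T b := by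
    intro a b hab
    by_cases hb : b.2.1 ∈ (ν b.1).cells
    · obtain ⟨ha, hT⟩ := hab hb
      rw [extend_of_mem T a ha, extend_of_mem T b hb]
      exact hT
    · rw [extend_of_notMem T b hb]
      exact Fin.le_last _
  have hcast : ∀ k : Fin n,
      (Finset.univ.filter fun a : Node lam => extend lam T a = k.castSucc).card =
        c.part k.castSucc := fun k => by
    rw [card_extend_eq hs.le, h.card_eq]
    rfl
  refine ⟨?_, ?_, ?_, ?_, ?_, ?_, ?_⟩
  · rintro ⟨i, ⟨r, s⟩, ha⟩ ⟨i', ⟨r', s'⟩, hb⟩ hi hr hc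
    obtain rfl : i = i' := hi
    obtain rfl : r = r' := hr
    obtain rfl : s' = s + 1 := hc
    refine le_of _ _ fun hb' => ?_
    have ha' : (r, s) ∈ (ν i).cells := (ν i).up_left_mem le_rfl (by omega) hb'
    exact ⟨ha', h.row_le _ _ rfl rfl rfl⟩
  · rintro ⟨i, ⟨r, s⟩, ha⟩ ⟨i', ⟨r', s'⟩, hb⟩ hi hc hr
    obtain rfl : i = i' := hi
    obtain rfl : s = s' := hc
    obtain rfl : r' = r + 1 := hr
    refine le_of _ _ fun hb' => ?_
    have ha' : (r, s) ∈ (ν i).cells := (ν i).up_left_mem (by omega) le_rfl hb'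
    exact ⟨ha', h.col_le _ _ rfl rfl rfl⟩
  · rintro ⟨i, ⟨r, s⟩, ha⟩ ⟨i', ⟨r', s'⟩, hb⟩ hi hi' hr hc
    obtain rfl : i = 0 := hi
    obtain rfl : i' = 0 := hi'
    obtain rfl : r' = r + 1 := hr
    obtain rfl : s = s' + 1 := hc
    refine le_of _ _ fun hb' => ?_
    -- Strictness of `ν 0` makes row `r` longer than row `r + 1`, so the node diagonally above
    -- belongs to `ν` as well.
    have ha' : (r, s' + 1) ∈ (ν 0).cells := by
      have h1 : s' < (ν 0).rowLen (r + 1) := YoungDiagram.mem_iff_lt_rowLen.1 hb'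
      have h2 := rowLen_antitone (ν 0) (Nat.le_succ r)
      have h3 := hν r
      simp only [Nat.succ_eq_add_one] at h2
      exact YoungDiagram.mem_iff_lt_rowLen.2 (by omega)
    exact ⟨ha', h.strict _ _ rfl rfl rfl rfl⟩
  · intro k
    induction k using Fin.lastCases with
    | cast k => exact hcast k
    -- The multiplicity of the largest entry is what the other entries leave of the total size.
    | last =>
      have h1 := Finset.card_eq_sum_card_fiberwise (s := (Finset.univ : Finset (Node lam)))
        (f := extend lam T) (t := Finset.univ) (fun _ _ => Finset.mem_univ _)
      have h2 := c.sum_part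
      rw [Finset.card_univ, card_node, hsize, Fin.sum_univ_castSucc,
        Finset.sum_congr rfl fun k _ => hcast k] at h1
      rw [Fin.sum_univ_castSucc] at h2
      omega
  · intro a
    by_cases ha : a.2.1 ∈ (ν a.1).cells
    · rw [extend_of_mem T a ha]
      exact h.comp_mem ⟨a.1, a.2.1, ha⟩
    · rw [extend_of_notMem T a ha]
      by_contra! hn
      have := hs.eq_off a.1 hn.1 hn.2
      rw [this] at ha
      exact ha a.2.2
  · intro a b hab ha hb hcol
    by_cases ha' : a.2.1 ∈ (ν a.1).cells
    · rw [extend_of_mem T a ha'] at hab ha hb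
      obtain ⟨hb', hT⟩ := (extend_eq_castSucc_iff T b _).1 hab.symm
      have := h.col_inj ⟨a.1, a.2.1, ha'⟩ ⟨b.1, b.2.1, hb'⟩ hT.symm ha hb hcol
      exact Node.ext (congrArg (fun a : Node ν => a.1) this)
        (congrArg (fun a : Node ν => a.2.1) this)
    · rw [extend_of_notMem T a ha'] at hab ha hb
      have hb' := (extend_eq_last_iff T b).1 hab.symm
      change a.1 = _ at ha
      change b.1 = _ at hb
      have e := hs.hstrip.2 a.2.1 b.2.1 (by rw [← ha]; exact a.2.2) (by rw [← ha]; exact ha')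
        (by rw [← hb]; exact b.2.2) (by rw [← hb]; exact hb') hcol
      exact Node.ext (ha.trans hb.symm) e
  · intro a b hab ha hb hrow
    by_cases ha' : a.2.1 ∈ (ν a.1).cells
    · rw [extend_of_mem T a ha'] at hab ha hb
      obtain ⟨hb', hT⟩ := (extend_eq_castSucc_iff T b _).1 hab.symm
      have := h.row_inj ⟨a.1, a.2.1, ha'⟩ ⟨b.1, b.2.1, hb'⟩ hT.symm ha hb hrow
      exact Node.ext (congrArg (fun a : Node ν => a.1) this)
        (congrArg (fun a : Node ν => a.2.1) this)
    · rw [extend_of_notMem T a ha'] at hab ha hb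
      have hb' := (extend_eq_last_iff T b).1 hab.symm
      change a.1 = _ at ha
      change b.1 = _ at hb
      have e := hs.vstrip.2 a.2.1 b.2.1 (by rw [← ha]; exact a.2.2) (by rw [← ha]; exact ha')
        (by rw [← hb]; exact b.2.2) (by rw [← hb]; exact hb') hrow
      exact Node.ext (ha.trans hb.symm) e

theorem IsColoredTableau.isStep {T : Node lam → Fin (n + 1)} (h : IsColoredTableau lam c T) :
    IsStep (c.color (Fin.last n)) (innerShape T) lam := by
  have hle : ∀ i, innerShape T i ≤ lam i := fun i x hx => ((mem_innerShape h).1 hx).1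
  have hlast : ∀ (i : Fin (ℓ + 1)) (x : ℕ × ℕ) (hx : x ∈ (lam i).cells), x ∉ innerShape T i →
      T ⟨i, x, hx⟩ = Fin.last n := by
    intro i x hx hn
    by_contra hne
    exact hn ((mem_innerShape h).2 ⟨hx, hne⟩)
  refine ⟨hle, fun r h1 h2 => le_antisymm (hle r) fun x hx => ?_, ⟨hle _, ?_⟩, ⟨hle _, ?_⟩⟩
  · by_contra hn
    have hT := hlast r x hx hn
    have := h.comp_mem ⟨r, x, hx⟩
    rw [hT] at this
    exact this.elim h1 h2
  · intro a b ha ha' hb hb' hab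
    have e1 := hlast _ a ha ha'
    have e2 := hlast _ b hb hb'
    have := h.col_inj ⟨_, a, ha⟩ ⟨_, b, hb⟩ (e1.trans e2.symm) (by rw [e1]; rfl) (by rw [e1]; rfl)
      hab
    exact congrArg (fun a : Node lam => a.2.1) this
  · intro a b ha ha' hb hb' hab
    have e1 := hlast _ a ha ha'
    have e2 := hlast _ b hb hb'
    have := h.row_inj ⟨_, a, ha⟩ ⟨_, b, hb⟩ (e1.trans e2.symm) (by rw [e1]; rfl) (by rw [e1]; rfl)
      hab
    exact congrArg (fun a : Node lam => a.2.1) this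

/-- If rows `r` and `r + 1` of the inner shape had the same length $m>0$, then strictness of `lam 0`
would provide the node in row `r`, column `m`. By the condition `strict` its entry is at most that
of the node in row `r + 1`, column `m - 1`, hence not the largest, and row `r` would be longer than
`m`. -/
theorem IsColoredTableau.isStrict_innerShape {T : Node lam → Fin (n + 1)} (hlam : IsStrict (lam 0))
    (h : IsColoredTableau lam c T) : IsStrict (innerShape T 0) := by
  intro r hr
  by_contra! hle
  have h1 : (r + 1, (innerShape T 0).rowLen r - 1) ∈ innerShape T 0 :=
    YoungDiagram.mem_iff_lt_rowLen.2 (by omega)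
  obtain ⟨h2, h3⟩ := (mem_innerShape h).1 h1
  have h4 : (innerShape T 0).rowLen r ≤ (lam 0).rowLen (r + 1) := by
    have := YoungDiagram.mem_iff_lt_rowLen.1 ((YoungDiagram.mem_cells _).1 h2)
    omega
  have h5 := hlam r
  have h6 := rowLen_antitone (lam 0) (Nat.le_succ r)
  simp only [Nat.succ_eq_add_one] at h6
  have h7 : (r, (innerShape T 0).rowLen r - 1 + 1) ∈ (lam 0).cells :=
    YoungDiagram.mem_iff_lt_rowLen.2 (by omega)
  have h8 := h.strict ⟨0, _, h7⟩ ⟨0, _, h2⟩ rfl rfl rfl rfl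
  have h9 : (r, (innerShape T 0).rowLen r - 1 + 1) ∈ innerShape T 0 :=
    (mem_innerShape h).2 ⟨h7, (h8.trans_lt (lt_of_le_of_ne (Fin.le_last _) h3)).ne⟩
  have := YoungDiagram.mem_iff_lt_rowLen.1 h9
  omega

theorem innerShape_extend {T : Node ν → Fin n} (hs : ∀ i, ν i ≤ lam i)
    (h : IsColoredTableau lam c (extend lam T)) : innerShape (extend lam T) = ν := by
  funext i
  refine SetLike.ext fun x => ?_
  rw [mem_innerShape h]
  simp only [ne_eq, extend_eq_last_iff, not_not]
  exact ⟨fun h => h.2, fun h => ⟨hs i h, h⟩⟩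

theorem IsColoredTableau.exists_extend {T : Node lam → Fin (n + 1)}
    (h : IsColoredTableau lam c T) : ∃ T' : Node (innerShape T) → Fin n,
      IsColoredTableau (innerShape T) c.init T' ∧ extend lam T' = T := by
  have hle := h.isStep.le
  have hex : ∀ a : Node (innerShape T), ∃ k : Fin n,
      T ⟨a.1, a.2.1, hle a.1 a.2.2⟩ = k.castSucc := by
    intro a
    obtain ⟨_, h2⟩ := (mem_innerShape h).1 a.2.2
    exact ⟨Fin.castPred _ h2, (Fin.castSucc_castPred _ h2).symm⟩
  choose T' hT' using hex
  have hext : extend lam T' = T := by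
    funext a
    by_cases ha : a.2.1 ∈ (innerShape T a.1).cells
    · rw [extend_of_mem T' a ha, ← hT']
    · rw [extend_of_notMem T' a ha]
      by_contra hne
      exact ha ((mem_innerShape h).2 ⟨a.2.2, Ne.symm hne⟩)
  refine ⟨T', ⟨?_, ?_, ?_, ?_, ?_, ?_, ?_⟩, hext⟩
  · intro a b h1 h2 h3
    rw [← Fin.castSucc_le_castSucc_iff, ← hT', ← hT']
    exact h.row_le _ _ h1 h2 h3
  · intro a b h1 h2 h3
    rw [← Fin.castSucc_le_castSucc_iff, ← hT', ← hT']
    exact h.col_le _ _ h1 h2 h3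
  · intro a b h1 h2 h3 h4
    rw [← Fin.castSucc_le_castSucc_iff, ← hT', ← hT']
    exact h.strict _ _ h1 h2 h3 h4
  · intro k
    rw [← card_extend_eq hle, hext]
    exact h.card_eq _
  · intro a
    have := h.comp_mem ⟨a.1, a.2.1, hle a.1 a.2.2⟩
    rw [hT'] at this
    exact this
  · intro a b h1 h2 h3 h4
    have := h.col_inj ⟨a.1, a.2.1, hle a.1 a.2.2⟩ ⟨b.1, b.2.1, hle b.1 b.2.2⟩
      (by rw [hT', hT', h1]) (by rw [hT']; exact h2) (by rw [hT']; exact h3) h4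
    exact Node.ext (congrArg (fun a : Node lam => a.1) this)
      (congrArg (fun a : Node lam => a.2.1) this)
  · intro a b h1 h2 h3 h4
    have := h.row_inj ⟨a.1, a.2.1, hle a.1 a.2.2⟩ ⟨b.1, b.2.1, hle b.1 b.2.2⟩
      (by rw [hT', hT', h1]) (by rw [hT']; exact h2) (by rw [hT']; exact h3) h4
    exact Node.ext (congrArg (fun a : Node lam => a.1) this)
      (congrArg (fun a : Node lam => a.2.1) this)

theorem extend_injective (hle : ∀ i, ν i ≤ lam i) :
    Function.Injective (extend lam : (Node ν → Fin n) → Node lam → Fin (n + 1)) := by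
  intro T T' h
  funext a
  have := congrFun h ⟨a.1, a.2.1, hle a.1 a.2.2⟩
  rw [extend_of_mem T (⟨a.1, a.2.1, hle a.1 a.2.2⟩ : Node lam) a.2.2,
    extend_of_mem T' (⟨a.1, a.2.1, hle a.1 a.2.2⟩ : Node lam) a.2.2] at this
  exact Fin.castSucc_injective _ this

theorem qStat_extend (hle : ∀ i, ν i ≤ lam i) (T : Node ν → Fin n) :
    qStat (extend lam T) = qStat T + stripEnds (ν 0) (lam 0) := by
  have h1 : ∀ k, columnsZero (extend lam T) k.castSucc = columnsZero T k := by
    intro k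
    ext s
    simp only [columnsZero, Finset.mem_image, Finset.mem_filter, Finset.mem_univ, true_and,
      extend_eq_castSucc_iff]
    constructor
    · rintro ⟨a, ⟨h0, h, hT⟩, rfl⟩
      exact ⟨⟨a.1, a.2.1, h⟩, ⟨h0, hT⟩, rfl⟩
    · rintro ⟨a, ⟨h0, hT⟩, rfl⟩
      exact ⟨⟨a.1, a.2.1, hle _ a.2.2⟩, ⟨h0, a.2.2, hT⟩, rfl⟩
  have h2 : columnsZero (extend lam T) (Fin.last n) = stripCols (ν 0) (lam 0) := by
    ext s
    simp only [columnsZero, stripCols, Finset.mem_image, Finset.mem_filter, Finset.mem_univ,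
      true_and, extend_eq_last_iff, Finset.mem_sdiff]
    constructor
    · rintro ⟨⟨i, x, hx⟩, ⟨h0, h⟩, rfl⟩
      obtain rfl : i = 0 := h0
      exact ⟨x, ⟨hx, h⟩, rfl⟩
    · rintro ⟨x, ⟨hx, h⟩, rfl⟩
      exact ⟨⟨0, x, hx⟩, ⟨rfl, h⟩, rfl⟩
  unfold qStat
  rw [Fin.sum_univ_castSucc, h2]
  congr 1
  exact Finset.sum_congr rfl fun k _ => by rw [h1]

end Tableau

/-! ### The recursion for the tableau numbers and the evaluation of $D^d$ -/

section Recursion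

variable {ℓ n d : ℕ} {lam ν : Multipartition ℓ}

theorem mem_strictMultipartitions :
    lam ∈ strictMultipartitions ℓ d ↔ IsStrict (lam 0) ∧ size lam = d := by
  simp [strictMultipartitions, size]

theorem stripEnds_self (μ : YoungDiagram) : stripEnds μ μ = 0 := by
  simp [stripEnds, stripCols]

theorem stepKernel_eq_zero {j : Fin ℓ} (h : ¬ IsStep j ν lam) : stepKernel j ν lam = 0 := by
  by_contra hne
  unfold stepKernel at hne
  split_ifs at hne with hoff
  · obtain ⟨h1, h2⟩ := mul_ne_zero_iff.1 hne
    refine h ⟨fun i => ?_, hoff, ?_, ?_⟩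
    · by_cases hi : i = j.castSucc
      · rw [hi]; exact stripKernel_le h1
      · by_cases hi' : i = j.succ
        · rw [hi']; exact vKernel_le h2
        · exact (hoff i hi hi').le
    · unfold stripKernel qKernel hKernel at h1
      by_cases h3 : j.castSucc = 0
      · simp only [if_pos h3] at h1
        split_ifs at h1 with h4
        · exact h4.2.2
        · exact absurd rfl h1
      · simp only [if_neg h3] at h1
        split_ifs at h1 with h4
        · exact h4
        · exact absurd rfl h1
    · unfold vKernel at h2
      split_ifs at h2 with h4
      · exact h4
      · exact absurd rfl h2
  · exact absurd rfl hne

/-- Only the color 0 adds nodes to component 0; for the other colors component 0 is unchanged and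
the power of 2 is trivial. This makes the formula uniform in `j`. -/
theorem IsStep.stepKernel_eq {j : Fin ℓ} (h : IsStep j ν lam) (hν : IsStrict (ν 0))
    (hlam : IsStrict (lam 0)) : stepKernel j ν lam = 2 ^ stripEnds (ν 0) (lam 0) := by
  unfold stepKernel vKernel stripKernel
  rw [if_pos h.eq_off, if_pos h.vstrip, mul_one]
  have hh := h.hstrip
  by_cases h0 : j.castSucc = 0
  · rw [if_pos h0]
    rw [h0] at hh ⊢
    exact if_pos ⟨hν, hlam, hh⟩
  · rw [if_neg h0, h.eq_off 0 (Ne.symm h0) (Fin.succ_ne_zero j).symm, stripEnds_self, pow_zero]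
    exact if_pos hh

theorem stepKernel_eq_zero_of_not_isStrict {j : Fin ℓ} (hν : IsStrict (ν 0))
    (hlam : ¬ IsStrict (lam 0)) : stepKernel j ν lam = 0 := by
  unfold stepKernel stripKernel
  split_ifs with h h0
  · rw [h0, qKernel, if_neg (fun h => hlam h.2.1), zero_mul]
  · exact absurd (h 0 (Ne.symm h0) (Fin.succ_ne_zero j).symm ▸ hν) hlam
  · rfl

/-- Tableaux are grouped by the shape of the nodes without the largest entry. Over a fixed shape
`ν`, extension by the largest entry is a bijection, and `qStat` grows by the constant `stripEnds (ν
0) (lam 0)`. -/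
theorem K_succ {c : ColoredComposition ℓ (n + 1) d} (hlam : IsStrict (lam 0))
    (hsize : size lam = d) :
    K lam c = ∑ ν ∈ strictMultipartitions ℓ (d - c.part (Fin.last n)),
      K ν c.init * stepKernel (c.color (Fin.last n)) ν lam := by
  classical
  unfold K
  rw [← Finset.sum_fiberwise_of_maps_to (g := innerShape)
    (t := strictMultipartitions ℓ (d - c.part (Fin.last n)))]
  swap
  · intro T hT
    obtain ⟨T', hT', -⟩ := (Finset.mem_filter.1 hT).2.exists_extend
    rw [mem_strictMultipartitions]
    exact ⟨(Finset.mem_filter.1 hT).2.isStrict_innerShape hlam, hT'.size_eq⟩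
  refine Finset.sum_congr rfl fun ν hν => ?_
  rw [mem_strictMultipartitions] at hν
  by_cases hs : IsStep (c.color (Fin.last n)) ν lam
  · rw [hs.stepKernel_eq hν.1 hlam, Finset.sum_mul]
    symm
    refine Finset.sum_bij (fun T _ => extend lam T) ?_ ?_ ?_ ?_
    · intro T hT
      have := isColoredTableau_extend hsize hν.1 hs (Finset.mem_filter.1 hT).2
      simp only [Finset.mem_filter, Finset.mem_univ, true_and]
      exact ⟨this, innerShape_extend hs.le this⟩
    · intro T _ T' _ h
      exact extend_injective hs.le h
    · intro T hT
      simp only [Finset.mem_filter, Finset.mem_univ, true_and] at hT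
      obtain ⟨hT, rfl⟩ := hT
      obtain ⟨T', hT', he⟩ := hT.exists_extend
      exact ⟨T', by simpa using hT', he⟩
    · intro T _
      rw [qStat_extend hs.le, pow_add]
  · rw [stepKernel_eq_zero hs, mul_zero]
    refine Finset.sum_eq_zero fun T hT => ?_
    simp only [Finset.mem_filter, Finset.mem_univ, true_and] at hT
    exact absurd (hT.2 ▸ hT.1.isStep) hs

/-- The coefficient vector of `PiElt c`. -/
def tableauVector (c : ColoredComposition ℓ n d) : Multipartition ℓ →₀ ℂ :=
  ∑ lam ∈ strictMultipartitions ℓ d, Finsupp.single lam (K lam c : ℂ)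

open Classical in
theorem tableauVector_apply (c : ColoredComposition ℓ n d) (lam : Multipartition ℓ) :
    tableauVector c lam = if lam ∈ strictMultipartitions ℓ d then (K lam c : ℂ) else 0 := by
  rw [tableauVector, Finsupp.finsetSum_apply]
  simp only [Finsupp.single_apply, Finset.sum_ite_eq']

theorem tableauVector_succ (c : ColoredComposition ℓ (n + 1) d) :
    tableauVector c =
      stepOp (c.color (Fin.last n)) (c.part (Fin.last n)) (tableauVector c.init) := by
  classical
  ext lam
  rw [tableauVector_apply, tableauVector, map_sum, Finsupp.finsetSum_apply]
  have hs : ∀ ν ∈ strictMultipartitions ℓ (d - c.part (Fin.last n)),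
      stepOp (c.color (Fin.last n)) (c.part (Fin.last n)) (Finsupp.single ν (K ν c.init : ℂ)) lam =
      if size lam = d then (K ν c.init : ℂ) * stepKernel (c.color (Fin.last n)) ν lam else 0 := by
    intro ν hν
    rw [mem_strictMultipartitions] at hν
    rw [apply_single_smul, stepOp_single_apply, hν.2, Nat.sub_add_cancel c.last_le]
    simp
  rw [Finset.sum_congr rfl hs]
  simp only [mem_strictMultipartitions]
  by_cases h1 : size lam = d
  · simp only [if_pos h1]
    by_cases h2 : IsStrict (lam 0)
    · rw [if_pos ⟨h2, h1⟩, K_succ h2 h1]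
      push_cast
      rfl
    · rw [if_neg (fun h => h2 h.1)]
      symm
      refine Finset.sum_eq_zero fun ν hν => ?_
      rw [mem_strictMultipartitions] at hν
      rw [stepKernel_eq_zero_of_not_isStrict hν.1 h2]
      simp
  · simp [h1]

/-- The empty multipartition. -/
def emptyMulti (ℓ : ℕ) : Multipartition ℓ := fun _ => ⊥

theorem size_eq_zero_iff : size lam = 0 ↔ lam = emptyMulti ℓ := by
  unfold size
  rw [Finset.sum_eq_zero_iff]
  constructor
  · intro h
    funext i
    have := h i (Finset.mem_univ i)
    exact YoungDiagram.ext (Finset.card_eq_zero.1 this)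
  · rintro rfl i _
    rfl

theorem isStrict_bot : IsStrict ⊥ := by
  intro i hi
  exact absurd (YoungDiagram.mem_iff_lt_rowLen.2 hi) (YoungDiagram.notMem_bot _)

theorem strictMultipartitions_zero : strictMultipartitions ℓ 0 = {emptyMulti ℓ} := by
  ext lam
  rw [mem_strictMultipartitions, size_eq_zero_iff, Finset.mem_singleton]
  exact ⟨fun h => h.2, fun h => ⟨h ▸ isStrict_bot, h⟩⟩

theorem K_zero (c : ColoredComposition ℓ 0 d) : K (emptyMulti ℓ) c = 1 := by
  classical
  have hempty : IsEmpty (Node (emptyMulti ℓ)) :=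
    ⟨fun a => YoungDiagram.notMem_bot _ a.2.2⟩
  unfold K
  rw [Finset.sum_filter, Fintype.sum_unique, if_pos]
  · simp [qStat]
  · exact ⟨fun a => hempty.elim a, fun a => hempty.elim a, fun a => hempty.elim a,
      fun k => k.elim0, fun a => hempty.elim a, fun a => hempty.elim a, fun a => hempty.elim a⟩

theorem tableauVector_zero (c : ColoredComposition ℓ 0 d) :
    tableauVector c = Finsupp.single (emptyMulti ℓ) 1 := by
  obtain rfl : d = 0 := by simpa using c.sum_part.symm
  rw [tableauVector, strictMultipartitions_zero, Finset.sum_singleton, K_zero, Nat.cast_one]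

theorem stepKernel_emptyMulti (j : Fin ℓ) :
    stepKernel j (emptyMulti ℓ) (emptyMulti ℓ) = 1 := by
  have : IsStep j (emptyMulti ℓ) (emptyMulti ℓ) :=
    ⟨fun _ => le_rfl, fun _ _ _ => rfl,
      ⟨le_rfl, fun a _ h => absurd h (YoungDiagram.notMem_bot a)⟩,
      ⟨le_rfl, fun a _ h => absurd h (YoungDiagram.notMem_bot a)⟩⟩
  rw [this.stepKernel_eq isStrict_bot isStrict_bot, stripEnds_self, pow_zero]

/-- Adding cells never yields the empty multipartition, and adding none yields it only from itself.
This is what `IsLowering.pow_mul` requires of the functional that reads off the empty coefficient.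
-/
theorem stepOp_apply_emptyMulti (j : Fin ℓ) (m : ℕ) (v : Multipartition ℓ →₀ ℂ) :
    stepOp j m v (emptyMulti ℓ) = if m = 0 then v (emptyMulti ℓ) else 0 := by
  induction v using Finsupp.induction_linear with
  | zero => simp
  | add f g hf hg =>
    rw [map_add, Finsupp.add_apply, hf, hg, Finsupp.add_apply]
    split_ifs <;> simp
  | single ν b =>
    rw [apply_single_smul, stepOp_single_apply, size_eq_zero_iff.2 rfl]
    by_cases hm : m = 0
    · subst hm
      rw [if_pos rfl, add_zero]
      by_cases hν : ν = emptyMulti ℓ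
      · rw [hν, if_pos (size_eq_zero_iff.2 rfl).symm, stepKernel_emptyMulti,
          Finsupp.single_eq_same]
        simp
      · rw [if_neg (fun h => hν (size_eq_zero_iff.1 h.symm)),
          Finsupp.single_eq_of_ne (Ne.symm hν), mul_zero]
    · rw [if_neg hm, if_neg (by omega), mul_zero]

theorem multinomial_succ (c : ColoredComposition ℓ (n + 1) d) :
    Nat.multinomial Finset.univ c.part =
      d.choose (c.part (Fin.last n)) * Nat.multinomial Finset.univ c.init.part := by
  have h1 := Nat.multinomial_spec Finset.univ c.part
  have h2 := Nat.multinomial_spec Finset.univ c.init.part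
  rw [c.sum_part, Fin.prod_univ_castSucc] at h1
  rw [c.init.sum_part] at h2
  have h3 := Nat.choose_mul_factorial_mul_factorial c.last_le
  rw [← h2] at h3
  have hpos : 0 < (∏ k : Fin n, (c.part k.castSucc).factorial) *
      (c.part (Fin.last n)).factorial :=
    Nat.mul_pos (Finset.prod_pos fun _ _ => Nat.factorial_pos _) (Nat.factorial_pos _)
  refine Nat.eq_of_mul_eq_mul_left hpos (h1.trans (h3.symm.trans ?_))
  change _ * _ * ((∏ k : Fin n, (c.part k.castSucc).factorial) * _) = _
  ring

theorem removeOp_pow_tableauVector (c : ColoredComposition ℓ n d) :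
    (removeOp ℓ ^ d) (tableauVector c) (emptyMulti ℓ) =
      (Nat.multinomial Finset.univ c.part : ℂ) *
        ∏ k, (colorFactor (c.color k) : ℂ) ^ c.part k := by
  induction n generalizing d with
  | zero =>
    obtain rfl : d = 0 := by simpa using c.sum_part.symm
    rw [tableauVector_zero]
    simp [Nat.multinomial]
  | succ n ih =>
    -- The functional evaluates an operator at the vector of the shortened composition and takes the
    -- coefficient of the empty multipartition.
    let ε : Module.End ℂ (Multipartition ℓ →₀ ℂ) →ₗ[ℂ] ℂ :=
      Finsupp.lapply (emptyMulti ℓ) ∘ₗ LinearMap.applyₗ (tableauVector c.init)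
    have h := (isLowering_stepOp (c.color (Fin.last n))).pow_mul ε
      (fun x => (stepOp_apply_emptyMulti _ _ _).trans (if_pos rfl))
      (fun m x => (stepOp_apply_emptyMulti _ _ _).trans (if_neg (Nat.succ_ne_zero m)))
      d (c.part (Fin.last n)) 1
    rw [mul_one, mul_one] at h
    rw [tableauVector_succ, multinomial_succ, Fin.prod_univ_castSucc]
    refine h.trans ?_
    change _ * (removeOp ℓ ^ (d - c.part (Fin.last n))) (tableauVector c.init) (emptyMulti ℓ) = _
    rw [ih c.init]
    push_cast
    change _ * (_ * ∏ k : Fin n, (colorFactor (c.color k.castSucc) : ℂ) ^ c.part k.castSucc) = _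
    ring

theorem prod_colorFactor (c : ColoredComposition ℓ n d) :
    ∏ k, (colorFactor (c.color k) : ℂ) ^ c.part k =
      4 ^ (d - c.lastColorSize) * 3 ^ c.lastColorSize := by
  have h := Finset.sum_filter_add_sum_filter_not Finset.univ
    (fun k => (c.color k : ℕ) + 1 = ℓ) c.part
  rw [c.sum_part] at h
  have hd : d - c.lastColorSize = ∑ k with ¬ (c.color k : ℕ) + 1 = ℓ, c.part k := by
    rw [ColoredComposition.lastColorSize]; omega
  rw [hd, ColoredComposition.lastColorSize,
    ← Finset.prod_filter_mul_prod_filter_not Finset.univ (fun k => (c.color k : ℕ) + 1 = ℓ),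
    mul_comm, ← Finset.prod_pow_eq_pow_sum, ← Finset.prod_pow_eq_pow_sum]
  congr 1
  · refine Finset.prod_congr rfl fun k hk => ?_
    rw [colorFactor, if_neg (Finset.mem_filter.1 hk).2]
    norm_num
  · refine Finset.prod_congr rfl fun k hk => ?_
    rw [colorFactor, if_pos (Finset.mem_filter.1 hk).2]
    norm_num

end Recursion

/-! ### The tableaux with entries `1, …, d` -/

theorem Covers.hstrip {ν μ : YoungDiagram} (h : Covers ν μ) : HStrip ν μ := by
  refine ⟨h.1, fun a b ha ha' hb hb' _ => ?_⟩
  have hc : (μ.cells \ ν.cells).card ≤ 1 := by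
    rw [Finset.card_sdiff_of_subset h.1]
    have := h.2
    simp only [YoungDiagram.card] at this
    omega
  exact Finset.card_le_one.1 hc a (Finset.mem_sdiff.2 ⟨ha, ha'⟩) b (Finset.mem_sdiff.2 ⟨hb, hb'⟩)

theorem Covers.vstrip {ν μ : YoungDiagram} (h : Covers ν μ) : VStrip ν μ :=
  VStrip_iff_transpose.2 (covers_transpose.2 h).hstrip

theorem Covers.stripEnds_eq {ν μ : YoungDiagram} (h : Covers ν μ) : stripEnds ν μ = 1 := by
  have hc : (μ.cells \ ν.cells).card = 1 := by
    rw [Finset.card_sdiff_of_subset h.1]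
    have := h.2
    simp only [YoungDiagram.card] at this
    omega
  obtain ⟨x, hx⟩ := Finset.card_eq_one.1 hc
  rw [stripEnds, stripCols, hx, Finset.image_singleton, Finset.filter_singleton, if_pos (by simp)]
  rfl

section Omega

variable {ℓ : ℕ} {lam ν : Multipartition ℓ}

/-- `lam` is obtained from `ν` by adding a cell in component `i`. -/
def IsCellStep (i : Fin (ℓ + 1)) (ν lam : Multipartition ℓ) : Prop :=
  (∀ r, r ≠ i → ν r = lam r) ∧ Covers (ν i) (lam i)

theorem IsCellStep.unique {i i' : Fin (ℓ + 1)} (h : IsCellStep i ν lam)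
    (h' : IsCellStep i' ν lam) : i = i' := by
  by_contra hne
  have h1 := h.2.2
  rw [h'.1 i hne] at h1
  omega

theorem IsCellStep.size_eq {i : Fin (ℓ + 1)} (h : IsCellStep i ν lam) :
    size lam = size ν + 1 := by
  unfold size
  rw [← Finset.add_sum_erase _ _ (Finset.mem_univ i),
    ← Finset.add_sum_erase (Finset.univ) (fun i => (ν i).card) (Finset.mem_univ i), h.2.2,
    Finset.sum_congr rfl fun r hr => congrArg YoungDiagram.card (h.1 r (Finset.ne_of_mem_erase hr))]
  ring

theorem hstrip_refl (μ : YoungDiagram) : HStrip μ μ :=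
  ⟨le_rfl, fun _ _ h h' => absurd h h'⟩

theorem vstrip_refl (μ : YoungDiagram) : VStrip μ μ :=
  ⟨le_rfl, fun _ _ h h' => absurd h h'⟩

theorem IsCellStep.isStep {i : Fin (ℓ + 1)} (h : IsCellStep i ν lam) {j : Fin ℓ}
    (hj : j.castSucc = i ∨ j.succ = i) : IsStep j ν lam := by
  have hle : ∀ r, ν r ≤ lam r := by
    intro r
    by_cases hr : r = i
    · rw [hr]; exact h.2.1
    · exact (h.1 r hr).le
  refine ⟨hle, fun r h1 h2 => h.1 r ?_, ?_, ?_⟩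
  · rintro rfl
    rcases hj with hj | hj
    · exact h1 hj.symm
    · exact h2 hj.symm
  · by_cases hi : j.castSucc = i
    · rw [hi]; exact h.2.hstrip
    · rw [h.1 _ hi]; exact hstrip_refl _
  · by_cases hi : j.succ = i
    · rw [hi]; exact h.2.vstrip
    · rw [h.1 _ hi]; exact vstrip_refl _

theorem eq_of_le_of_card_eq {ν μ : YoungDiagram} (h : ν ≤ μ) (hc : ν.card = μ.card) : ν = μ :=
  YoungDiagram.ext (Finset.eq_of_subset_of_card_le h hc.ge)

theorem IsStep.isCellStep {j : Fin ℓ} (h : IsStep j ν lam) (hs : size lam = size ν + 1) :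
    IsCellStep j.castSucc ν lam ∨ IsCellStep j.succ ν lam := by
  have hrest : ∑ i ∈ (Finset.univ.erase j.castSucc).erase j.succ, (lam i).card =
      ∑ i ∈ (Finset.univ.erase j.castSucc).erase j.succ, (ν i).card := by
    refine Finset.sum_congr rfl fun i hi => ?_
    rw [h.eq_off i (Finset.ne_of_mem_erase (Finset.mem_of_mem_erase hi))
      (Finset.ne_of_mem_erase hi)]
  rw [ColoredSym.size_eq j lam, ColoredSym.size_eq j ν, hrest] at hs
  have h1 := card_mono (h.le j.castSucc)
  have h2 := card_mono (h.le j.succ)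
  rcases Nat.lt_or_ge (ν j.castSucc).card (lam j.castSucc).card with hlt | hge
  · refine Or.inl ⟨fun r hr => ?_, h.le _, by omega⟩
    by_cases hr' : r = j.succ
    · rw [hr']; exact eq_of_le_of_card_eq (h.le _) (by omega)
    · exact h.eq_off r hr hr'
  · refine Or.inr ⟨fun r hr => ?_, h.le _, by omega⟩
    by_cases hr' : r = j.castSucc
    · rw [hr']; exact eq_of_le_of_card_eq (h.le _) (by omega)
    · exact h.eq_off r hr' hr

/-- A component lies next to the colors $i-1$ and $i$, one of which is missing at either end. The
assumption on `ℓ` keeps the two ends apart. -/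
theorem sum_adjacent_colors (hℓ : 1 ≤ ℓ) (i : Fin (ℓ + 1)) :
    (∑ j : Fin ℓ, if j.castSucc = i ∨ j.succ = i then 1 else 0) =
      if i = 0 ∨ i = Fin.last ℓ then 1 else 2 := by
  have h0 : (∑ r : Fin (ℓ + 1), if r = i then 1 else 0) = 1 := by simp
  have h1 := h0
  have h2 := h0
  rw [Fin.sum_univ_castSucc] at h1
  rw [Fin.sum_univ_succ] at h2
  have h3 : (∑ j : Fin ℓ, if j.castSucc = i ∨ j.succ = i then 1 else 0) =
      (∑ j : Fin ℓ, if j.castSucc = i then 1 else 0) + ∑ j : Fin ℓ, if j.succ = i then 1 else 0 := by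
    rw [← Finset.sum_add_distrib]
    refine Finset.sum_congr rfl fun j _ => ?_
    by_cases hj : j.castSucc = i
    · have : j.succ ≠ i := by rw [← hj]; exact (Fin.castSucc_lt_succ).ne'
      simp [hj, this]
    · simp [hj]
  have h4 : (0 : Fin (ℓ + 1)) ≠ Fin.last ℓ := by
    rw [Ne, Fin.ext_iff]; simp; omega
  rw [h3]
  by_cases hi : i = 0
  · subst hi
    rw [if_neg h4.symm] at h1
    rw [if_pos rfl] at h2
    rw [if_pos (Or.inl rfl)]
    omega
  · rw [if_neg (Ne.symm hi)] at h2
    by_cases hi' : i = Fin.last ℓ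
    · rw [if_pos hi'.symm] at h1
      rw [if_pos (Or.inr hi')]
      omega
    · rw [if_neg (Ne.symm hi')] at h1
      rw [if_neg (by tauto)]
      omega

theorem IsCellStep.sum_stepKernel (hℓ : 1 ≤ ℓ) {i : Fin (ℓ + 1)} (h : IsCellStep i ν lam)
    (hν : IsStrict (ν 0)) (hlam : IsStrict (lam 0)) :
    ∑ j : Fin ℓ, stepKernel j ν lam =
      (if i = 0 ∨ i = Fin.last ℓ then 1 else 2) * 2 ^ stripEnds (ν 0) (lam 0) := by
  rw [← sum_adjacent_colors hℓ i, Finset.sum_mul]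
  refine Finset.sum_congr rfl fun j _ => ?_
  by_cases hj : j.castSucc = i ∨ j.succ = i
  · rw [if_pos hj, one_mul, (h.isStep hj).stepKernel_eq hν hlam]
  · rw [if_neg hj, zero_mul]
    refine stepKernel_eq_zero fun hs => hj ?_
    exact (hs.isCellStep h.size_eq).imp (fun h' => h'.unique h) (fun h' => h'.unique h)

theorem boxOp_single_apply (i : Fin (ℓ + 1)) (μ κ : YoungDiagram) :
    boxOp i (Finsupp.single μ 1) κ =
      if i = 0 then (strictCoverKernel κ μ : ℂ) else compWeight i * coverKernel κ μ := by
  have key : ∀ k : YoungDiagram → YoungDiagram → ℕ,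
      (∀ κ lam, k κ lam ≠ 0 → lam.card = κ.card + 1) →
      downOp k (Finsupp.single μ 1) κ = k κ μ := by
    intro k hk
    rw [downOp_single_apply]
    by_cases h0 : k κ μ = 0
    · simp [h0]
    · have := hk _ _ h0
      rw [if_pos (by omega)]
  unfold boxOp
  split_ifs with hi
  · exact key _ strictCoverKernel_card
  · rw [LinearMap.smul_apply, Finsupp.smul_apply, key _ coverKernel_card, smul_eq_mul]

theorem lift_boxOp_eq_zero {i : Fin (ℓ + 1)} (h : ¬ IsCellStep i ν lam) :
    lift i (boxOp i) (Finsupp.single lam 1) ν = 0 := by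
  classical
  rw [lift_single_apply]
  split_ifs with hoff
  · have hc : ¬ Covers (ν i) (lam i) := fun hc => h ⟨fun r hr => (hoff r hr).symm, hc⟩
    have h1 : strictCoverKernel (ν i) (lam i) = 0 := if_neg fun h => hc h.2.2
    have h2 : coverKernel (ν i) (lam i) = 0 := if_neg hc
    rw [boxOp_single_apply, h1, h2]
    simp
  · rfl

open Classical in
-- Conjugation by $2^{h}$ turns removal into the transpose of adding one cell of any color. For
-- component 0 the right-hand weight is always 2, the unique color times $2^{q}=2$. On the left it
-- is either the removal weight 2 with $h$ unchanged, or the removal weight 1 with $h$ increased by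
-- 1. For the other components $h$ does not change and `compWeight` counts the adjacent colors.
theorem removeOp_single_apply (hℓ : 1 ≤ ℓ) (hlam : IsStrict (lam 0)) :
    removeOp ℓ (Finsupp.single lam 1) ν * 2 ^ (lam 0).colLen 0 =
      if IsStrict (ν 0) ∧ size lam = size ν + 1 then
        2 ^ (ν 0).colLen 0 * ∑ j, (stepKernel j ν lam : ℂ) else 0 := by
  unfold removeOp
  rw [LinearMap.sum_apply, Finsupp.finsetSum_apply]
  by_cases hex : ∃ i, IsCellStep i ν lam
  swap
  · rw [Finset.sum_eq_zero fun i _ => lift_boxOp_eq_zero fun h => hex ⟨i, h⟩, zero_mul]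
    split_ifs with hc
    · rw [Finset.sum_eq_zero, mul_zero]
      intro j _
      rw [stepKernel_eq_zero, Nat.cast_zero]
      exact fun hs => (hs.isCellStep hc.2).elim (fun h => hex ⟨_, h⟩) fun h => hex ⟨_, h⟩
    · rfl
  obtain ⟨i, hi⟩ := hex
  rw [Finset.sum_eq_single i (fun r _ hr => lift_boxOp_eq_zero fun h => hr (h.unique hi))
    (fun h => absurd (Finset.mem_univ i) h), lift_single_apply,
    if_pos (fun r hr => (hi.1 r hr).symm), boxOp_single_apply]
  by_cases hν : IsStrict (ν 0)
  · rw [if_pos (show IsStrict (ν 0) ∧ size lam = size ν + 1 from ⟨hν, hi.size_eq⟩), ← Nat.cast_sum, hi.sum_stepKernel hℓ hν hlam]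
    by_cases h0 : i = 0
    · subst h0
      rw [if_pos rfl, if_pos (Or.inl rfl), hi.2.stripEnds_eq, strictCoverKernel,
        if_pos ⟨hν, hlam, hi.2⟩]
      obtain ⟨r, hr⟩ := hi.2.exists_row
      split_ifs with hc
      · rw [hc]; push_cast; ring
      -- The number of rows has changed, so the new cell sits in an empty row of `ν 0`, necessarily
      -- the first one.
      · have hle : (lam 0).colLen 0 = (ν 0).colLen 0 + 1 := by
          have hz : (ν 0).rowLen r = 0 := by
            by_contra hne
            exact hc ((colLen_eq_iff_of_update hr).2 hne)
          have h1 := rowLen_pos_iff.1 (show 0 < (lam 0).rowLen r by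
            rw [hr, Function.update_self]; omega)
          have h2 : (ν 0).colLen 0 ≤ (lam 0).colLen 0 := by
            by_contra! hlt
            have h3 := rowLen_pos_iff.2 hlt
            have h4 := le_iff_rowLen_le.1 hi.2.1 ((lam 0).colLen 0)
            rw [rowLen_eq_zero_of_le le_rfl] at h4
            omega
          have h5 : (lam 0).colLen 0 ≤ (ν 0).colLen 0 + 1 := by
            refine colLen_le_of_rowLen_eq_zero ?_
            have h6 := colLen_le_of_rowLen_eq_zero hz
            by_contra hne
            have h7 : r = (ν 0).colLen 0 + 1 := by
              by_contra hr'
              rw [hr, Function.update_of_ne (Ne.symm hr')] at hne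
              exact hne (rowLen_eq_zero_of_le (by omega))
            have h8 := rowLen_antitone (lam 0) (show (ν 0).colLen 0 ≤ r by omega)
            rw [hr, Function.update_self, Function.update_of_ne (by omega),
              rowLen_eq_zero_of_le le_rfl] at h8
            omega
          omega
        rw [hle]; push_cast; ring
    · rw [if_neg h0, hi.1 0 (Ne.symm h0), stripEnds_self, coverKernel, if_pos hi.2, compWeight]
      simp only [h0, false_or]
      push_cast
      ring
  · rw [if_neg (fun h : IsStrict (ν 0) ∧ size lam = size ν + 1 => hν h.1)]
    by_cases h0 : i = 0
    · rw [if_pos h0, h0, strictCoverKernel, if_neg (fun h => hν h.1)]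
      simp
    · rw [hi.1 0 (Ne.symm h0)] at hν
      exact absurd hlam hν

theorem K_omega_succ {d : ℕ} {lam : Multipartition ℓ}
    (hlam : lam ∈ strictMultipartitions ℓ (d + 1)) :
    ∑ i : Fin (d + 1) → Fin ℓ, K lam (omegaComposition i) =
      ∑ ν ∈ strictMultipartitions ℓ d, (∑ i : Fin d → Fin ℓ, K ν (omegaComposition i)) *
        ∑ j, stepKernel j ν lam := by
  rw [mem_strictMultipartitions] at hlam
  have hK : ∀ i : Fin (d + 1) → Fin ℓ, K lam (omegaComposition i) =
      ∑ ν ∈ strictMultipartitions ℓ d, K ν (omegaComposition (fun k => i k.castSucc)) *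
        stepKernel (i (Fin.last d)) ν lam := fun i => K_succ hlam.1 hlam.2
  rw [Finset.sum_congr rfl fun i _ => hK i, Finset.sum_comm]
  refine Finset.sum_congr rfl fun ν _ => ?_
  rw [Finset.sum_mul_sum, Finset.sum_comm, ← Finset.sum_product']
  -- A color sequence of length $d+1$ is split into its last color and the first $d$ colors.
  rw [Finset.univ_product_univ, ← (Fin.snocEquiv fun _ : Fin (d + 1) => Fin ℓ).sum_comp]
  refine Finset.sum_congr rfl fun p _ => ?_
  simp [Fin.snocEquiv]

/-- Both sides satisfy the same recursion on removing one cell: the factors $2^{h}$ of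
`removeOp_single_apply` telescope along a chain of removals, ending with $h=0$ for the empty
multipartition. -/
theorem K_omega_eq (hℓ : 1 ≤ ℓ) {d : ℕ} {lam : Multipartition ℓ}
    (hlam : lam ∈ strictMultipartitions ℓ d) :
    ((∑ i : Fin d → Fin ℓ, K lam (omegaComposition i) : ℕ) : ℂ) =
      (removeOp ℓ ^ d) (Finsupp.single lam 1) (emptyMulti ℓ) * 2 ^ (lam 0).colLen 0 := by
  induction d generalizing lam with
  | zero =>
    rw [strictMultipartitions_zero, Finset.mem_singleton] at hlam
    subst hlam
    have h0 : (emptyMulti ℓ 0).colLen 0 = 0 :=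
      Nat.le_zero.1 (colLen_le_of_rowLen_eq_zero (Nat.eq_zero_of_not_pos fun h =>
        YoungDiagram.notMem_bot _ (YoungDiagram.mem_iff_lt_rowLen.2 h)))
    simp [K_zero, h0]
  | succ d ih =>
    have hmem := mem_strictMultipartitions.1 hlam
    have hexp : (2 : ℂ) ^ (lam 0).colLen 0 • removeOp ℓ (Finsupp.single lam 1) =
        ∑ ν ∈ strictMultipartitions ℓ d,
          (2 ^ (ν 0).colLen 0 * ∑ j, (stepKernel j ν lam : ℂ)) • Finsupp.single ν (1 : ℂ) := by
      classical
      ext ν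
      rw [Finsupp.smul_apply, smul_eq_mul, mul_comm, removeOp_single_apply hℓ hmem.1,
        Finsupp.finsetSum_apply]
      simp only [Finsupp.smul_apply, Finsupp.single_apply, smul_eq_mul, mul_ite, mul_one, mul_zero,
        Finset.sum_ite_eq', mem_strictMultipartitions, hmem.2]
      refine if_congr (and_congr_right fun _ => ?_) rfl rfl
      omega
    rw [K_omega_succ hlam, pow_succ, Module.End.mul_apply, mul_comm _ ((2 : ℂ) ^ _),
      ← smul_eq_mul, ← Finsupp.smul_apply, ← map_smul, hexp, map_sum, Finsupp.finsetSum_apply]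
    push_cast
    refine Finset.sum_congr rfl fun ν hν => ?_
    have := ih hν
    push_cast at this
    rw [this, map_smul, Finsupp.smul_apply, smul_eq_mul]
    ring

end Omega

/-! ### Products of power sums -/

/-- The multiset of nonzero exponents of a monomial. -/
def exponents (m : ℕ →₀ ℕ) : Multiset ℕ := m.support.val.map m

theorem card_exponents (m : ℕ →₀ ℕ) : Multiset.card (exponents m) = m.support.card := by
  simp [exponents]

theorem exponents_eq_cons {m : ℕ →₀ ℕ} {i : ℕ} (hi : i ∈ m.support) :
    exponents m = m i ::ₘ exponents (m - Finsupp.single i (m i)) := by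
  classical
  have hs : (m - Finsupp.single i (m i)).support = m.support.erase i := by
    ext j
    simp only [Finsupp.mem_support_iff, Finsupp.tsub_apply, Finset.mem_erase]
    by_cases hj : i = j
    · subst hj
      simp
    · rw [Finsupp.single_eq_of_ne' hj]
      simp [Ne.symm hj]
  unfold exponents
  rw [hs]
  conv_lhs => rw [← Finset.insert_erase hi, Finset.insert_val_of_notMem (Finset.notMem_erase i _),
    Multiset.map_cons]
  congr 1
  refine Multiset.map_congr rfl fun j hj => ?_
  rw [Finsupp.tsub_apply, Finsupp.single_eq_of_ne (Finset.ne_of_mem_erase hj), tsub_zero]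

theorem exists_exponents_eq (s : Multiset ℕ) (hs : ∀ k ∈ s, 0 < k) :
    ∃ m : ℕ →₀ ℕ, exponents m = s := by
  classical
  induction s using Multiset.induction_on with
  | empty => exact ⟨0, by simp [exponents]⟩
  | cons k s ih =>
    obtain ⟨m, hm⟩ := ih fun x hx => hs x (Multiset.mem_cons_of_mem hx)
    obtain ⟨i, hi⟩ := Infinite.exists_notMem_finset m.support
    have hmi : m i = 0 := Finsupp.notMem_support_iff.1 hi
    have hk := hs k (Multiset.mem_cons_self k s)
    have hv : (m + Finsupp.single i k) i = k := by simp [hmi]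
    refine ⟨m + Finsupp.single i k, ?_⟩
    rw [exponents_eq_cons (i := i) (by rw [Finsupp.mem_support_iff, hv]; exact hk.ne'), hv,
      add_tsub_cancel_right, hm]

/-- The product of the power sums `p_k`, `k ∈ s`. -/
def powerSumProd (s : Multiset ℕ) : Lam := (s.map powerSum).prod

/-- Each factor $p_k$ puts its whole degree on one variable, so a monomial of the product has at
most as many variables as there are factors, with equality only if no two factors share a variable.
The coefficients are counts, hence natural numbers, which excludes cancellation. -/
theorem coeff_powerSumProd (s : Multiset ℕ) (hs : ∀ k ∈ s, 0 < k) :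
    ∃ f : (ℕ →₀ ℕ) → ℕ, (∀ m, MvPowerSeries.coeff m (powerSumProd s : MvPowerSeries ℕ ℂ) = f m) ∧
      (∀ m, exponents m = s → 0 < f m) ∧ ∀ m, f m ≠ 0 → m.support.card ≤ Multiset.card s ∧
        (m.support.card = Multiset.card s → exponents m = s) := by
  classical
  induction s using Multiset.induction_on with
  | empty =>
    refine ⟨fun m => if m = 0 then 1 else 0, fun m => ?_, fun m hm => ?_, fun m hm => ?_⟩
    · simp [powerSumProd, MvPowerSeries.coeff_one]
    · have : m.support = ∅ := by simpa [exponents] using hm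
      rw [Finsupp.support_eq_empty] at this
      simp [this]
    · have : m = 0 := by simpa using hm
      subst this
      simp [exponents]
  | cons k s ih =>
    obtain ⟨f, h1, h2, h3⟩ := ih fun x hx => hs x (Multiset.mem_cons_of_mem hx)
    have hk := hs k (Multiset.mem_cons_self k s)
    refine ⟨fun m => ∑ i ∈ m.support, if k ≤ m i then f (m - Finsupp.single i k) else 0,
      fun m => ?_, fun m hm => ?_, fun m hm => ?_⟩
    · have e : (powerSumProd (k ::ₘ s) : MvPowerSeries ℕ ℂ) =
          (powerSum k : MvPowerSeries ℕ ℂ) * (powerSumProd s : MvPowerSeries ℕ ℂ) := by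
        simp [powerSumProd]
      rw [e, coeff_powerSum_mul k hk]
      push_cast
      refine Finset.sum_congr rfl fun i _ => ?_
      split_ifs
      · exact h1 _
      · rfl
    · have hmem : k ∈ exponents m := by rw [hm]; exact Multiset.mem_cons_self k s
      obtain ⟨i, hi, hik⟩ := Multiset.mem_map.1 hmem
      refine lt_of_lt_of_le ?_ (Finset.single_le_sum (f := fun i => if k ≤ m i then
        f (m - Finsupp.single i k) else 0) (fun _ _ => Nat.zero_le _) hi)
      rw [if_pos hik.ge]
      refine h2 _ ?_
      have := exponents_eq_cons (m := m) hi
      rw [hm, hik] at this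
      exact ((Multiset.cons_inj_right k).1 this).symm
    · obtain ⟨i, hi, hne⟩ := Finset.exists_ne_zero_of_sum_ne_zero hm
      split_ifs at hne with hle
      · obtain ⟨h4, h5⟩ := h3 _ hne
        rw [Multiset.card_cons]
        by_cases hik : m i = k
        · have he := exponents_eq_cons (m := m) hi
          rw [hik] at he
          have hc := congrArg Multiset.card he
          rw [Multiset.card_cons, card_exponents, card_exponents] at hc
          refine ⟨by omega, fun hh => ?_⟩
          rw [he, h5 (by omega)]
        · have hsupp : (m - Finsupp.single i k).support = m.support := by
            ext j
            simp only [Finsupp.mem_support_iff, Finsupp.tsub_apply]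
            by_cases hj : i = j
            · subst hj
              rw [Finsupp.single_eq_same]
              omega
            · rw [Finsupp.single_eq_of_ne' hj]
              omega
          rw [hsupp] at h4
          exact ⟨by omega, fun hh => by omega⟩
      · exact absurd rfl hne

/-- In a linear relation take a partition with the greatest number of parts among those with nonzero
coefficient. The monomial with its parts as exponents occurs in no other term. -/
theorem linearIndependent_powerSumProd (d : ℕ) :
    LinearIndependent ℂ fun ρ : Nat.Partition d => powerSumProd ρ.parts := by
  classical
  rw [Fintype.linearIndependent_iff]
  intro c hc
  by_contra! hne
  obtain ⟨ρ₁, hρ₁⟩ := hne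
  obtain ⟨ρ, hρ, hmax⟩ := Finset.exists_max_image
    (Finset.univ.filter fun ρ : Nat.Partition d => c ρ ≠ 0) (fun ρ => Multiset.card ρ.parts)
    ⟨ρ₁, by simpa using hρ₁⟩
  simp only [Finset.mem_filter, Finset.mem_univ, true_and] at hρ hmax
  obtain ⟨m, hm⟩ := exists_exponents_eq ρ.parts fun k hk => ρ.parts_pos hk
  have h := congrArg (fun f : Lam => MvPowerSeries.coeff m (f : MvPowerSeries ℕ ℂ)) hc
  simp only [AddSubmonoidClass.coe_finsetSum, SetLike.val_smul, map_sum, map_smul, smul_eq_mul,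
    ZeroMemClass.coe_zero, map_zero] at h
  rw [Finset.sum_eq_single ρ] at h
  · obtain ⟨f, h1, h2, -⟩ := coeff_powerSumProd ρ.parts fun k hk => ρ.parts_pos hk
    rw [h1, mul_eq_zero] at h
    rcases h with h | h
    · exact hρ h
    · have := h2 m hm
      norm_cast at h
      omega
  · intro σ _ hσ
    by_cases hcσ : c σ = 0
    · rw [hcσ, zero_mul]
    · obtain ⟨f, h1, -, h3⟩ := coeff_powerSumProd σ.parts fun k hk => σ.parts_pos hk
      rw [h1]
      by_cases hf : f m = 0
      · simp [hf]
      · obtain ⟨h4, h5⟩ := h3 m hf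
        have h6 := hmax σ hcσ
        have h7 := card_exponents m
        rw [hm] at h7
        have h8 := h5 (by omega)
        rw [hm] at h8
        exact absurd (Nat.Partition.ext h8.symm) hσ
  · intro hn
    exact absurd (Finset.mem_univ ρ) hn

/-! ### Spans of products of generators with a large sum of squares -/

section HighSpan

variable {A : Type*} [CommRing A] (g : ℕ → A)

/-- The product of the `g k`, `k ∈ s`. -/
def genProd (s : Multiset ℕ) : A := (s.map g).prod

/-- The sum of the squares of the elements of `s`. -/
def sumSq (s : Multiset ℕ) : ℕ := (s.map fun k => k ^ 2).sum

theorem genProd_add (s t : Multiset ℕ) : genProd g (s + t) = genProd g s * genProd g t := by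
  simp [genProd]

theorem sumSq_add (s t : Multiset ℕ) : sumSq (s + t) = sumSq s + sumSq t := by
  simp [sumSq]

/-- This makes the filtration by sums of squares finite in each degree. -/
theorem sumSq_le (s : Multiset ℕ) : sumSq s ≤ s.sum ^ 2 := by
  induction s using Multiset.induction_on with
  | empty => simp [sumSq]
  | cons k s ih =>
    simp only [sumSq, Multiset.map_cons, Multiset.sum_cons] at *
    nlinarith [Nat.zero_le (k * s.sum)]

theorem genProd_filter_pos {g : ℕ → A} (h0 : g 0 = 1) (s : Multiset ℕ) :
    genProd g (s.filter fun k => 0 < k) = genProd g s := by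
  induction s using Multiset.induction_on with
  | empty => rfl
  | cons k s ih =>
    rcases Nat.eq_zero_or_pos k with rfl | hk
    · rw [Multiset.filter_cons_of_neg (p := fun k => 0 < k) s (lt_irrefl 0), ih]
      simp [genProd, h0]
    · rw [Multiset.filter_cons_of_pos (p := fun k => 0 < k) s hk]
      simp only [genProd, Multiset.map_cons, Multiset.prod_cons] at *
      rw [ih]

theorem sumSq_filter_pos (s : Multiset ℕ) : sumSq (s.filter fun k => 0 < k) = sumSq s := by
  induction s using Multiset.induction_on with
  | empty => rfl
  | cons k s ih =>
    rcases Nat.eq_zero_or_pos k with rfl | hk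
    · rw [Multiset.filter_cons_of_neg (p := fun k => 0 < k) s (lt_irrefl 0), ih]
      simp [sumSq]
    · rw [Multiset.filter_cons_of_pos (p := fun k => 0 < k) s hk]
      simp only [sumSq, Multiset.map_cons, Multiset.sum_cons] at *
      rw [ih]

theorem sum_filter_pos (s : Multiset ℕ) : (s.filter fun k => 0 < k).sum = s.sum := by
  induction s using Multiset.induction_on with
  | empty => rfl
  | cons k s ih =>
    rcases Nat.eq_zero_or_pos k with rfl | hk
    · rw [Multiset.filter_cons_of_neg (p := fun k => 0 < k) s (lt_irrefl 0), ih]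
      simp
    · rw [Multiset.filter_cons_of_pos (p := fun k => 0 < k) s hk]
      simp [ih]

variable [Algebra ℂ A]

/-- The span of the products `genProd g s` for multisets `s` of sum `d` with sum of squares at least
`N`. -/
def highSpan (d N : ℕ) : Submodule ℂ A :=
  Submodule.span ℂ {x | ∃ s : Multiset ℕ, s.sum = d ∧ N ≤ sumSq s ∧ x = genProd g s}

variable {g}

theorem genProd_mem_highSpan {s : Multiset ℕ} {N : ℕ} (h : N ≤ sumSq s) :
    genProd g s ∈ highSpan g s.sum N := Submodule.subset_span ⟨s, rfl, h, rfl⟩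

theorem highSpan_mono {d N M : ℕ} (h : N ≤ M) : highSpan g d M ≤ highSpan g d N := by
  refine Submodule.span_mono ?_
  rintro x ⟨s, h1, h2, h3⟩
  exact ⟨s, h1, h.trans h2, h3⟩

theorem mul_mem_highSpan {d e N M : ℕ} {x y : A} (hx : x ∈ highSpan g d N)
    (hy : y ∈ highSpan g e M) : x * y ∈ highSpan g (d + e) (N + M) := by
  have h := Submodule.mul_mem_mul hx hy
  rw [highSpan, highSpan, Submodule.span_mul_span] at h
  refine Submodule.span_mono ?_ h
  rintro _ ⟨_, ⟨s, h1, h2, rfl⟩, _, ⟨t, h3, h4, rfl⟩, rfl⟩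
  refine ⟨s + t, by rw [Multiset.sum_add, h1, h3], by rw [sumSq_add]; omega, ?_⟩
  exact (genProd_add g s t).symm

theorem highSpan_eq_bot {d N : ℕ} (h : d ^ 2 < N) : highSpan g d N = ⊥ := by
  rw [highSpan, Submodule.span_eq_bot]
  rintro x ⟨s, rfl, h2, -⟩
  have := sumSq_le s
  omega

/-- If every product of generators agrees with an element of `W` up to products with a larger sum of
squares, then all products of generators belong to `W`. -/
theorem highSpan_le_of_lead {d : ℕ} (W : Submodule ℂ A)
    (h : ∀ s : Multiset ℕ, s.sum = d → ∃ w ∈ W, genProd g s - w ∈ highSpan g d (sumSq s + 1)) :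
    highSpan g d 0 ≤ W := by
  -- Descending induction on `N`, starting beyond $d^2$, where the span is zero.
  have key : ∀ k N, d ^ 2 + 1 ≤ N + k → highSpan g d N ≤ W := by
    intro k
    induction k with
    | zero =>
      intro N hN
      rw [highSpan_eq_bot (by omega)]
      exact bot_le
    | succ k ih =>
      intro N hN
      refine Submodule.span_le.2 ?_
      rintro x ⟨s, h1, h2, rfl⟩
      obtain ⟨w, hw, hd⟩ := h s h1
      have := ih (N + 1) (by omega) (highSpan_mono (by omega) hd)
      simpa using W.add_mem this hw
  exact key (d ^ 2 + 1) 0 (by omega)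

/-- Leading terms multiply. -/
theorem lead_mul {x y : A} {s t : Multiset ℕ}
    (hx : x - genProd g s ∈ highSpan g s.sum (sumSq s + 1))
    (hy : y - genProd g t ∈ highSpan g t.sum (sumSq t + 1)) :
    x * y - genProd g (s + t) ∈ highSpan g (s + t).sum (sumSq (s + t) + 1) := by
  have e : x * y - genProd g (s + t) = (x - genProd g s) * (y - genProd g t) +
      ((x - genProd g s) * genProd g t + genProd g s * (y - genProd g t)) := by
    rw [genProd_add]; ring
  rw [e, Multiset.sum_add, sumSq_add]
  refine Submodule.add_mem _ (highSpan_mono (by omega) (mul_mem_highSpan hx hy))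
    (Submodule.add_mem _ ?_ ?_)
  · exact highSpan_mono (by omega) (mul_mem_highSpan hx (genProd_mem_highSpan le_rfl))
  · exact highSpan_mono (by omega) (mul_mem_highSpan (genProd_mem_highSpan le_rfl) hy)

end HighSpan

/-! ### A criterion for linear independence of homogeneous families -/

theorem highSpan_homogeneous {g : ℕ → Lam}
    (hg : ∀ k m, m.degree ≠ k → MvPowerSeries.coeff m (g k : MvPowerSeries ℕ ℂ) = 0) {d N : ℕ}
    {x : Lam} (hx : x ∈ highSpan g d N) (m : ℕ →₀ ℕ) (hm : m.degree ≠ d) :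
    MvPowerSeries.coeff m (x : MvPowerSeries ℕ ℂ) = 0 := by
  classical
  have key : ∀ (s : Multiset ℕ) (m : ℕ →₀ ℕ), m.degree ≠ s.sum →
      MvPowerSeries.coeff m ((genProd g s : Lam) : MvPowerSeries ℕ ℂ) = 0 := by
    intro s
    induction s using Multiset.induction_on with
    | empty =>
      intro m hm
      simp only [genProd, Multiset.map_zero, Multiset.prod_zero, OneMemClass.coe_one,
        MvPowerSeries.coeff_one]
      rw [if_neg]
      rintro rfl
      simp at hm
    | cons k s ih =>
      intro m hm
      have e : ((genProd g (k ::ₘ s) : Lam) : MvPowerSeries ℕ ℂ) =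
          (g k : MvPowerSeries ℕ ℂ) * ((genProd g s : Lam) : MvPowerSeries ℕ ℂ) := by
        simp [genProd]
      rw [e, MvPowerSeries.coeff_mul]
      refine Finset.sum_eq_zero fun p hp => ?_
      rw [Finset.HasAntidiagonal.mem_antidiagonal] at hp
      have hd : p.1.degree + p.2.degree = m.degree := by rw [← hp, map_add]
      rw [Multiset.sum_cons] at hm
      by_cases h1 : p.1.degree = k
      · rw [ih _ (by omega), mul_zero]
      · rw [hg _ _ h1, zero_mul]
  induction hx using Submodule.span_induction with
  | mem x hx =>
    obtain ⟨s, rfl, -, rfl⟩ := hx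
    exact key s m hm
  | zero => simp
  | add x y _ _ hx hy => simp [hx, hy]
  | smul c x _ hx => simp [hx]

theorem linearIndependent_of_homogeneous {ι : Type*} (v : ι → Lam) (deg : ι → ℕ)
    (hv : ∀ i m, m.degree ≠ deg i → MvPowerSeries.coeff m (v i : MvPowerSeries ℕ ℂ) = 0)
    (h : ∀ d, LinearIndependent ℂ fun i : {i // deg i = d} => v i) : LinearIndependent ℂ v := by
  classical
  rw [linearIndependent_iff']
  intro s c hc i hi
  have hsum : ∑ j ∈ s with deg j = deg i, c j • v j = 0 := by
    apply Subtype.ext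
    ext m
    have hcm := congrArg (fun f : Lam => MvPowerSeries.coeff m (f : MvPowerSeries ℕ ℂ)) hc
    simp only [AddSubmonoidClass.coe_finsetSum, SetLike.val_smul, map_sum, map_smul, smul_eq_mul,
      ZeroMemClass.coe_zero, map_zero] at hcm ⊢
    by_cases hm : m.degree = deg i
    · rw [← hcm, Finset.sum_filter]
      refine Finset.sum_congr rfl fun j _ => ?_
      split_ifs with hj
      · rfl
      · rw [hv j m (by omega), mul_zero]
    · refine Finset.sum_eq_zero fun j hj => ?_
      rw [hv j m (by rw [(Finset.mem_filter.1 hj).2]; exact hm), mul_zero]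
  have h2 := linearIndependent_iff'.1 (h (deg i))
    ((s.filter fun j => deg j = deg i).subtype fun j => deg j = deg i) (fun j => c j) ?_
    ⟨i, rfl⟩ (by simpa using hi)
  · exact h2
  · rw [← hsum, Finset.sum_subtype_of_mem (fun j => c j • v j)]
    intro j hj
    exact (Finset.mem_filter.1 hj).2

/-- The span of `v` has dimension at least the number of the `w k`, hence at least the number of the
`v i`. -/
theorem linearIndependent_of_span {ι κ : Type*} [Fintype ι] [Fintype κ] (v : ι → Lam) (w : κ → Lam)
    (hw : LinearIndependent ℂ w) (hcard : Fintype.card ι ≤ Fintype.card κ)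
    (hspan : ∀ k, w k ∈ Submodule.span ℂ (Set.range v)) : LinearIndependent ℂ v := by
  rw [linearIndependent_iff_card_le_finrank_span]
  refine hcard.trans ?_
  rw [← finrank_span_eq_card hw]
  have : FiniteDimensional ℂ (Submodule.span ℂ (Set.range v)) :=
    FiniteDimensional.span_of_finite ℂ (Set.finite_range v)
  refine Submodule.finrank_mono (Submodule.span_le.2 ?_)
  rintro _ ⟨k, rfl⟩
  exact hspan k

/-! ### Row multisets -/

/-- The multiset of the nonzero row lengths. -/
def rowMultiset (μ : YoungDiagram) : Multiset ℕ := (Multiset.range (μ.colLen 0)).map μ.rowLen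

theorem rowMultiset_eq_coe (μ : YoungDiagram) : rowMultiset μ = (μ.rowLens : Multiset ℕ) := rfl

theorem sum_rowMultiset (μ : YoungDiagram) : (rowMultiset μ).sum = μ.card :=
  (card_eq_sum_rowLen μ le_rfl).symm

theorem pos_of_mem_rowMultiset {μ : YoungDiagram} {k : ℕ} (hk : k ∈ rowMultiset μ) : 0 < k := by
  rw [rowMultiset_eq_coe, Multiset.mem_coe] at hk
  exact μ.pos_of_mem_rowLens k hk

theorem rowMultiset_injective : Function.Injective rowMultiset := by
  intro μ ν h
  rw [rowMultiset_eq_coe, rowMultiset_eq_coe, Multiset.coe_eq_coe] at h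
  have h2 := h.eq_of_sortedGE μ.rowLens_sorted ν.rowLens_sorted
  rw [← YoungDiagram.ofRowLens_to_rowLens_eq_self (μ := μ),
    ← YoungDiagram.ofRowLens_to_rowLens_eq_self (μ := ν)]
  congr 1

theorem exists_rowMultiset_eq {s : Multiset ℕ} (hs : ∀ k ∈ s, 0 < k) :
    ∃ μ, rowMultiset μ = s := by
  refine ⟨YoungDiagram.ofRowLens (s.sort (· ≥ ·)) (s.pairwise_sort _).sortedGE, ?_⟩
  rw [rowMultiset_eq_coe, YoungDiagram.rowLens_ofRowLens_eq_self, Multiset.sort_eq]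
  intro x hx
  exact hs x (by simpa using hx)

/-- The row lengths of a Young diagram with `d` cells, as a partition of `d`. -/
def rowPartition {d : ℕ} (μ : {μ : YoungDiagram // μ.card = d}) : Nat.Partition d where
  parts := rowMultiset μ
  parts_pos := fun h => pos_of_mem_rowMultiset h
  parts_sum := (sum_rowMultiset _).trans μ.2

theorem rowPartition_injective {d : ℕ} : Function.Injective (rowPartition (d := d)) :=
  fun _ _ h => Subtype.ext (rowMultiset_injective (congrArg Nat.Partition.parts h))

theorem finite_subtype_card (d : ℕ) : Finite {μ : YoungDiagram // μ.card = d} :=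
  finite_diagrams d

/-! ### Power sums in terms of products of generators -/

theorem self_mem_highSpan {A : Type*} [CommRing A] [Algebra ℂ A] (g : ℕ → A) (k : ℕ) :
    g k ∈ highSpan g k 0 := by
  simpa [genProd] using genProd_mem_highSpan (g := g) (s := {k}) (Nat.zero_le _)

theorem powerSumProd_mem_highSpan {g : ℕ → Lam} (s : Multiset ℕ)
    (h : ∀ k ∈ s, powerSum k ∈ highSpan g k 0) : powerSumProd s ∈ highSpan g s.sum 0 := by
  induction s using Multiset.induction_on with
  | empty =>
    have h := genProd_mem_highSpan (g := g) (s := 0) (Nat.zero_le _)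
    simpa [genProd, powerSumProd] using h
  | cons k s ih =>
    have h1 := mul_mem_highSpan (h k (Multiset.mem_cons_self k s))
      (ih fun x hx => h x (Multiset.mem_cons_of_mem hx))
    simpa [powerSumProd] using h1

theorem coeff_complete (r : ℕ) (m : ℕ →₀ ℕ) :
    MvPowerSeries.coeff m (complete r : MvPowerSeries ℕ ℂ) = if m.degree = r then 1 else 0 := rfl

theorem complete_zero : complete 0 = 1 := by
  apply Subtype.ext
  ext m
  classical
  rw [coeff_complete, OneMemClass.coe_one, MvPowerSeries.coeff_one]
  simp [Finsupp.degree_eq_zero_iff]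

/-- Newton's identity. A monomial `m` of degree `n` is obtained from $p_{k+1}h_{n-k-1}$ once for
each variable $x_i$ with $k+1\le m_i$, so altogether $\sum_i m_i=n$ times. -/
theorem complete_recursion (n : ℕ) :
    (n : ℂ) • complete n = ∑ k ∈ Finset.range n, powerSum (k + 1) * complete (n - (k + 1)) := by
  apply Subtype.ext
  ext m
  simp only [SetLike.val_smul, AddSubmonoidClass.coe_finsetSum, MulMemClass.coe_mul, map_smul,
    map_sum, smul_eq_mul]
  have step : ∀ k ∈ Finset.range n, MvPowerSeries.coeff m ((powerSum (k + 1) : MvPowerSeries ℕ ℂ) *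
      (complete (n - (k + 1)) : MvPowerSeries ℕ ℂ)) =
      ∑ i ∈ m.support, if k + 1 ≤ m i then (if m.degree = n then 1 else 0) else 0 := by
    intro k hk
    rw [Finset.mem_range] at hk
    rw [coeff_powerSum_mul _ k.succ_pos]
    refine Finset.sum_congr rfl fun i _ => ?_
    split_ifs with h1
    all_goals try rfl
    all_goals
      have h3 := congrArg Finsupp.degree (tsub_add_cancel_of_le (Finsupp.single_le_iff.2 h1))
      rw [map_add, Finsupp.degree_single] at h3
      rw [coeff_complete]
      split_ifs
      · first | rfl | omega
      · first | rfl | omega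
  rw [Finset.sum_congr rfl step, coeff_complete]
  by_cases hm : m.degree = n
  · simp only [hm, if_true]
    rw [Finset.sum_comm, mul_one]
    have inner : ∀ i ∈ m.support, ∑ k ∈ Finset.range n, (if k + 1 ≤ m i then (1 : ℂ) else 0) =
        (m i : ℂ) := by
      intro i _
      have hle : m i ≤ n := hm ▸ Finsupp.le_degree i m
      rw [← Finset.sum_filter, Finset.sum_const, nsmul_eq_mul, mul_one]
      congr 1
      have : (Finset.range n).filter (fun k => k + 1 ≤ m i) = Finset.range (m i) := by
        ext k
        simp only [Finset.mem_filter, Finset.mem_range]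
        omega
      rw [this, Finset.card_range]
    rw [Finset.sum_congr rfl inner, ← Nat.cast_sum, ← hm]
    rfl
  · simp [hm]

theorem powerSum_mem_highSpan_complete {n : ℕ} (hn : 0 < n) :
    powerSum n ∈ highSpan complete n 0 := by
  induction n using Nat.strong_induction_on with
  | _ n ih =>
    obtain ⟨n, rfl⟩ := Nat.exists_eq_succ_of_ne_zero hn.ne'
    have h := complete_recursion (n + 1)
    rw [Finset.sum_range_succ, Nat.sub_self, complete_zero, mul_one] at h
    rw [Nat.succ_eq_add_one, ← sub_eq_of_eq_add' h]
    refine Submodule.sub_mem _ (Submodule.smul_mem _ _ (self_mem_highSpan _ _))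
      (Submodule.sum_mem _ fun k hk => ?_)
    rw [Finset.mem_range] at hk
    have := mul_mem_highSpan (ih (k + 1) (by omega) k.succ_pos)
      (self_mem_highSpan complete (n + 1 - (k + 1)))
    rwa [show k + 1 + (n + 1 - (k + 1)) = n + 1 by omega] at this

/-! ### Linear independence of the Schur functions -/

theorem genProd_map_range {A : Type*} [CommRing A] (g : ℕ → A) (f : ℕ → ℕ) (n : ℕ) :
    genProd g ((Multiset.range n).map f) = ∏ i : Fin n, g (f i) := by
  rw [Fin.prod_univ_eq_prod_range (fun i => g (f i)), genProd, Multiset.map_map]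
  rfl

/-- Expanding the squares, $\sum b_i^2-\sum a_i^2=2\bigl(\sum a_{\sigma i}\,i-\sum
a_i\,i\bigr)+\sum(i-\sigma i)^2$. The first bracket is nonnegative by the rearrangement inequality
and the last sum is positive for $\sigma\ne1$. -/
theorem sumSq_add_one_le_of_perm {n : ℕ} {a : ℕ → ℕ} (ha : Antitone a) {σ : Equiv.Perm (Fin n)}
    (hσ : σ ≠ 1) {b : Fin n → ℕ} (hb : ∀ i, (b i : ℤ) = a (σ i) - (σ i : ℕ) + (i : ℕ)) :
    ∑ i : Fin n, a i ^ 2 + 1 ≤ ∑ i, b i ^ 2 := by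
  have h1 : ∑ i : Fin n, (a i : ℤ) * (i : ℕ) ≤ ∑ i : Fin n, (a (σ i) : ℤ) * (i : ℕ) := by
    refine Antivary.sum_mul_le_sum_comp_perm_mul (f := fun i : Fin n => (a i : ℤ))
      (g := fun i : Fin n => ((i : ℕ) : ℤ)) ?_
    intro i j hij
    have h : ((i : ℕ) : ℤ) < (j : ℕ) := hij
    change (a j : ℤ) ≤ a i
    exact_mod_cast ha (by omega)
  have h2 : ∑ i : Fin n, (a (σ i) : ℤ) * (σ i : ℕ) = ∑ i : Fin n, (a i : ℤ) * (i : ℕ) :=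
    Equiv.sum_comp σ fun i : Fin n => (a i : ℤ) * (i : ℕ)
  have h3 : ∑ i : Fin n, (a (σ i) : ℤ) ^ 2 = ∑ i : Fin n, (a i : ℤ) ^ 2 :=
    Equiv.sum_comp σ fun i : Fin n => (a i : ℤ) ^ 2
  obtain ⟨i₀, hi₀⟩ : ∃ i, σ i ≠ i := by
    by_contra! h
    exact hσ (Equiv.ext h)
  have h4 : 1 ≤ ∑ i : Fin n, (((i : ℕ) : ℤ) - (σ i : ℕ)) ^ 2 := by
    have : 1 ≤ (((i₀ : ℕ) : ℤ) - (σ i₀ : ℕ)) ^ 2 := by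
      have hne : ((i₀ : ℕ) : ℤ) - (σ i₀ : ℕ) ≠ 0 := by
        intro h
        exact hi₀ (Fin.ext (by omega))
      have := sq_pos_of_ne_zero hne
      omega
    exact this.trans (Finset.single_le_sum
      (f := fun i : Fin n => (((i : ℕ) : ℤ) - (σ i : ℕ)) ^ 2) (fun _ _ => sq_nonneg _)
      (Finset.mem_univ i₀))
  have h5 : ∑ i, (b i : ℤ) ^ 2 = ∑ i : Fin n, (a (σ i) : ℤ) ^ 2 +
      2 * (∑ i : Fin n, (a (σ i) : ℤ) * (i : ℕ) - ∑ i : Fin n, (a (σ i) : ℤ) * (σ i : ℕ)) +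
      ∑ i : Fin n, (((i : ℕ) : ℤ) - (σ i : ℕ)) ^ 2 := by
    rw [← Finset.sum_sub_distrib, Finset.mul_sum, ← Finset.sum_add_distrib,
      ← Finset.sum_add_distrib]
    refine Finset.sum_congr rfl fun i _ => ?_
    rw [hb]
    ring
  zify
  linarith

/-- In the Jacobi–Trudi determinant the identity permutation gives $h_\mu$, and every other
permutation gives zero or a product with a larger sum of squares. -/
theorem schur_sub_genProd_mem (μ : YoungDiagram) :
    schur μ - genProd complete (rowMultiset μ) ∈
      highSpan complete μ.card (sumSq (rowMultiset μ) + 1) := by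
  rw [schur, Matrix.det_apply, ← Finset.add_sum_erase _ _ (Finset.mem_univ 1)]
  have e : genProd complete (rowMultiset μ) =
      Equiv.Perm.sign (1 : Equiv.Perm (Fin (μ.colLen 0))) • ∏ i,
        Matrix.of (fun i j : Fin (μ.colLen 0) =>
          completeInt ((μ.rowLen i : ℤ) - (i : ℤ) + (j : ℤ)))
          ((1 : Equiv.Perm (Fin (μ.colLen 0))) i) i := by
    rw [rowMultiset, genProd_map_range, Equiv.Perm.sign_one, one_smul]
    refine Finset.prod_congr rfl fun i _ => ?_
    rw [Equiv.Perm.one_apply, Matrix.of_apply, sub_add_cancel, completeInt, if_neg (by omega),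
      Int.toNat_natCast]
  rw [← e, add_sub_cancel_left]
  refine Submodule.sum_mem _ fun σ hσ => ?_
  have hmem : ∏ i, Matrix.of (fun i j : Fin (μ.colLen 0) =>
      completeInt ((μ.rowLen i : ℤ) - (i : ℤ) + (j : ℤ))) (σ i) i ∈
      highSpan complete μ.card (sumSq (rowMultiset μ) + 1) := by
    simp only [Matrix.of_apply]
    -- A negative index kills the product; otherwise the indices are natural numbers with sum
    -- $|\mu|$.
    by_cases hneg : ∃ i, (μ.rowLen (σ i) : ℤ) - ((σ i : ℕ) : ℤ) + ((i : ℕ) : ℤ) < 0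
    · obtain ⟨i, hi⟩ := hneg
      rw [Finset.prod_eq_zero (Finset.mem_univ i) (by rw [completeInt, if_pos hi])]
      exact Submodule.zero_mem _
    · push Not at hneg
      set b : Fin (μ.colLen 0) → ℕ := fun i =>
        ((μ.rowLen (σ i) : ℤ) - ((σ i : ℕ) : ℤ) + ((i : ℕ) : ℤ)).toNat with hb
      have hb' : ∀ i, (b i : ℤ) = μ.rowLen (σ i) - (σ i : ℕ) + (i : ℕ) := fun i =>
        Int.toNat_of_nonneg (hneg i)
      refine Submodule.subset_span ⟨Finset.univ.val.map b, ?_, ?_, ?_⟩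
      · change ∑ i, b i = _
        rw [card_eq_sum_rowLen μ le_rfl, ← Fin.sum_univ_eq_sum_range]
        zify
        simp only [hb']
        rw [Finset.sum_add_distrib, Finset.sum_sub_distrib,
          Equiv.sum_comp σ fun i : Fin (μ.colLen 0) => (μ.rowLen i : ℤ),
          Equiv.sum_comp σ fun i : Fin (μ.colLen 0) => ((i : ℕ) : ℤ), sub_add_cancel]
      · have h := sumSq_add_one_le_of_perm (rowLen_antitone μ) (Finset.ne_of_mem_erase hσ) hb'
        rw [Fin.sum_univ_eq_sum_range (fun i => μ.rowLen i ^ 2)] at h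
        rw [sumSq, sumSq, rowMultiset, Multiset.map_map, Multiset.map_map]
        exact h
      · rw [genProd, Multiset.map_map]
        refine Finset.prod_congr rfl fun i _ => ?_
        rw [completeInt, if_neg (not_lt.2 (hneg i))]
        rfl
  rcases Int.units_eq_one_or (Equiv.Perm.sign σ) with h | h
  · rw [h, one_smul]
    exact hmem
  · rw [h, Units.neg_smul, one_smul]
    exact Submodule.neg_mem _ hmem

theorem schur_mem_highSpan (μ : YoungDiagram) : schur μ ∈ highSpan complete μ.card 0 := by
  have h := genProd_mem_highSpan (g := complete) (s := rowMultiset μ) (Nat.zero_le _)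
  rw [sum_rowMultiset] at h
  rw [← sub_add_cancel (schur μ) (genProd complete (rowMultiset μ))]
  exact Submodule.add_mem _ (highSpan_mono (Nat.zero_le _) (schur_sub_genProd_mem μ)) h

/-- In degree `d` the Schur functions span all products of complete functions by leading terms,
hence the independent power sum products, and there are at most as many diagrams as partitions of
`d`. -/
theorem linearIndependent_schur : LinearIndependent ℂ schur := by
  refine linearIndependent_of_homogeneous schur YoungDiagram.card
    (fun μ m hm => highSpan_homogeneous (fun k m hm => ?_) (schur_mem_highSpan μ) m hm)
    fun d => ?_
  · rw [coeff_complete, if_neg hm]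
  have := finite_subtype_card d
  have := Fintype.ofFinite {μ : YoungDiagram // μ.card = d}
  refine linearIndependent_of_span _ _ (linearIndependent_powerSumProd d)
    (Fintype.card_le_of_injective _ rowPartition_injective) fun ρ => ?_
  have hle : highSpan complete d 0 ≤ Submodule.span ℂ
      (Set.range fun μ : {μ : YoungDiagram // μ.card = d} => schur μ) := by
    refine highSpan_le_of_lead _ fun s hs => ?_
    obtain ⟨μ, hμ⟩ := exists_rowMultiset_eq (s := s.filter fun k => 0 < k)
      fun k hk => (Multiset.mem_filter.1 hk).2
    have hc : μ.card = d := by rw [← sum_rowMultiset, hμ, sum_filter_pos, hs]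
    refine ⟨schur μ, Submodule.subset_span ⟨⟨μ, hc⟩, rfl⟩, ?_⟩
    have h := schur_sub_genProd_mem μ
    rw [hμ, sumSq_filter_pos, genProd_filter_pos complete_zero, hc] at h
    rw [← neg_sub]
    exact Submodule.neg_mem _ h
  refine hle ?_
  have := powerSumProd_mem_highSpan (g := complete) ρ.parts
    fun k hk => powerSum_mem_highSpan_complete (ρ.parts_pos hk)
  rwa [ρ.parts_sum] at this

/-! ### The quadratic relations between the `q_r` -/

/-- The odd power sums `2 p_{n+1}`, `n` even, as the coefficients of a power series. -/
def oddSeries (n : ℕ) : Lam := if Even n then (2 : ℂ) • powerSum (n + 1) else 0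

theorem succ_smul_qLam (n : ℕ) : ((n : ℂ) + 1) • qLam (n + 1) =
    ∑ x ∈ Finset.HasAntidiagonal.antidiagonal n, qLam x.1 * oddSeries x.2 := by
  have h := qLam_recursion (n + 1)
  rw [Finset.sum_filter, Finset.sum_range_succ', if_neg (by decide), add_zero,
    Finset.smul_sum] at h
  push_cast at h
  rw [h, ← Finset.Nat.sum_antidiagonal_swap, Finset.Nat.sum_antidiagonal_eq_sum_range_succ_mk]
  refine Finset.sum_congr rfl fun k _ => ?_
  simp only [Prod.swap, oddSeries]
  by_cases hk : Even k
  · rw [if_pos hk.add_one, if_pos hk, mul_smul_comm, mul_comm]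
  · rw [if_neg (by rw [Nat.not_odd_iff_even]; exact (Nat.not_even_iff_odd.1 hk).add_one),
      if_neg hk, mul_zero, smul_zero]

theorem neg_one_pow_add_even {A : Type*} [CommRing A] {i j : ℕ} (hj : Even j) (x y : A) :
    (-1) ^ (i + j + 1) * (x * y) = -((-1) ^ i * x * y) := by
  rw [pow_succ, pow_add, hj.neg_one_pow]
  ring

/-- These are the coefficients of $Q(-t)Q(t)=1$ in positive degree. The recursion says $Q'=QS$ with
$S$ even, so $Q(-t)$ has logarithmic derivative $-S$ and the product has derivative zero. -/
theorem sum_antidiagonal_qLam {n : ℕ} (hn : 0 < n) :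
    ∑ x ∈ Finset.HasAntidiagonal.antidiagonal n, (-1 : Lam) ^ x.1 * (qLam x.1 * qLam x.2) = 0 := by
  obtain ⟨n, rfl⟩ := Nat.exists_eq_succ_of_ne_zero hn.ne'
  set Q : PowerSeries Lam := PowerSeries.mk qLam with hQ
  set R : PowerSeries Lam := PowerSeries.mk fun n => (-1) ^ n * qLam n with hR
  set S : PowerSeries Lam := PowerSeries.mk oddSeries with hS
  have hsmul : ∀ n : ℕ, qLam (n + 1) * ((n : Lam) + 1) = ((n : ℂ) + 1) • qLam (n + 1) := by
    intro n
    rw [Algebra.smul_def, mul_comm]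
    simp
  have h1 : PowerSeries.derivative Lam Q = Q * S := by
    ext1 n
    rw [PowerSeries.coeff_derivative, PowerSeries.coeff_mul]
    simp only [hQ, hS, PowerSeries.coeff_mk]
    rw [← succ_smul_qLam, hsmul]
  have h2 : PowerSeries.derivative Lam R = -(R * S) := by
    ext1 n
    rw [PowerSeries.coeff_derivative, map_neg, PowerSeries.coeff_mul]
    simp only [hR, hS, PowerSeries.coeff_mk]
    rw [mul_assoc, hsmul, succ_smul_qLam, Finset.mul_sum, ← Finset.sum_neg_distrib]
    refine Finset.sum_congr rfl fun x hx => ?_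
    rw [Finset.HasAntidiagonal.mem_antidiagonal] at hx
    unfold oddSeries
    split_ifs with hev
    · rw [← hx]
      exact neg_one_pow_add_even hev _ _
    · simp
  have h3 : PowerSeries.derivative Lam (R * Q) = 0 := by
    rw [Derivation.leibniz, h1, h2]
    simp only [smul_eq_mul]
    ring
  have h4 := congrArg (PowerSeries.coeff n) h3
  rw [PowerSeries.coeff_derivative, map_zero, PowerSeries.coeff_mul] at h4
  simp only [hQ, hR, PowerSeries.coeff_mk, mul_assoc] at h4
  set x := ∑ x ∈ Finset.HasAntidiagonal.antidiagonal (n + 1),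
    (-1 : Lam) ^ x.1 * (qLam x.1 * qLam x.2)
  have h5 : ((n : ℂ) + 1) • x = 0 := by
    rw [Algebra.smul_def, mul_comm]
    simpa using h4
  exact (smul_eq_zero.1 h5).resolve_left (by exact_mod_cast n.succ_ne_zero)

theorem genProd_pair {A : Type*} [CommRing A] (g : ℕ → A) (a b : ℕ) :
    genProd g {a, b} = g a * g b := by simp [genProd]

theorem sumSq_pair (a b : ℕ) : sumSq {a, b} = a ^ 2 + b ^ 2 := by simp [sumSq]

theorem pair_mem_highSpan {A : Type*} [CommRing A] [Algebra ℂ A] {g : ℕ → A} {a b d N : ℕ}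
    (hd : a + b = d) (hN : N ≤ a ^ 2 + b ^ 2) : g a * g b ∈ highSpan g d N :=
  Submodule.subset_span ⟨{a, b}, by simpa using hd, by rwa [sumSq_pair], (genProd_pair g a b).symm⟩

theorem neg_one_pow_mul_mem_iff {A : Type*} [CommRing A] [Algebra ℂ A] {W : Submodule ℂ A} {x : A}
    {i : ℕ} : (-1) ^ i * x ∈ W ↔ x ∈ W := by
  rcases neg_one_pow_eq_or A i with h | h
  · rw [h, one_mul]
  · rw [h, neg_one_mul, neg_mem_iff]

/-- In the quadratic relation of degree $2a$ the balanced term $q_a^2$ is, up to sign, minus the sum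
of the others, and every other $q_iq_j$ with $i+j=2a$ has $i^2+j^2>2a^2$. -/
theorem qLam_sq_mem {a : ℕ} (ha : 0 < a) :
    qLam a * qLam a ∈ highSpan qLam (a + a) (a ^ 2 + a ^ 2 + 1) := by
  have h := sum_antidiagonal_qLam (n := a + a) (by omega)
  rw [← Finset.add_sum_erase _ _ (Finset.HasAntidiagonal.mem_antidiagonal.2 rfl : ((a, a) : ℕ × ℕ) ∈
    Finset.HasAntidiagonal.antidiagonal (a + a))] at h
  have h2 : (-1) ^ a * (qLam a * qLam a) ∈ highSpan qLam (a + a) (a ^ 2 + a ^ 2 + 1) := by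
    rw [eq_neg_of_add_eq_zero_left h]
    refine Submodule.neg_mem _ (Submodule.sum_mem _ fun x hx => neg_one_pow_mul_mem_iff.2 ?_)
    obtain ⟨i, j⟩ := x
    rw [Finset.mem_erase, Finset.HasAntidiagonal.mem_antidiagonal] at hx
    obtain ⟨hne, hsum⟩ := hx
    simp only at hsum
    refine pair_mem_highSpan hsum ?_
    have hne2 : (i : ℤ) - a ≠ 0 := by
      intro h0
      exact hne (by ext <;> simp <;> omega)
    have hpos := sq_pos_of_ne_zero hne2
    have hj : (j : ℤ) = 2 * a - i := by omega
    zify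
    rw [hj]
    nlinarith
  exact neg_one_pow_mul_mem_iff.1 h2

theorem genProd_mem_of_not_nodup {s : Multiset ℕ} (hs : ¬(s.filter fun k => 0 < k).Nodup) :
    genProd qLam s ∈ highSpan qLam s.sum (sumSq s + 1) := by
  rw [Multiset.nodup_iff_le] at hs
  push Not at hs
  obtain ⟨a, ha⟩ := hs
  have hpos : 0 < a := (Multiset.mem_filter.1
    (Multiset.mem_of_le ha (Multiset.mem_cons_self a _))).2
  obtain ⟨t, ht⟩ := Multiset.le_iff_exists_add.1 (ha.trans (Multiset.filter_le _ s))
  have e : s = {a, a} + t := ht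
  rw [e, genProd_add, sumSq_add, Multiset.sum_add, genProd_pair, sumSq_pair]
  have := mul_mem_highSpan (qLam_sq_mem hpos) (genProd_mem_highSpan (g := qLam) (s := t) le_rfl)
  simpa [add_right_comm] using this

theorem powerSum_mem_highSpan_qLam {n : ℕ} (hn : Odd n) : powerSum n ∈ highSpan qLam n 0 := by
  induction n using Nat.strong_induction_on with
  | _ n ih =>
    have h := qLam_recursion n
    rw [← Finset.add_sum_erase _ _ (Finset.mem_filter.2 ⟨Finset.self_mem_range_succ n, hn⟩),
      Nat.sub_self, qLam_zero, mul_one, smul_add] at h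
    have h2 : powerSum n = (2 : ℂ)⁻¹ • ((n : ℂ) • qLam n - (2 : ℂ) • ∑ k ∈
        ((Finset.range (n + 1)).filter Odd).erase n, powerSum k * qLam (n - k)) := by
      rw [h, add_sub_cancel_right, smul_smul, inv_mul_cancel₀ two_ne_zero, one_smul]
    rw [h2]
    refine Submodule.smul_mem _ _ (Submodule.sub_mem _ (Submodule.smul_mem _ _
      (self_mem_highSpan _ _)) (Submodule.smul_mem _ _ (Submodule.sum_mem _ fun k hk => ?_)))
    rw [Finset.mem_erase, Finset.mem_filter, Finset.mem_range] at hk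
    have := mul_mem_highSpan (ih k (by omega) hk.2.2) (self_mem_highSpan qLam (n - k))
    rwa [show k + (n - k) = n by omega] at this

/-! ### Leading terms of Schur's `Q`-functions -/

/-- Moving $i\ge1$ units from the smaller index to the larger one raises the sum of squares by
$2i(a-b)+2i^2$. -/
theorem schurQTwo_sub_genProd_mem {a b : ℕ} (h : b ≤ a) :
    (schurQTwo a b : Lam) - genProd qLam {a, b} ∈
      highSpan qLam ({a, b} : Multiset ℕ).sum (sumSq {a, b} + 1) := by
  have e : (schurQTwo a b : Lam) = qLam a * qLam b +
      2 * ∑ i ∈ Finset.Icc 1 b, (-1) ^ i * (qLam (a + i) * qLam (b - i)) := by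
    unfold schurQTwo
    push_cast
    rfl
  rw [e, genProd_pair, add_sub_cancel_left, two_mul]
  have key : ∑ i ∈ Finset.Icc 1 b, (-1) ^ i * (qLam (a + i) * qLam (b - i)) ∈
      highSpan qLam ({a, b} : Multiset ℕ).sum (sumSq {a, b} + 1) := by
    refine Submodule.sum_mem _ fun i hi => neg_one_pow_mul_mem_iff.2 ?_
    rw [Finset.mem_Icc] at hi
    obtain ⟨c, rfl⟩ := Nat.exists_eq_add_of_le hi.2
    obtain ⟨t, rfl⟩ := Nat.exists_eq_add_of_le h
    rw [Nat.add_sub_cancel_left]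
    refine pair_mem_highSpan (by simp; omega) ?_
    rw [sumSq_pair]
    have h1 := hi.1
    nlinarith [Nat.zero_le (i * t)]
  exact Submodule.add_mem _ key key

theorem map_univ_succAbove {α : Type*} {n : ℕ} (f : Fin (n + 1) → α) (j : Fin (n + 1)) :
    (Finset.univ : Finset (Fin (n + 1))).val.map f =
      f j ::ₘ (Finset.univ : Finset (Fin n)).val.map fun i => f (j.succAbove i) := by
  rw [Fin.univ_succAbove n j]
  simp [Function.comp_def]

theorem sum_neg_one_pow_fin {R : Type*} [CommRing R] (m : ℕ) :
    ∑ j : Fin (2 * m + 1), (-1 : R) ^ (j : ℕ) = 1 := by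
  rw [Fin.sum_univ_eq_sum_range (fun j => (-1 : R) ^ j)]
  induction m with
  | zero => simp
  | succ m ih =>
    rw [show 2 * (m + 1) + 1 = 2 * m + 1 + 1 + 1 by ring, Finset.sum_range_succ,
      Finset.sum_range_succ, ih, pow_succ]
    ring

/-- By induction all terms of the first-row expansion have the same leading product $\prod_a
q_{f(a)}$, up to sign. An odd number of alternating signs adds up to 1, so this product survives
with coefficient 1. -/
theorem pfaffian_sub_genProd_mem (m : ℕ) (f : Fin (2 * m) → ℕ) (hf : Antitone f) :
    ((pfaffian m (fun a b => schurQTwo (f a) (f b)) : Omega) : Lam) -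
      genProd qLam ((Finset.univ : Finset (Fin (2 * m))).val.map f) ∈
      highSpan qLam ((Finset.univ : Finset (Fin (2 * m))).val.map f).sum
        (sumSq ((Finset.univ : Finset (Fin (2 * m))).val.map f) + 1) := by
  induction m with
  | zero => simp [pfaffian, genProd]
  | succ m ih =>
    set s : Multiset ℕ := (Finset.univ : Finset (Fin (2 * (m + 1)))).val.map f with hs
    have hsplit : ∀ j : Fin (2 * m + 1), s = {f (0 : Fin (2 * m + 1 + 1)), f j.succ} +
        (Finset.univ : Finset (Fin (2 * m))).val.map fun a => f (j.succAbove a).succ := by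
      intro j
      rw [hs]
      refine (map_univ_succAbove (n := 2 * m + 1) f 0).trans ?_
      rw [map_univ_succAbove (n := 2 * m) (fun i => f ((0 : Fin (2 * m + 1 + 1)).succAbove i)) j]
      simp
    have e : ((pfaffian (m + 1) (fun a b => schurQTwo (f a) (f b)) : Omega) : Lam) - genProd qLam s =
        ∑ j : Fin (2 * m + 1), (-1) ^ (j : ℕ) *
          ((schurQTwo (f (0 : Fin (2 * m + 1 + 1))) (f j.succ) : Lam) *
            ((pfaffian m (fun a b => schurQTwo (f (j.succAbove a).succ) (f (j.succAbove b).succ)) :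
              Omega) : Lam) - genProd qLam s) := by
      simp only [mul_sub]
      rw [Finset.sum_sub_distrib, ← Finset.sum_mul, sum_neg_one_pow_fin, one_mul, pfaffian]
      push_cast
      simp only [mul_assoc]
    rw [e]
    refine Submodule.sum_mem _ fun j _ => neg_one_pow_mul_mem_iff.2 ?_
    rw [hsplit j]
    refine lead_mul (schurQTwo_sub_genProd_mem (hf (Fin.zero_le _))) (ih _ ?_)
    intro a b hab
    exact hf (Fin.succ_le_succ_iff.2 (j.strictMono_succAbove.monotone hab))

theorem map_univ_fin {α : Type*} (f : ℕ → α) (n : ℕ) :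
    ((Finset.univ : Finset (Fin n)).val.map fun i : Fin n => f i) = (Multiset.range n).map f := by
  induction n with
  | zero => rfl
  | succ n ih =>
    rw [map_univ_succAbove _ (Fin.last n), Multiset.range_succ, Multiset.map_cons, ← ih]
    simp

theorem filter_pos_map_rowLen (μ : YoungDiagram) {n : ℕ} (h : μ.colLen 0 ≤ n) :
    (((Multiset.range n).map μ.rowLen).filter fun k => 0 < k) = rowMultiset μ := by
  induction n, h using Nat.le_induction with
  | base =>
    exact Multiset.filter_eq_self.2 fun k hk => pos_of_mem_rowMultiset hk
  | succ n hn ih =>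
    rw [Multiset.range_succ, Multiset.map_cons, rowLen_eq_zero_of_le hn,
      Multiset.filter_cons_of_neg (p := fun k => 0 < k) _ (lt_irrefl 0), ih]

theorem schurQ_sub_genProd_mem (μ : YoungDiagram) :
    (schurQ μ : Lam) - genProd qLam (rowMultiset μ) ∈
      highSpan qLam μ.card (sumSq (rowMultiset μ) + 1) := by
  have h := pfaffian_sub_genProd_mem ((μ.colLen 0 + 1) / 2) (fun a => μ.rowLen a)
    fun a b hab => rowLen_antitone μ hab
  -- For an odd number of rows the Pfaffian has one additional index with row length 0. Since
  -- $q_0=1$, zero indices can be dropped.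
  rw [map_univ_fin, ← genProd_filter_pos qLam_zero, ← sumSq_filter_pos, ← sum_filter_pos,
    filter_pos_map_rowLen μ (by omega), sum_rowMultiset] at h
  exact h

theorem schurQ_mem_highSpan (μ : YoungDiagram) : (schurQ μ : Lam) ∈ highSpan qLam μ.card 0 := by
  have h := genProd_mem_highSpan (g := qLam) (s := rowMultiset μ) (Nat.zero_le _)
  rw [sum_rowMultiset] at h
  rw [← sub_add_cancel (schurQ μ : Lam) (genProd qLam (rowMultiset μ))]
  exact Submodule.add_mem _ (highSpan_mono (Nat.zero_le _) (schurQ_sub_genProd_mem μ)) h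

theorem nodup_rowMultiset_iff {μ : YoungDiagram} : (rowMultiset μ).Nodup ↔ IsStrict μ := by
  constructor
  · intro h i hi
    refine lt_of_le_of_ne (rowLen_antitone μ i.le_succ) fun he => ?_
    have h1 := rowLen_pos_iff.1 hi
    have h2 := rowLen_pos_iff.1 (he ▸ hi : 0 < μ.rowLen (i + 1))
    have := Multiset.inj_on_of_nodup_map h i (Multiset.mem_range.2 h1) (i + 1)
      (Multiset.mem_range.2 h2) he.symm
    omega
  · intro h
    have key : ∀ i j, i < j → i < μ.colLen 0 → μ.rowLen j < μ.rowLen i := fun i j hij hi =>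
      (rowLen_antitone μ hij).trans_lt (h i (rowLen_pos_iff.2 hi))
    refine Multiset.Nodup.map_on (fun i hi j hj he => ?_) (Multiset.nodup_range _)
    rw [Multiset.mem_range] at hi hj
    rcases lt_trichotomy i j with hij | hij | hij
    · exact absurd he (key i j hij hi).ne'
    · exact hij
    · exact absurd he (key j i hij hj).ne

/-! ### Linear independence of Schur's `Q`-functions -/

/-- In degree `d` the $Q_\mu$ span all products of the $q_r$: products with distinct positive
indices are leading terms, and a repeated positive index can be pushed to a larger sum of squares.
So they span the products of odd power sums, and the strict diagrams are no more numerous than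
these. -/
theorem linearIndependent_schurQ :
    LinearIndependent ℂ fun μ : {μ : YoungDiagram // IsStrict μ} => schurQ μ := by
  refine LinearIndependent.of_comp Omega.val.toLinearMap ?_
  refine linearIndependent_of_homogeneous _ (fun μ => μ.1.card)
    (fun μ m hm => highSpan_homogeneous (fun k m hm => ?_) (schurQ_mem_highSpan μ.1) m hm)
    fun d => ?_
  · rw [coeff_qLam, if_neg hm]
  have := finite_subtype_card d
  have hinj : Function.Injective
      fun μ : {μ : {μ : YoungDiagram // IsStrict μ} // μ.1.card = d} =>
        (⟨rowPartition ⟨μ.1.1, μ.2⟩, Finset.mem_filter.2 ⟨Finset.mem_univ _,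
          nodup_rowMultiset_iff.2 μ.1.2⟩⟩ : Nat.Partition.distincts d) := by
    intro μ ν h
    have := rowPartition_injective (congrArg Subtype.val h)
    exact Subtype.ext (Subtype.ext (Subtype.mk.inj this))
  have := Fintype.ofInjective _ hinj
  refine linearIndependent_of_span _
    (fun ρ : Nat.Partition.odds d => powerSumProd (ρ : Nat.Partition d).parts)
    ((linearIndependent_powerSumProd d).comp _ Subtype.val_injective) ?_ fun ρ => ?_
  · refine (Fintype.card_le_of_injective _ hinj).trans (le_of_eq ?_)
    -- Euler: partitions into distinct parts and into odd parts are equinumerous.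
    rw [Fintype.card_coe, Fintype.card_coe, Nat.Partition.card_odds_eq_card_distincts]
  have hle : highSpan qLam d 0 ≤ Submodule.span ℂ
      (Set.range fun μ : {μ : {μ : YoungDiagram // IsStrict μ} // μ.1.card = d} =>
        (schurQ μ.1 : Lam)) := by
    refine highSpan_le_of_lead _ fun s hs => ?_
    by_cases hnd : (s.filter fun k => 0 < k).Nodup
    · obtain ⟨μ, hμ⟩ := exists_rowMultiset_eq (s := s.filter fun k => 0 < k)
        fun k hk => (Multiset.mem_filter.1 hk).2
      have hc : μ.card = d := by rw [← sum_rowMultiset, hμ, sum_filter_pos, hs]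
      have hst : IsStrict μ := nodup_rowMultiset_iff.1 (hμ ▸ hnd)
      refine ⟨schurQ μ, Submodule.subset_span ⟨⟨⟨μ, hst⟩, hc⟩, rfl⟩, ?_⟩
      have h := schurQ_sub_genProd_mem μ
      rw [hμ, sumSq_filter_pos, genProd_filter_pos qLam_zero, hc] at h
      rw [← neg_sub]
      exact Submodule.neg_mem _ h
    · refine ⟨0, Submodule.zero_mem _, ?_⟩
      rw [sub_zero, ← hs]
      exact genProd_mem_of_not_nodup hnd
  refine hle ?_
  have := powerSumProd_mem_highSpan (g := qLam) ρ.1.parts fun k hk =>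
    powerSum_mem_highSpan_qLam (Nat.not_even_iff_odd.1 ((Finset.mem_filter.1 ρ.2).2 k hk))
  rwa [ρ.1.parts_sum] at this

/-! ### The bilinear forms -/

/-- Independence suffices: a left inverse of the map from the free module on `ι` pulls back the
diagonal form, and the values off the span of `v` depend on the choice. -/
theorem exists_bilinForm {ι V : Type*} [AddCommMonoid V] [Module ℂ V] [DecidableEq ι] (v : ι → V)
    (hv : LinearIndependent ℂ v) (w : ι → ℂ) :
    ∃ B : LinearMap.BilinForm ℂ V, ∀ i j, B (v i) (v j) = if i = j then w i else 0 := by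
  let _ := Module.addCommMonoidToAddCommGroup ℂ (M := V)
  obtain ⟨f, hf⟩ := LinearMap.exists_leftInverse_of_injective (Finsupp.linearCombination ℂ v)
    (LinearMap.ker_eq_bot.2 hv)
  have hf' : ∀ i, f (v i) = Finsupp.single i 1 := by
    intro i
    have := LinearMap.congr_fun hf (Finsupp.single i 1)
    simpa using this
  let B₀ : (ι →₀ ℂ) →ₗ[ℂ] (ι →₀ ℂ) →ₗ[ℂ] ℂ :=
    Finsupp.linearCombination ℂ fun i => w i • Finsupp.lapply i
  refine ⟨B₀.compl₁₂ f f, fun i j => ?_⟩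
  rw [LinearMap.compl₁₂_apply, hf', hf', Finsupp.linearCombination_single, one_smul,
    LinearMap.smul_apply, Finsupp.lapply_apply, Finsupp.single_apply, smul_eq_mul]
  simp only [eq_comm, mul_ite, mul_one, mul_zero]

theorem exists_bilinForm_dual {ι V : Type*} [AddCommMonoid V] [Module ℂ V] [DecidableEq ι]
    {P : ι → Prop} (v : ι → V) (hv : LinearIndependent ℂ fun i : {i // P i} => v i) {w : ι → ℂ}
    (hw : ∀ i, w i ≠ 0) : ∃ B : LinearMap.BilinForm ℂ V,
      ∀ i j, P i → P j → B ((w i)⁻¹ • v i) (v j) = if i = j then 1 else 0 := by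
  obtain ⟨B, hB⟩ := exists_bilinForm _ hv fun i => w i
  refine ⟨B, fun i j hi hj => ?_⟩
  have h := hB ⟨i, hi⟩ ⟨j, hj⟩
  simp only [Subtype.mk.injEq] at h
  rw [LinearMap.BilinForm.smul_left, h, mul_ite, mul_zero, inv_mul_cancel₀ (hw i)]

open Classical in
-- The form is chosen by `Classical.epsilon`, so existence of a form with the required values is all
-- there is to prove.
theorem formLam_schur (μ ν : YoungDiagram) :
    formLam (schur μ) (schur ν) = if μ = ν then 1 else 0 := by
  have h : ∃ B : LinearMap.BilinForm ℂ Lam, ∀ μ ν : YoungDiagram,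
      B (schur μ) (schur ν) = if μ = ν then 1 else 0 :=
    exists_bilinForm schur linearIndependent_schur fun _ => 1
  exact Classical.epsilon_spec h μ ν

open Classical in
theorem formOmega_schurP_schurQ {μ ν : YoungDiagram} (hμ : IsStrict μ) (hν : IsStrict ν) :
    formOmega (schurP μ) (schurQ ν) = if μ = ν then 1 else 0 := by
  have h : ∃ B : LinearMap.BilinForm ℂ Omega, ∀ μ ν : YoungDiagram, IsStrict μ → IsStrict ν →
      B (schurP μ) (schurQ ν) = if μ = ν then 1 else 0 := by
    unfold schurP
    exact exists_bilinForm_dual (w := fun μ : YoungDiagram => (2 : ℂ) ^ μ.colLen 0) schurQ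
      linearIndependent_schurQ fun μ => pow_ne_zero _ two_ne_zero
  exact Classical.epsilon_spec h μ ν hμ hν

/-! ### The pairing as a coefficient of an iterated removal operator -/

open Classical in
theorem formSym_piElt {ℓ : ℕ} {lam mu : Multipartition ℓ} (hlam : IsStrict (lam 0))
    (hmu : IsStrict (mu 0)) :
    formSym ℓ (piElt lam) (piElt mu) = if lam = mu then ((2 : ℂ) ^ (lam 0).colLen 0)⁻¹ else 0 := by
  rw [piElt, piElt, formSym_elementary, schurP.eq_def (mu 0), map_smul,
    formOmega_schurP_schurQ hlam hmu]
  simp only [formLam_schur]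
  split_ifs with h0 h h
  · subst h
    simp
  · rw [Finset.prod_ite_zero, if_neg, mul_zero]
    intro hs
    refine h (funext fun i => ?_)
    induction i using Fin.cases with
    | zero => exact h0
    | succ i => exact hs i (Finset.mem_univ i)
  · exact absurd (congrFun h 0) h0
  · simp

/-- Only equal shapes pair nontrivially, and the norm $2^{-h}$ cancels the factor $2^{h}$ in
`K_omega_eq`. What remains is the expansion of $D^d$ on the coefficient vector. -/
theorem formSym_PiElt_PiOmega {ℓ n d : ℕ} (hℓ : 1 ≤ ℓ) (c : ColoredComposition ℓ n d) :
    formSym ℓ (PiElt c) (PiOmega ℓ d) = (removeOp ℓ ^ d) (tableauVector c) (emptyMulti ℓ) := by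
  classical
  have e : PiOmega ℓ d = ∑ mu ∈ strictMultipartitions ℓ d,
      ((∑ i : Fin d → Fin ℓ, K mu (omegaComposition i) : ℕ) : ℂ) • piElt mu := by
    simp only [PiOmega, PiElt, Nat.cast_sum, Finset.sum_smul]
    exact Finset.sum_comm
  rw [e, PiElt, tableauVector, LinearMap.BilinForm.sum_left, map_sum, Finsupp.finsetSum_apply]
  refine Finset.sum_congr rfl fun lam hlam => ?_
  rw [LinearMap.BilinForm.smul_left, map_sum, Finset.sum_eq_single_of_mem lam hlam]
  · rw [map_smul, formSym_piElt (mem_strictMultipartitions.1 hlam).1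
      (mem_strictMultipartitions.1 hlam).1, if_pos rfl, K_omega_eq hℓ hlam, smul_eq_mul,
      mul_inv_cancel_right₀ (pow_ne_zero _ two_ne_zero)]
    rw [show (Finsupp.single lam (K lam c : ℂ)) = (K lam c : ℂ) • Finsupp.single lam 1 by simp,
      map_smul, Finsupp.smul_apply, smul_eq_mul]
  · intro mu hmu hne
    rw [map_smul, formSym_piElt (mem_strictMultipartitions.1 hlam).1
      (mem_strictMultipartitions.1 hmu).1, if_neg hne.symm, smul_zero]

end ColoredSym

end

theorem mainTheorem5 (ℓ n d : ℕ) (hℓ : 1 ≤ ℓ) (hn : 1 ≤ n)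
    (c : ColoredSym.ColoredComposition ℓ n d) :
    ColoredSym.formSym ℓ (ColoredSym.PiElt c) (ColoredSym.PiOmega ℓ d) =
      (Nat.multinomial Finset.univ c.part : ℂ) * 4 ^ (d - c.lastColorSize) *
        3 ^ c.lastColorSize := by
  rw [ColoredSym.formSym_PiElt_PiOmega hℓ, ColoredSym.removeOp_pow_tableauVector,
    ColoredSym.prod_colorFactor, mul_assoc]
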